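/- Let $\xi(x)=\sum_{p\ge 2}\beta_p^2x^p$ with $|\beta_p|\le p^{-2}$ for all $p\ge2$. Let $\zeta$ be a finite-RSB measure, i.e. a probability measure on $[0,1]$ with finite support $q_0<q_1<\dots<q_r=q_*$, each $q_p$ having positive mass. Put $$S_\zeta=\int_0^1\zeta([0,l])\,(l\xi''(l)+\xi'(l))\,dl,\qquad \hat S_\zeta=\xi'(q_*)(1-q_*)+\sum_{p=1}^r\big(q_p\xi'(q_p)-q_{p-1}\xi'(q_{p-1})\big)\zeta([0,q_{p-1}]),$$ and for $f\in\mathbb R$ let $\rho^f_\zeta$ be the probability measure on $\mathbb R$ with $$\rho^f_\zeta(g)=\frac{\int\!\int g(s)\,e^{-\frac{1+S_\zeta}{2}s^2}e^{-\frac{(y-f)^2}{2(\xi'(1)-\xi'(q_*))}}e^{sy}\,dy\,ds}{\int\!\int e^{-\frac{1+S_\zeta}{2}s^2}e^{-\frac{(y-f)^2}{2(\xi'(1)-\xi'(q_*))}}e^{sy}\,dy\,ds}$$ (if $\xi'(1)=\xi'(q_*)$, the normalised Gaussian weight in $y$ is replaced by the point mass at $f$). Let $(w_\alpha)_{\alpha\in\mathbb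 N^r}$ be the weights of the Ruelle probability cascade with parameters $\zeta([0,q_0])<\dots<\zeta([0,q_{r-1}])$: attach to the nodes of the tree $\bigcup_{p\le r}\mathbb N^p$ of depth $p<r$ independent Poisson processes on $(0,\infty)$ with intensity $m\,x^{-1-m}dx$, $m=\zeta([0,q_p])$, assign their decreasingly ordered points to the children, multiply the points along the path to $\alpha$ and normalise. Independently of $w$, let $Z^1,\dots,Z^n$ be independent centred Gaussian fields with $\mathrm{Cov}(Z^i(h_\alpha),Z^i(h_\gamma))=\xi'(\langle h_\alpha,h_\gamma\rangle)$, where $\langle h_\alpha,h_\gamma\rangle=q_{p}$ if $p$ is the depth of the last common node of the paths to $\alpha$ and $\gamma$; equivalently, $Z^i(h_\alpha)$ is the sum over the nodes $b$ of the path from the root to $\alpha$ of independent centred Gaussian variables $z^i_b$ of variance $\xi'(q_0)$ at the root and $\xi'(q_{p})-\xi'(q_{p-1})$ at depth $p\ge1$. The tilted fields $(Z^i)'$, $1\le i\le n$, are independent of each other and of $w$ and are defined as follows. Put $X_r(x_0,\dots,x_r)=\frac{(x_0+\dots+x_r)^2}{2(1+\hat S_\zeta)}$ and, for $0\le p<r$,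 $$X_p(x_0,\dots,x_p)=\frac1{\zeta([0,q_p])}\log\mathbb E\exp\big(\zeta([0,q_p])X_{p+1}(x_0,\dots,x_p,z)\big),\qquad z\sim N(0,\xi'(q_{p+1})-\xi'(q_p)).$$ Then $(Z^i)'(h_\alpha)$ is the sum of variables $(z^i_b)'$ over the path to $\alpha$, generated from the root downwards: $(z^i_b)'\sim N(0,\xi'(q_0))$ at the root, and, given the values $x_0,\dots,x_p$ at the ancestors of a node $b$ of depth $p+1$, the variable $(z^i_b)'$ is drawn, independently for different nodes, from the law with density $e^{\zeta([0,q_p])(X_{p+1}(x_0,\dots,x_p,z)-X_p(x_0,\dots,x_p))}$ with respect to $N(0,\xi'(q_{p+1})-\xi'(q_p))$. Let $k,n\ge0$, let $e_{l,i}\ge0$ be integers ($1\le l\le k$, $1\le i\le n$), and for $0<C\le\infty$ let $$F^{C}(\zeta)=\mathbb E\prod_{l=1}^k\frac{\sum_\alpha w_\alpha\prod_{i=1}^n\int_{-C}^Cs^{e_{l,i}}e^{-\frac12[1+\hat S_\zeta]s^2+Z^i(h_\alpha)s}\,ds}{\sum_\alpha w_\alpha\prod_{i=1}^n\int_{-C}^Ce^{-\frac12[1+\hat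 S_\zeta]s^2+Z^i(h_\alpha)s}\,ds}.$$ Then all the series below and in $F^C(\zeta)$ converge almost surely, the denominators are positive almost surely, the random variables under the expectations are integrable, and $$\lim_{C\to\infty}F^{C}(\zeta)=F^\infty(\zeta)=\mathbb E\prod_{l=1}^k\frac{\sum_\alpha w_\alpha\prod_{i=1}^n\rho_\zeta^{Z^i(h_\alpha)}(s^{e_{l,i}})\,e^{\frac{Z^i(h_\alpha)^2}{2[1+\hat S_\zeta]}}}{\sum_\alpha w_\alpha\prod_{i=1}^ne^{\frac{Z^i(h_\alpha)^2}{2[1+\hat S_\zeta]}}}=\mathbb E\prod_{l=1}^k\sum_\alpha w_\alpha\prod_{i=1}^n\rho_\zeta^{(Z^i)'(h_\alpha)}(s^{e_{l,i}}).$$ Moreover, if $(\zeta_j)_{j\in\mathbb N}$ is a sequence of finite-RSB measures converging weakly to a probability measure $\zeta^*$, then $\lim_{C\to\infty}\sup_j|F^C(\zeta_j)-F^\infty(\zeta_j)|=0$. -/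

import Mathlib

open MeasureTheory ProbabilityTheory Filter Topology

noncomputable section

/-! ### The mixture and finitely supported overlap distributions -/

/-- First derivative on `[0,1]` of the mixture `ξ(x) = ∑_{p ≥ 2} β_p² x^p`
(differentiated term by term, so that the endpoint `1` is included). -/
def xiD (β : ℕ → ℝ) (x : ℝ) : ℝ :=
  ∑' p : ℕ, if 2 ≤ p then (p : ℝ) * β p ^ 2 * x ^ (p - 1) else 0

/-- Second derivative on `[0,1]` of the mixture `ξ`. -/
def xiDD (β : ℕ → ℝ) (x : ℝ) : ℝ :=
  ∑' p : ℕ, if 2 ≤ p then (p : ℝ) * ((p : ℝ) - 1) * β p ^ 2 * x ^ (p - 2) else 0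

/-- A probability measure on `[0,1]` with finite support `q 0 < q 1 < ⋯ < q r`, the atom `q p`
having mass `mass p > 0` (values of `q`, `mass` at indices `> r` are irrelevant). -/
structure FiniteRSB where
  r : ℕ
  q : ℕ → ℝ
  mass : ℕ → ℝ
  q_nonneg : 0 ≤ q 0
  q_lt : ∀ p < r, q p < q (p + 1)
  q_le_one : q r ≤ 1
  mass_pos : ∀ p ≤ r, 0 < mass p
  mass_sum : ∑ p ∈ Finset.range (r + 1), mass p = 1

namespace FiniteRSB

/-- The measure `ζ = ∑_p mass p · δ_{q p}`. -/
def measure (ζ : FiniteRSB) : Measure ℝ :=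
  ∑ p ∈ Finset.range (ζ.r + 1), ENNReal.ofReal (ζ.mass p) • Measure.dirac (ζ.q p)

instance (ζ : FiniteRSB) : IsProbabilityMeasure ζ.measure := by
  constructor
  simp only [measure, Measure.coe_finsetSum, Finset.sum_apply, Measure.smul_apply,
    measure_univ, smul_eq_mul, mul_one]
  rw [← ENNReal.ofReal_sum_of_nonneg, ζ.mass_sum, ENNReal.ofReal_one]
  intro p hp
  exact (ζ.mass_pos p (by simpa [Nat.lt_succ_iff] using hp)).le

/-- `ζ` as an element of the space of probability measures with the weak topology. -/
def law (ζ : FiniteRSB) : ProbabilityMeasure ℝ := ⟨ζ.measure, inferInstance⟩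

/-- The distribution function `t ↦ ζ([0,t])`. -/
def cdf (ζ : FiniteRSB) (t : ℝ) : ℝ := ζ.measure.real (Set.Icc 0 t)

/-- The largest point of the support, `q_*`. -/
def qStar (ζ : FiniteRSB) : ℝ := ζ.q ζ.r

/-- `S_ζ = ∫_0^1 ζ([0,l]) (l ξ''(l) + ξ'(l)) dl`. -/
def S (ζ : FiniteRSB) (β : ℕ → ℝ) : ℝ :=
  ∫ l in (0 : ℝ)..1, ζ.cdf l * (l * xiDD β l + xiD β l)

/-- `Ŝ_ζ = ξ'(q_*)(1 - q_*) + ∑_{p=1}^r (q_p ξ'(q_p) - q_{p-1} ξ'(q_{p-1})) ζ([0,q_{p-1}])`. -/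
def Shat (ζ : FiniteRSB) (β : ℕ → ℝ) : ℝ :=
  xiD β ζ.qStar * (1 - ζ.qStar) +
    ∑ p ∈ Finset.range ζ.r,
      (ζ.q (p + 1) * xiD β (ζ.q (p + 1)) - ζ.q p * xiD β (ζ.q p)) * ζ.cdf (ζ.q p)

/-- Variance of the increment of the cavity field at depth `p` of the tree:
`ξ'(q_0)` at the root and `ξ'(q_p) - ξ'(q_{p-1})` at depth `p ≥ 1`. -/
def incVar (ζ : FiniteRSB) (β : ℕ → ℝ) : ℕ → ℝ
  | 0 => xiD β (ζ.q 0)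
  | p + 1 => xiD β (ζ.q (p + 1)) - xiD β (ζ.q p)

/-- The spin measure `ρ_ζ^f` applied to `g`: the quotient of
`∫∫ g(s) exp(-(1+S_ζ)s²/2) exp(-(y-f)²/(2(ξ'(1)-ξ'(q_*)))) exp(sy) dy ds` by the same integral with
`g = 1`. The Gaussian weight in `y` is written as the normalised Gaussian law, whose constant
cancels; it is the point mass at `f` if `ξ'(1) = ξ'(q_*)`. -/
def rho (ζ : FiniteRSB) (β : ℕ → ℝ) (f : ℝ) (g : ℝ → ℝ) : ℝ :=
  (∫ s : ℝ, ∫ y : ℝ, g s * Real.exp (-((1 + ζ.S β) / 2) * s ^ 2) * Real.exp (s * y)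
      ∂(gaussianReal f (xiD β 1 - xiD β ζ.qStar).toNNReal)) /
    (∫ s : ℝ, ∫ y : ℝ, Real.exp (-((1 + ζ.S β) / 2) * s ^ 2) * Real.exp (s * y)
      ∂(gaussianReal f (xiD β 1 - xiD β ζ.qStar).toNNReal))

end FiniteRSB

/-! ### The Ruelle probability cascade

The tree has the finite sequences of natural numbers as nodes, the empty sequence as root, and the
sequences of length `r` as leaves. -/

/-- Leaves of the tree of depth `r`. -/
abbrev Leaf (r : ℕ) : Type := Fin r → ℕ

/-- The ancestor at depth `p` of the leaf `α` (the root for `p = 0`, `α` itself for `p = r`). -/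
def ancestor {r : ℕ} (α : Leaf r) (p : ℕ) : List ℕ := (List.ofFn α).take p

instance isProbabilityMeasure_expMeasure_one : IsProbabilityMeasure (expMeasure 1) :=
  isProbabilityMeasure_expMeasure one_pos

/-- Noise of the cascade: an exponential variable for each node and each of its children. -/
abbrev CascadeNoise : Type := List ℕ × ℕ → ℝ

/-- The exponential variables are i.i.d. with mean one. -/
def cascadeLaw : Measure CascadeNoise := Measure.infinitePi fun _ => expMeasure 1

/-- The points, in decreasing order, of the Poisson process on `(0,∞)` with mean measure
`m x^{-1-m} dx` that is attached to the node `b`: `u_{b,j} = Γ_j^{-1/m}` with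
`Γ_0 < Γ_1 < ⋯` the arrival times of a unit rate Poisson process. -/
def poissonPoint (m : ℝ) (ε : CascadeNoise) (b : List ℕ) (j : ℕ) : ℝ :=
  (∑ i ∈ Finset.range (j + 1), ε (b, i)) ^ (-(1 / m))

namespace FiniteRSB

/-- Unnormalised weight of a leaf: the product along its path; the points attached to
a node of depth `p` have parameter `ζ([0,q_p])`. -/
def rawWeight (ζ : FiniteRSB) (ε : CascadeNoise) (α : Leaf ζ.r) : ℝ :=
  ∏ p : Fin ζ.r, poissonPoint (ζ.cdf (ζ.q p)) ε (ancestor α p) (α p)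

/-- The weights `w_α` of the cascade. -/
def weight (ζ : FiniteRSB) (ε : CascadeNoise) (α : Leaf ζ.r) : ℝ :=
  ζ.rawWeight ε α / ∑' γ : Leaf ζ.r, ζ.rawWeight ε γ

end FiniteRSB

/-! ### The cavity fields -/

/-- Noise of `n` cavity fields: a real variable for each field and each node. -/
abbrev FieldNoise (n : ℕ) : Type := Fin n × List ℕ → ℝ

/-- I.i.d. standard Gaussian variables. -/
def fieldLaw (n : ℕ) : Measure (FieldNoise n) := Measure.infinitePi fun _ => gaussianReal 0 1

/-- The field `Z^i(h_α) = ∑_{b ≤ α} z^i_b`, where the `z^i_b` are independent centred Gaussian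
variables of variance `incVar` at the depth of `b`. Two leaves whose paths separate after depth `p`
share exactly the increments up to depth `p`, so that `Cov(Z^i(h_α), Z^i(h_γ)) = ξ'(q_p)`
with `q_p = ⟨h_α, h_γ⟩`. -/
def cavityField (ζ : FiniteRSB) (β : ℕ → ℝ) {n : ℕ} (g : FieldNoise n) (i : Fin n)
    (α : Leaf ζ.r) : ℝ :=
  ∑ p ∈ Finset.range (ζ.r + 1), Real.sqrt (ζ.incVar β p) * g (i, ancestor α p)

/-- The functions `X_p`, indexed by the number `j = r - p` of remaining levels and evaluated at the
list of increments `[x_0, …, x_p]` (with `x_0` the increment at the root):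
`X_r(x) = (∑ x_i)² / (2(1+Ŝ_ζ))` and
`X_p(x) = ζ([0,q_p])⁻¹ log E exp(ζ([0,q_p]) X_{p+1}(x, x_{p+1}))`, with `E` the expectation over
the centred Gaussian increment `x_{p+1}`. -/
def potentialAux (ζ : FiniteRSB) (β : ℕ → ℝ) : ℕ → List ℝ → ℝ
  | 0, x => x.sum ^ 2 / (2 * (1 + ζ.Shat β))
  | j + 1, x =>
      1 / ζ.cdf (ζ.q (ζ.r - (j + 1))) *
        Real.log (∫ z, Real.exp (ζ.cdf (ζ.q (ζ.r - (j + 1))) * potentialAux ζ β j (x ++ [z]))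
          ∂(gaussianReal 0 (ζ.incVar β (ζ.r - j)).toNNReal))

/-- The function `X_p`. -/
def potential (ζ : FiniteRSB) (β : ℕ → ℝ) (p : ℕ) (x : List ℝ) : ℝ :=
  potentialAux ζ β (ζ.r - p) x

/-- Law of the tilted increment at depth `p` given the list `x` of the tilted increments at the
depths `0, …, p - 1` on the path to the root: at depth `p + 1` it has density
`exp(ζ([0,q_p]) (X_{p+1}(x,z) - X_p(x)))` with respect to the law of the Gaussian increment; the
increment at the root, common to all leaves, is not tilted. -/
def tiltedKernel (ζ : FiniteRSB) (β : ℕ → ℝ) : ℕ → List ℝ → Measure ℝ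
  | 0, _ => gaussianReal 0 (ζ.incVar β 0).toNNReal
  | p + 1, x =>
      (gaussianReal 0 (ζ.incVar β (p + 1)).toNNReal).withDensity fun z =>
        ENNReal.ofReal (Real.exp
          (ζ.cdf (ζ.q p) * (potential ζ β (p + 1) (x ++ [z]) - potential ζ β p x)))

/-- Quantile function of a law on the line: if `u` is uniform on `[0,1]`, then
`quantile μ u` has law `μ` (see `map_quantile`). -/
def quantile (μ : Measure ℝ) (u : unitInterval) : ℝ := sInf {x : ℝ | (u : ℝ) ≤ μ.real (Set.Iic x)}

theorem quantile_le_iff (μ : Measure ℝ) [IsProbabilityMeasure μ] {u : unitInterval}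
    (h0 : 0 < (u : ℝ)) (h1 : (u : ℝ) < 1) (t : ℝ) :
    quantile μ u ≤ t ↔ (u : ℝ) ≤ μ.real (Set.Iic t) := by
  simp only [quantile, ← ProbabilityTheory.cdf_eq_real]
  set s : Set ℝ := {x : ℝ | (u : ℝ) ≤ ProbabilityTheory.cdf μ x} with hs
  have hne : s.Nonempty := by
    obtain ⟨x, hx⟩ := ((tendsto_cdf_atTop μ).eventually (eventually_gt_nhds h1)).exists
    exact ⟨x, hx.le⟩
  have hbdd : BddBelow s := by
    obtain ⟨x, hx⟩ := ((tendsto_cdf_atBot μ).eventually (eventually_lt_nhds h0)).exists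
    refine ⟨x, fun y hy => ?_⟩
    by_contra! hyx
    exact absurd (hy.trans (monotone_cdf μ hyx.le)) (not_le.mpr hx)
  constructor
  · intro h
    have hright : Tendsto (ProbabilityTheory.cdf μ) (𝓝[>] t) (𝓝 (ProbabilityTheory.cdf μ t)) :=
      ((ProbabilityTheory.cdf μ).right_continuous t).mono_left
        (nhdsWithin_mono _ Set.Ioi_subset_Ici_self)
    refine ge_of_tendsto hright ?_
    filter_upwards [self_mem_nhdsWithin] with y hy
    obtain ⟨x, hx, hxy⟩ := exists_lt_of_csInf_lt hne (h.trans_lt hy)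
    exact hx.trans (monotone_cdf μ hxy.le)
  · exact fun h => csInf_le hbdd h

theorem map_quantile (μ : Measure ℝ) [IsProbabilityMeasure μ] :
    (volume : Measure unitInterval).map (quantile μ) = μ := by
  have hae : ∀ᵐ u : unitInterval, 0 < (u : ℝ) ∧ (u : ℝ) < 1 := by
    have h : ∀ a : unitInterval, ∀ᵐ u : unitInterval, u ≠ a := fun a => by
      simp [ae_iff]
    filter_upwards [h 0, h 1] with u hu0 hu1
    exact ⟨lt_of_le_of_ne u.2.1 fun h => hu0 (Subtype.ext h.symm),
      lt_of_le_of_ne u.2.2 fun h => hu1 (Subtype.ext h)⟩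
  have hset : ∀ t : ℝ, (quantile μ ⁻¹' Set.Iic t : Set unitInterval) =ᵐ[volume]
      {u : unitInterval | (u : ℝ) ≤ μ.real (Set.Iic t)} := fun t => by
    filter_upwards [hae] with u hu
    exact propext (quantile_le_iff μ hu.1 hu.2 t)
  have hm : ∀ t : ℝ, MeasurableSet {u : unitInterval | (u : ℝ) ≤ μ.real (Set.Iic t)} :=
    fun t => measurableSet_le measurable_subtype_coe measurable_const
  have hmeas : AEMeasurable (quantile μ) (volume : Measure unitInterval) := by
    have hmI : @Measurable (NullMeasurableSpace unitInterval (volume : Measure unitInterval)) ℝ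
        _ _ (quantile μ) := measurable_of_Iic fun t =>
      ((hm t).nullMeasurableSet (μ := (volume : Measure unitInterval))).congr (hset t).symm
    have this : NullMeasurable (quantile μ) (volume : Measure unitInterval) := fun A hA => hmI hA
    exact this.aemeasurable
  have hp := Measure.isProbabilityMeasure_map hmeas
  refine Measure.ext_of_Iic _ _ fun t => ?_
  rw [Measure.map_apply_of_aemeasurable hmeas measurableSet_Iic, measure_congr (hset t)]
  change volume (Set.Iic (⟨μ.real (Set.Iic t), measureReal_nonneg, measureReal_le_one⟩ :
    unitInterval)) = _
  rw [unitInterval.volume_Iic]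
  exact ofReal_measureReal

/-- Noise of `n` tilted fields: a number in `[0,1]` for each field and each node. -/
abbrev UniformNoise (n : ℕ) : Type := Fin n × List ℕ → unitInterval

/-- I.i.d. uniform variables. -/
def uniformLaw (n : ℕ) : Measure (UniformNoise n) := Measure.infinitePi fun _ => volume

/-- The tilted increments `z'` of the field `i` at the depths `0, …, p - 1` on the path to `α`.
They are generated iteratively, the increment at a node being sampled from `tiltedKernel` at the
increments of its ancestors, with fresh randomness at every node. -/
def tiltedIncrements (ζ : FiniteRSB) (β : ℕ → ℝ) {n : ℕ} (U : UniformNoise n) (i : Fin n)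
    (α : Leaf ζ.r) : ℕ → List ℝ
  | 0 => []
  | p + 1 =>
      tiltedIncrements ζ β U i α p ++
        [quantile (tiltedKernel ζ β p (tiltedIncrements ζ β U i α p)) (U (i, ancestor α p))]

/-- The tilted cavity field `(Z^i)'(h_α)`. -/
def tiltedField (ζ : FiniteRSB) (β : ℕ → ℝ) {n : ℕ} (U : UniformNoise n) (i : Fin n)
    (α : Leaf ζ.r) : ℝ :=
  (tiltedIncrements ζ β U i α (ζ.r + 1)).sum

/-! ### The four expectations -/

/-- `∑_α w_α ∏_i A i (Z^i(h_α))`. -/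
def cascadeSum (ζ : FiniteRSB) (β : ℕ → ℝ) {n : ℕ} (A : Fin n → ℝ → ℝ)
    (ω : CascadeNoise × FieldNoise n) : ℝ :=
  ∑' α : Leaf ζ.r, ζ.weight ω.1 α * ∏ i, A i (cavityField ζ β ω.2 i α)

/-- `∏_{l=1}^k (∑_α w_α ∏_i A l i (Z^i(h_α))) / (∑_α w_α ∏_i B (Z^i(h_α)))`. -/
def replicaRatio (ζ : FiniteRSB) (β : ℕ → ℝ) {k n : ℕ} (A : Fin k → Fin n → ℝ → ℝ) (B : ℝ → ℝ)
    (ω : CascadeNoise × FieldNoise n) : ℝ :=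
  ∏ l, cascadeSum ζ β (A l) ω / cascadeSum ζ β (fun _ => B) ω

/-- Joint law of the cascade and of the independent cavity fields. -/
def cavityLaw (n : ℕ) : Measure (CascadeNoise × FieldNoise n) := cascadeLaw.prod (fieldLaw n)

/-- Joint law of the cascade and of the independent tilted fields. -/
def tiltedLaw (n : ℕ) : Measure (CascadeNoise × UniformNoise n) := cascadeLaw.prod (uniformLaw n)

/-- `E replicaRatio` makes sense: almost surely all series converge and
the denominator is positive, and the product of the ratios is integrable. -/
def RatioWellDefined (ζ : FiniteRSB) (β : ℕ → ℝ) {k n : ℕ} (A : Fin k → Fin n → ℝ → ℝ)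
    (B : ℝ → ℝ) : Prop :=
  (∀ᵐ ω ∂(cavityLaw n),
    (∀ l, Summable fun α : Leaf ζ.r => ζ.weight ω.1 α * ∏ i, A l i (cavityField ζ β ω.2 i α)) ∧
    (Summable fun α : Leaf ζ.r => ζ.weight ω.1 α * ∏ i : Fin n, B (cavityField ζ β ω.2 i α)) ∧
    0 < cascadeSum ζ β (fun _ : Fin n => B) ω) ∧
  Integrable (replicaRatio ζ β A B) (cavityLaw n)

/-- `∫_{-C}^C s^d exp(-(1+Ŝ_ζ)s²/2 + xs) ds`. -/
def cutMoment (ζ : FiniteRSB) (β : ℕ → ℝ) (C : ℝ) (d : ℕ) (x : ℝ) : ℝ :=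
  ∫ s in (-C)..C, s ^ d * Real.exp (-(1 / 2) * (1 + ζ.Shat β) * s ^ 2 + x * s)

/-- `∫_{-∞}^∞ s^d exp(-(1+Ŝ_ζ)s²/2 + xs) ds`. -/
def fullMoment (ζ : FiniteRSB) (β : ℕ → ℝ) (d : ℕ) (x : ℝ) : ℝ :=
  ∫ s : ℝ, s ^ d * Real.exp (-(1 / 2) * (1 + ζ.Shat β) * s ^ 2 + x * s)

/-- `exp(x² / (2(1+Ŝ_ζ)))`. -/
def gaussTilt (ζ : FiniteRSB) (β : ℕ → ℝ) (x : ℝ) : ℝ :=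
  Real.exp (x ^ 2 / (2 * (1 + ζ.Shat β)))

/-- `ρ_ζ^x(s^d) exp(x² / (2(1+Ŝ_ζ)))`. -/
def rhoMoment (ζ : FiniteRSB) (β : ℕ → ℝ) (d : ℕ) (x : ℝ) : ℝ :=
  ζ.rho β x (fun s => s ^ d) * gaussTilt ζ β x

/-- The expectation with cutoff `C`, i.e. `F^{C,E}(ζ)`. -/
def cutoffExpectation (ζ : FiniteRSB) (β : ℕ → ℝ) {k n : ℕ} (e : Fin k → Fin n → ℕ) (C : ℝ) : ℝ :=
  ∫ ω, replicaRatio ζ β (fun l i => cutMoment ζ β C (e l i)) (cutMoment ζ β C 0) ω ∂(cavityLaw n)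

/-- The expectation without cutoff. -/
def fullExpectation (ζ : FiniteRSB) (β : ℕ → ℝ) {k n : ℕ} (e : Fin k → Fin n → ℕ) : ℝ :=
  ∫ ω, replicaRatio ζ β (fun l i => fullMoment ζ β (e l i)) (fullMoment ζ β 0) ω ∂(cavityLaw n)

/-- The expectation without cutoff, after integration of the spins. -/
def rhoExpectation (ζ : FiniteRSB) (β : ℕ → ℝ) {k n : ℕ} (e : Fin k → Fin n → ℕ) : ℝ :=
  ∫ ω, replicaRatio ζ β (fun l i => rhoMoment ζ β (e l i)) (gaussTilt ζ β) ω ∂(cavityLaw n)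

/-- `∏_i ρ_ζ^{(Z^i)'(h_α)}(s^{d_i})`. -/
def tiltedMoment (ζ : FiniteRSB) (β : ℕ → ℝ) {n : ℕ} (d : Fin n → ℕ) (U : UniformNoise n)
    (α : Leaf ζ.r) : ℝ :=
  ∏ i, ζ.rho β (tiltedField ζ β U i α) (fun s => s ^ d i)

/-- `∏_{l=1}^k ∑_α w_α ∏_i ρ_ζ^{(Z^i)'(h_α)}(s^{e_{l,i}})`. -/
def tiltedProduct (ζ : FiniteRSB) (β : ℕ → ℝ) {k n : ℕ} (e : Fin k → Fin n → ℕ)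
    (ω : CascadeNoise × UniformNoise n) : ℝ :=
  ∏ l, ∑' α : Leaf ζ.r, ζ.weight ω.1 α * tiltedMoment ζ β (e l) ω.2 α

/-- The expectation in terms of the tilted field. -/
def tiltedExpectation (ζ : FiniteRSB) (β : ℕ → ℝ) {k n : ℕ} (e : Fin k → Fin n → ℕ) : ℝ :=
  ∫ ω, tiltedProduct ζ β e ω ∂(tiltedLaw n)

/-- `E tiltedProduct` makes sense. -/
def TiltedWellDefined (ζ : FiniteRSB) (β : ℕ → ℝ) {k n : ℕ} (e : Fin k → Fin n → ℕ) : Prop :=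
  (∀ᵐ ω ∂(tiltedLaw n), ∀ l,
    Summable fun α : Leaf ζ.r => ζ.weight ω.1 α * tiltedMoment ζ β (e l) ω.2 α) ∧
  Integrable (tiltedProduct ζ β e) (tiltedLaw n)

end

/-! There are three independent arguments: a uniform estimate for the cutoff, a Gaussian computation
for the spins, and an identity in law for the tilted cascade.

Cutoff. Since ξ'(1) ≤ 1/4, the coefficient 1 + Ŝ lies in [1, 5/4]. Each moment integral is therefore
at most a constant times exp(x²), while the integral of order zero has a positive lower bound
independent of x (`momentOn_zero_ge`). Everything is compared with the single variable H = ∑ w_α ∏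
exp(Z^i(h_α)²). Its mean is bounded uniformly in ζ: the weights sum to one and are independent of
the fields, whose variance is at most 1/4 (`lintegral_squareSum_le`). Jensen's inequality, applied
once to the spin integral and once to the Gibbs average, bounds any power of one ratio by a constant
times H (`abs_gibbs_pow_le`). Hence a product of k ratios is dominated by H, and removing the cutoff
changes it by at most a constant times √δ H, where δ is a tail of Gaussian moments
(`abs_prod_sub_le_of_pow_le`). The error after integration depends only on the exponents and on C
(`abs_cutoffExpectation_sub_le`), which gives the limit and its uniformity at once.

Spins. S exceeds Ŝ by exactly the variance of y in ρ (`S_eq_Shat`), so integrating out y leaves the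
weight exp(-(1+Ŝ)s²/2 + xs). Its mass is exp(x²/(2(1+Ŝ))) up to a factor independent of x, and such
a factor cancels in the ratios.

Tilt. For the Poisson points Γ_j^{-1/m} with i.i.d. marks Y_j, the Laplace transform of ∑ Γ_j^{-1/m}
Y_j is exp(-c_m E Y^m) (`lintegral_expNeg_stableSum`). The marks enter only through E Y^m, and E Y^m
is in turn determined by the Laplace transform of Y (`lintegral_rpow_eq_of_laplace`). With the
contribution of a subtree as mark, both facts can be iterated along the tree. Because X_p is defined
by normalising exp(m X_{p+1}), reweighting by exp(X) and replacing each Gaussian increment by its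
tilted version have the same effect at every level, up to the factor exp(X_0) that depends on the
root alone (`laplace_treeSum_tilt`). Applied to linear combinations of test functions, this is an
identity of joint laws (`map_treeSum_tilt`). The replica ratios are homogeneous of degree zero in
the weighted sums, so conditionally on the root this factor drops out, and the root increment is not
tilted (`map_gaussTree_eq_map_tiltTree`). Almost sure finiteness is transported by the same
identity, starting from the fractional moments of the cascade (`lintegral_treeSum_one_rpow_lt_top`).
-/

open scoped ENNReal

/-! ### Product measures indexed by sequences and trees -/

section InfiniteProducts

/-- Pairing two independent families coordinatewise yields a product measure. -/
theorem infinitePi_prod_map_pair {ι X Y : Type*} [MeasurableSpace X] [MeasurableSpace Y]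
    (μ : Measure X) (ν : Measure Y) [IsProbabilityMeasure μ] [IsProbabilityMeasure ν] :
    ((Measure.infinitePi fun _ : ι => μ).prod (Measure.infinitePi fun _ : ι => ν)).map
        (fun ω i => (ω.1 i, ω.2 i)) = Measure.infinitePi fun _ : ι => μ.prod ν := by
  classical
  refine (Measure.isProjectiveLimit_infinitePi fun _ : ι => μ.prod ν).unique
    (fun s => (Measure.pi_eq_generateFrom
      (C := fun _ => Set.image2 (· ×ˢ ·) {s : Set X | MeasurableSet s} {t : Set Y | MeasurableSet t})
      (fun _ => generateFrom_prod) (fun _ => isPiSystem_prod)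
      (fun _ => ⟨fun _ => Set.univ, fun _ => ⟨Set.univ, .univ, Set.univ, .univ, by simp⟩,
        fun _ => by simp, by simp [Set.iUnion_const]⟩) fun t ht => ?_).symm) |>.symm
  choose a ha b hb hab using ht
  let a' : ι → Set X := fun i => if h : i ∈ s then a ⟨i, h⟩ else Set.univ
  let b' : ι → Set Y := fun i => if h : i ∈ s then b ⟨i, h⟩ else Set.univ
  have ha' : ∀ i, MeasurableSet (a' i) := fun i => by
    by_cases h : i ∈ s <;> simp only [a', h, dite_true, dite_false]
    exacts [ha _, .univ]
  have hb' : ∀ i, MeasurableSet (b' i) := fun i => by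
    by_cases h : i ∈ s <;> simp only [b', h, dite_true, dite_false]
    exacts [hb _, .univ]
  rw [Measure.map_map (by fun_prop) (by fun_prop),
    Measure.map_apply (by fun_prop) (.univ_pi fun i => hab i ▸ (ha i).prod (hb i))]
  have hpre : (s.restrict ∘ fun (ω : (ι → X) × (ι → Y)) i => (ω.1 i, ω.2 i)) ⁻¹'
      Set.univ.pi t = (s : Set ι).pi a' ×ˢ (s : Set ι).pi b' := by
    ext ω
    simp only [Set.mem_preimage, Set.mem_pi, Set.mem_univ, true_imp_iff, Function.comp_apply,
      Finset.restrict_def, Set.mem_prod, ← forall_and, Finset.mem_coe, Subtype.forall, ← hab]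
    refine forall_congr' fun i => ?_
    by_cases h : i ∈ s <;> simp [a', b', h]
  rw [hpre, Measure.prod_prod, Measure.infinitePi_pi _ (fun i _ => ha' i),
    Measure.infinitePi_pi _ (fun i _ => hb' i), ← Finset.prod_mul_distrib, ← Finset.prod_coe_sort]
  refine Finset.prod_congr rfl fun i _ => ?_
  simp only [← hab, Measure.prod_prod]
  simp [a', b']

/-- Separating one coordinate from others. -/
theorem infinitePi_map_option {ι κ X : Type*} [MeasurableSpace X] (μ : Measure X)
    [IsProbabilityMeasure μ] (i₀ : ι) (f : κ → ι) (hf : Function.Injective f)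
    (h₀ : ∀ k, f k ≠ i₀) :
    (Measure.infinitePi fun _ : ι => μ).map (fun ω => (ω i₀, fun k => ω (f k))) =
      μ.prod (Measure.infinitePi fun _ : κ => μ) := by
  classical
  let G : X × (κ → X) → Option κ → X := fun p o => o.elim p.1 p.2
  have hG : Measurable G := by
    refine measurable_pi_iff.2 fun o => ?_
    cases o with
    | none => exact measurable_fst
    | some k => exact (measurable_pi_apply k).comp measurable_snd
  -- The case in which all coordinates are kept, modelled on `Option κ`; an injection of `Option κ`
  -- into `ι` then handles forgotten coordinates.
  have h1 : (μ.prod (Measure.infinitePi fun _ : κ => μ)).map G =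
      Measure.infinitePi fun _ : Option κ => μ := by
    refine Measure.eq_infinitePi _ fun s t ht => ?_
    rw [Measure.map_apply hG (.pi s.countable_toSet fun i _ => ht i)]
    have hpre : G ⁻¹' (s : Set (Option κ)).pi t =
        (if none ∈ s then t none else Set.univ) ×ˢ
          ((Finset.eraseNone s : Finset κ) : Set κ).pi (fun k => t (some k)) := by
      ext p
      simp only [Set.mem_preimage, Set.mem_pi, Set.mem_prod, Finset.mem_coe,
        Finset.mem_eraseNone]
      constructor
      · intro h
        refine ⟨?_, fun k hk => h (some k) hk⟩
        split_ifs with hn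
        · exact h none hn
        · trivial
      · rintro ⟨h1, h2⟩ (_ | k) ho
        · rw [if_pos ho] at h1
          exact h1
        · exact h2 k ho
    rw [hpre, Measure.prod_prod, Measure.infinitePi_pi _ (fun i _ => ht _)]
    by_cases hn : none ∈ s
    · simp only [hn, if_true]
      conv_rhs => rw [← Finset.insert_erase hn, Finset.prod_insert (by simp)]
      congr 1
      rw [← Finset.map_some_eraseNone, Finset.prod_map]
      rfl
    · simp only [hn, if_false, measure_univ, one_mul]
      conv_rhs => rw [← Finset.erase_eq_of_notMem hn]
      rw [← Finset.map_some_eraseNone, Finset.prod_map]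
      rfl
  let f' : Option κ → ι := fun o => o.elim i₀ f
  have hf' : Function.Injective f' := by
    rintro (_ | a) (_ | b) h
    · rfl
    · exact absurd h.symm (h₀ b)
    · exact absurd h (h₀ a)
    · exact congrArg some (hf h)
  have h2 := Measure.map_infinitePi_infinitePi_of_inj (P := fun _ : ι => μ) hf'
  let H : (Option κ → X) → X × (κ → X) := fun ω => (ω none, fun k => ω (some k))
  have hH : Measurable H := by fun_prop
  have h3 : (fun ω : ι → X => (ω i₀, fun k => ω (f k))) = H ∘ fun ω i => ω (f' i) := rfl
  rw [h3, ← Measure.map_map hH (by fun_prop), h2, ← h1, Measure.map_map hH hG]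
  exact Measure.map_id

theorem infinitePi_map_nat {X : Type*} [MeasurableSpace X] (μ : Measure X)
    [IsProbabilityMeasure μ] :
    (Measure.infinitePi fun _ : ℕ => μ).map (fun ω => (ω 0, fun k => ω (k + 1))) =
      μ.prod (Measure.infinitePi fun _ : ℕ => μ) :=
  infinitePi_map_option μ 0 _ (add_left_injective 1) fun k => Nat.succ_ne_zero k

/-- Decomposition of i.i.d. labels of the infinite tree into the label of the root and the labels
of the subtrees rooted at its children. -/
theorem infinitePi_map_tree {X : Type*} [MeasurableSpace X] (μ : Measure X)
    [IsProbabilityMeasure μ] :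
    (Measure.infinitePi fun _ : List ℕ => μ).map (fun ω => (ω [], fun a b => ω (a :: b))) =
      μ.prod (Measure.infinitePi fun _ : ℕ => Measure.infinitePi fun _ : List ℕ => μ) := by
  have h := infinitePi_map_option μ ([] : List ℕ) (fun p : ℕ × List ℕ => p.1 :: p.2)
    (fun p q h => by simpa [Prod.ext_iff] using h) (fun p => List.cons_ne_nil _ _)
  have hc := Measure.infinitePi_map_curry (fun (_ : ℕ) (_ : List ℕ) => μ)
  have hp : μ.prod ((Measure.infinitePi fun _ : ℕ × List ℕ => μ).map
      (MeasurableEquiv.curry ℕ (List ℕ) X)) = (μ.prod (Measure.infinitePi fun _ => μ)).map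
        (Prod.map id (MeasurableEquiv.curry ℕ (List ℕ) X)) := by
    rw [← Measure.map_prod_map _ _ measurable_id (by fun_prop), Measure.map_id]
  rw [← hc, hp, ← h, Measure.map_map (by fun_prop) (by fun_prop)]
  rfl

end InfiniteProducts

noncomputable section

/-! ### The exponential on [0,∞] and the stable constant -/

/-- The function `x ↦ e^{-x}` on `[0,∞]`. -/
def expNeg (x : ℝ≥0∞) : ℝ≥0∞ := (EReal.exp x)⁻¹

theorem expNeg_zero : expNeg 0 = 1 := by simp [expNeg]

theorem expNeg_top : expNeg ⊤ = 0 := by simp [expNeg]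

theorem one_le_exp_coe (x : ℝ≥0∞) : 1 ≤ EReal.exp x := by
  simpa using EReal.coe_ennreal_nonneg x

theorem expNeg_add (x y : ℝ≥0∞) : expNeg (x + y) = expNeg x * expNeg y := by
  rw [expNeg, EReal.coe_ennreal_add, EReal.exp_add, ENNReal.mul_inv]
  · rfl
  · exact .inl (zero_lt_one.trans_le (one_le_exp_coe x)).ne'
  · exact .inr (zero_lt_one.trans_le (one_le_exp_coe y)).ne'

theorem expNeg_ofReal {x : ℝ} (hx : 0 ≤ x) :
    expNeg (ENNReal.ofReal x) = ENNReal.ofReal (Real.exp (-x)) := by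
  rw [expNeg, EReal.coe_ennreal_ofReal, max_eq_left hx, EReal.exp_coe, Real.exp_neg,
    ENNReal.ofReal_inv_of_pos (Real.exp_pos x)]

theorem expNeg_le_one (x : ℝ≥0∞) : expNeg x ≤ 1 := by
  rw [expNeg, ENNReal.inv_le_one]
  exact one_le_exp_coe x

theorem expNeg_ne_top (x : ℝ≥0∞) : expNeg x ≠ ⊤ := ((expNeg_le_one x).trans_lt ENNReal.one_lt_top).ne

theorem expNeg_strictAnti : StrictAnti expNeg := fun x y h => by
  rw [expNeg, expNeg, ENNReal.inv_lt_inv, EReal.exp_lt_exp_iff]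
  exact_mod_cast h

theorem continuous_expNeg : Continuous expNeg :=
  continuous_inv.comp (ENNReal.continuous_exp.comp continuous_coe_ennreal_ereal)

theorem measurable_expNeg : Measurable expNeg := continuous_expNeg.measurable

theorem expNeg_sum {ι : Type*} (s : Finset ι) (f : ι → ℝ≥0∞) :
    expNeg (∑ i ∈ s, f i) = ∏ i ∈ s, expNeg (f i) := by
  classical
  induction s using Finset.induction_on with
  | empty => simp [expNeg_zero]
  | insert a s ha ih => rw [Finset.sum_insert ha, Finset.prod_insert ha, expNeg_add, ih]

theorem tendsto_prod_expNeg (f : ℕ → ℝ≥0∞) :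
    Tendsto (fun N => ∏ j ∈ Finset.range N, expNeg (f j)) atTop (𝓝 (expNeg (∑' j, f j))) := by
  simp only [← expNeg_sum]
  exact (continuous_expNeg.tendsto _).comp (ENNReal.tendsto_nat_tsum f)

theorem one_sub_expNeg_le (x : ℝ≥0∞) : 1 - expNeg x ≤ x := by
  induction x with
  | top => simp
  | coe x =>
    rw [← ENNReal.ofReal_coe_nnreal, expNeg_ofReal x.coe_nonneg, tsub_le_iff_right,
      ← ENNReal.ofReal_add x.coe_nonneg (Real.exp_pos _).le, ← ENNReal.ofReal_one]
    refine ENNReal.ofReal_le_ofReal ?_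
    linarith [Real.add_one_le_exp (-(x : ℝ))]

/-- The constant `∫_0^∞ (1 - exp(-t^{-1/m})) dt`. -/
def stableConst (m : ℝ) : ℝ≥0∞ :=
  ∫⁻ t in Set.Ioi (0 : ℝ), (1 - expNeg (ENNReal.ofReal (t ^ (-(1 / m)))))

theorem stableConst_pos (m : ℝ) : 0 < stableConst m := by
  rw [stableConst, setLIntegral_pos_iff (by
    exact measurable_const.sub (measurable_expNeg.comp (by fun_prop)))]
  have : Function.support (fun t : ℝ => 1 - expNeg (ENNReal.ofReal (t ^ (-(1 / m))))) ∩
      Set.Ioi 0 = Set.Ioi 0 := by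
    refine Set.inter_eq_right.2 fun t ht => ?_
    have h : expNeg (ENNReal.ofReal (t ^ (-(1 / m)))) < 1 := by
      rw [← expNeg_zero]
      exact expNeg_strictAnti (ENNReal.ofReal_pos.2 (Real.rpow_pos_of_pos ht _))
    exact (tsub_pos_of_lt h).ne'
  rw [this]
  simp

/-- A bound of stable type is integrable. -/
theorem lintegral_one_sub_expNeg_rpow_lt_top {c : ℝ≥0∞} (hc : c ≠ ⊤) {a : ℝ} (ha : 1 < a) :
    ∫⁻ t in Set.Ioi (0 : ℝ), (1 - expNeg (c * ENNReal.ofReal (t ^ (-a)))) < ⊤ := by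
  rw [← Set.Ioc_union_Ioi_eq_Ioi zero_le_one,
    lintegral_union measurableSet_Ioi (Set.Ioc_disjoint_Ioi le_rfl)]
  refine ENNReal.add_lt_top.2 ⟨?_, ?_⟩
  · calc _ ≤ ∫⁻ t in Set.Ioc (0 : ℝ) 1, 1 := lintegral_mono fun t => tsub_le_self
      _ < ⊤ := by simp
  · calc _ ≤ ∫⁻ t in Set.Ioi (1 : ℝ), c * ENNReal.ofReal (t ^ (-a)) :=
          lintegral_mono fun t => one_sub_expNeg_le _
      _ = c * ∫⁻ t in Set.Ioi (1 : ℝ), ENNReal.ofReal (t ^ (-a)) :=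
          lintegral_const_mul _ (by fun_prop)
      _ < ⊤ := ENNReal.mul_lt_top hc.lt_top
          (integrableOn_Ioi_rpow_of_lt (by linarith) zero_lt_one).lintegral_lt_top

theorem stableConst_lt_top {m : ℝ} (h0 : 0 < m) (h1 : m < 1) : stableConst m < ⊤ := by
  have h := lintegral_one_sub_expNeg_rpow_lt_top ENNReal.one_ne_top (one_lt_one_div h0 h1)
  simpa [stableConst] using h

theorem lintegral_Ioi_comp_div {f : ℝ → ℝ≥0∞} (hf : Measurable f) {b : ℝ} (hb : 0 < b) :
    ∫⁻ t in Set.Ioi (0 : ℝ), f (t / b) = ENNReal.ofReal b * ∫⁻ t in Set.Ioi (0 : ℝ), f t := by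
  have hmap := Real.map_volume_mul_left (inv_ne_zero hb.ne')
  have hm : Measurable ((Set.Ioi (0 : ℝ)).indicator f) := hf.indicator measurableSet_Ioi
  rw [← lintegral_indicator measurableSet_Ioi, ← lintegral_indicator measurableSet_Ioi]
  have h1 : ∀ t, (Set.Ioi (0 : ℝ)).indicator (fun t => f (t / b)) t =
      (Set.Ioi (0 : ℝ)).indicator f (b⁻¹ * t) := fun t => by
    have : t ∈ Set.Ioi (0 : ℝ) ↔ b⁻¹ * t ∈ Set.Ioi (0 : ℝ) := by
      simp [hb]
    by_cases h : t ∈ Set.Ioi (0 : ℝ)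
    · rw [Set.indicator_of_mem h, Set.indicator_of_mem (this.1 h), div_eq_inv_mul]
    · rw [Set.indicator_of_notMem h, Set.indicator_of_notMem (fun h' => h (this.2 h'))]
  simp only [h1]
  rw [← lintegral_map hm (measurable_const_mul _), hmap, lintegral_smul_measure]
  simp [abs_of_pos hb]

/-- Substituting t ↦ t / y^m absorbs y into the power of t. This is the source of all fractional
moments below; the values 0 and ∞ of y are included because subtree sums may a priori take them. -/
theorem lintegral_one_sub_expNeg {m : ℝ} (h0 : 0 < m) (y : ℝ≥0∞) :
    ∫⁻ t in Set.Ioi (0 : ℝ), (1 - expNeg (ENNReal.ofReal (t ^ (-(1 / m))) * y)) =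
      stableConst m * y ^ m := by
  rcases eq_or_ne y ⊤ with rfl | hy
  · rw [ENNReal.top_rpow_of_pos h0, ENNReal.mul_top (stableConst_pos m).ne']
    rw [setLIntegral_congr_fun (g := fun _ => 1) measurableSet_Ioi fun t ht => by
      rw [ENNReal.mul_top (ENNReal.ofReal_pos.2 (Real.rpow_pos_of_pos ht _)).ne', expNeg_top,
        tsub_zero]]
    simp
  rcases eq_or_ne y 0 with rfl | hy0
  · simp [expNeg_zero, ENNReal.zero_rpow_of_pos h0]
  have hpos : 0 < y.toReal := ENNReal.toReal_pos hy0 hy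
  have hb : 0 < y.toReal ^ m := Real.rpow_pos_of_pos hpos _
  have h := lintegral_Ioi_comp_div
    (f := fun t : ℝ => 1 - expNeg (ENNReal.ofReal (t ^ (-(1 / m)))))
    (measurable_const.sub (measurable_expNeg.comp (by fun_prop))) hb
  rw [stableConst, mul_comm, ← ENNReal.ofReal_toReal hy,
    ENNReal.ofReal_rpow_of_pos hpos, ← h]
  refine setLIntegral_congr_fun measurableSet_Ioi fun t ht => ?_
  have ht' : (0 : ℝ) < t := ht
  rw [← ENNReal.ofReal_mul (Real.rpow_nonneg ht'.le _), Real.div_rpow ht'.le hb.le,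
    ← Real.rpow_mul hpos.le, show m * -(1 / m) = -1 by field_simp, Real.rpow_neg_one, div_inv_eq_mul]


/-! ### Independent exponential waiting times -/

theorem lintegral_infinitePi_prod {ι X : Type*} [MeasurableSpace X] (μ : Measure X)
    [IsProbabilityMeasure μ] (s : Finset ι) {f : ι → X → ℝ≥0∞} (hf : ∀ i, Measurable (f i)) :
    ∫⁻ ω, ∏ i ∈ s, f i (ω i) ∂(Measure.infinitePi fun _ : ι => μ) =
      ∏ i ∈ s, ∫⁻ x, f i x ∂μ := by
  have hind : iIndepFun (fun (i : ι) (ω : ι → X) => f i (ω i)) (Measure.infinitePi fun _ : ι => μ) :=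
    iIndepFun_infinitePi (P := fun _ : ι => μ) (X := f) hf
  refine (lintegral_prod_eq_prod_lintegral_of_indepFun s _ hind
    fun i => (hf i).comp (measurable_pi_apply i)).trans (Finset.prod_congr rfl fun i _ => ?_)
  exact (measurePreserving_eval_infinitePi (fun _ : ι => μ) i).lintegral_comp (hf i)

theorem lintegral_expMeasure_one {f : ℝ → ℝ≥0∞} (hf : Measurable f) :
    ∫⁻ t, f t ∂expMeasure 1 = ∫⁻ t in Set.Ioi (0 : ℝ), ENNReal.ofReal (Real.exp (-t)) * f t := by
  have hm : Measurable (gammaPDF 1 1) := (measurable_gammaPDFReal 1 1).ennreal_ofReal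
  rw [expMeasure, gammaMeasure, lintegral_withDensity_eq_lintegral_mul _ hm hf,
    ← lintegral_add_compl _ (measurableSet_Ioi (a := (0 : ℝ))), Set.compl_Ioi]
  have h0 : ∫⁻ t in Set.Iic (0 : ℝ), (gammaPDF 1 1 * f) t = 0 := by
    rw [setLIntegral_congr (Iio_ae_eq_Iic (a := (0 : ℝ))).symm]
    rw [setLIntegral_congr_fun (g := fun _ => 0) measurableSet_Iio fun t ht => by
      simp [gammaPDF_of_neg ht]]
    simp
  rw [h0, add_zero]
  refine setLIntegral_congr_fun measurableSet_Ioi fun t ht => ?_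
  simp [gammaPDF_of_nonneg (le_of_lt ht)]

theorem ae_expMeasure_pos : ∀ᵐ t ∂expMeasure 1, 0 < t := by
  have h := lintegral_expMeasure_one (f := (Set.Iic (0 : ℝ)).indicator 1)
    (measurable_one.indicator measurableSet_Iic)
  rw [lintegral_indicator_one measurableSet_Iic] at h
  rw [setLIntegral_congr_fun (g := fun _ => 0) measurableSet_Ioi fun t ht => by
    simp [not_le.2 (Set.mem_Ioi.1 ht)]] at h
  rw [ae_iff]
  simpa [Set.Iic] using h

/-- Law of a sequence of independent exponential variables with mean one. -/
def expSeqLaw : Measure (ℕ → ℝ) := Measure.infinitePi fun _ => expMeasure 1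

instance : IsProbabilityMeasure expSeqLaw := by unfold expSeqLaw; infer_instance

theorem ae_expSeqLaw_pos : ∀ᵐ ε ∂expSeqLaw, ∀ i, 0 < ε i := by
  rw [ae_all_iff]
  intro i
  exact (measurePreserving_eval_infinitePi (fun _ : ℕ => expMeasure 1) i).quasiMeasurePreserving.ae
    ae_expMeasure_pos

/-- The sequence `t, ε 0, ε 1, …`. -/
def consSeq (t : ℝ) (ε : ℕ → ℝ) : ℕ → ℝ
  | 0 => t
  | i + 1 => ε i

theorem sum_consSeq (t : ℝ) (ε : ℕ → ℝ) (N : ℕ) :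
    ∑ i ∈ Finset.range (N + 1), consSeq t ε i = t + ∑ i ∈ Finset.range N, ε i := by
  rw [Finset.sum_range_succ', add_comm]
  rfl

theorem measurable_consSeq : Measurable fun p : ℝ × (ℕ → ℝ) => consSeq p.1 p.2 := by
  refine measurable_pi_iff.2 fun i => ?_
  cases i with
  | zero => exact measurable_fst
  | succ i => exact (measurable_pi_apply i).comp measurable_snd

theorem lintegral_expSeqLaw {f : (ℕ → ℝ) → ℝ≥0∞} (hf : Measurable f) :
    ∫⁻ ε, f ε ∂expSeqLaw = ∫⁻ t, ∫⁻ ε, f (consSeq t ε) ∂expSeqLaw ∂expMeasure 1 := by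
  have hc : Measurable fun p : ℝ × (ℕ → ℝ) => f (consSeq p.1 p.2) := hf.comp measurable_consSeq
  have h := lintegral_prod (μ := expMeasure 1) (ν := expSeqLaw)
    (fun p : ℝ × (ℕ → ℝ) => f (consSeq p.1 p.2)) hc.aemeasurable
  simp only at h
  rw [← h, expSeqLaw, ← infinitePi_map_nat, lintegral_map hc (by fun_prop)]
  refine lintegral_congr fun ε => congrArg f ?_
  funext i
  cases i <;> rfl

/-- The arrival times of a rate one Poisson process tend to infinity. -/
theorem tsum_expSeqLaw : ∀ᵐ ε ∂expSeqLaw, ∑' i, ENNReal.ofReal (ε i) = ⊤ := by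
  -- By independence the expectation of e^{-Γ} over N waiting times is the N-th power of this
  -- number. It tends to zero, so e^{-Γ_∞} vanishes almost surely.
  have hlt : ∫⁻ t, expNeg (ENNReal.ofReal t) ∂expMeasure 1 < 1 := by
    have hne : ∫⁻ t, expNeg (ENNReal.ofReal t) ∂expMeasure 1 ≠ ⊤ :=
      ((lintegral_mono fun t => expNeg_le_one _).trans_lt (by simp)).ne
    have h := lintegral_strict_mono (μ := expMeasure 1) (g := fun _ => 1)
      (f := fun t => expNeg (ENNReal.ofReal t)) (IsProbabilityMeasure.ne_zero _)
      aemeasurable_const hne (by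
        filter_upwards [ae_expMeasure_pos] with t ht
        rw [← expNeg_zero]
        exact expNeg_strictAnti (ENNReal.ofReal_pos.2 ht))
    simpa using h
  have hm : ∀ i, Measurable fun ε : ℕ → ℝ => expNeg (ENNReal.ofReal (ε i)) :=
    fun i => measurable_expNeg.comp (by fun_prop)
  have hprod : ∀ N, ∫⁻ ε, ∏ i ∈ Finset.range N, expNeg (ENNReal.ofReal (ε i)) ∂expSeqLaw =
      (∫⁻ t, expNeg (ENNReal.ofReal t) ∂expMeasure 1) ^ N := fun N => by
    refine (lintegral_infinitePi_prod (expMeasure 1) (Finset.range N)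
      (f := fun _ t => expNeg (ENNReal.ofReal t))
      fun _ => measurable_expNeg.comp (by fun_prop)).trans ?_
    rw [Finset.prod_const, Finset.card_range]
  have hlim : Tendsto (fun N => ∫⁻ ε, ∏ i ∈ Finset.range N, expNeg (ENNReal.ofReal (ε i)) ∂expSeqLaw)
      atTop (𝓝 (∫⁻ ε, expNeg (∑' i, ENNReal.ofReal (ε i)) ∂expSeqLaw)) :=
    tendsto_lintegral_of_dominated_convergence (fun _ => 1)
      (fun N => Finset.measurable_fun_prod _ fun i _ => hm i)
      (fun N => ae_of_all _ fun ε => Finset.prod_le_one' fun i _ => expNeg_le_one _)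
      (by simp) (ae_of_all _ fun ε => tendsto_prod_expNeg _)
  simp only [hprod] at hlim
  have h0 := tendsto_nhds_unique hlim (ENNReal.tendsto_pow_atTop_nhds_zero_of_lt_one hlt)
  have hms : Measurable fun ε : ℕ → ℝ => expNeg (∑' i, ENNReal.ofReal (ε i)) :=
    measurable_expNeg.comp (Measurable.tsum fun i => (measurable_pi_apply i).ennreal_ofReal)
  rw [lintegral_eq_zero_iff hms] at h0
  filter_upwards [h0] with ε hε
  by_contra hne
  have := expNeg_strictAnti (lt_top_iff_ne_top.2 hne)
  rw [hε, expNeg_top] at this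
  exact lt_irrefl _ this

theorem tendsto_arrival : ∀ᵐ ε ∂expSeqLaw,
    Tendsto (fun N => ∑ i ∈ Finset.range N, ε i) atTop atTop := by
  filter_upwards [tsum_expSeqLaw, ae_expSeqLaw_pos] with ε h hpos
  have h1 := ENNReal.tendsto_nat_tsum fun i => ENNReal.ofReal (ε i)
  rw [h] at h1
  simp only [← ENNReal.ofReal_sum_of_nonneg fun i _ => (hpos i).le] at h1
  exact ENNReal.tendsto_ofReal_nhds_top.1 h1

/-! ### Renewal equation and the Laplace functional of the arrival times -/

section Renewal

variable {g : ℝ → ℝ}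

/-- The tail functional `exp(-∫_s^∞ (1 - g))` of a function that is integrably close to one. -/
def tailExp (g : ℝ → ℝ) (s : ℝ) : ℝ :=
  Real.exp (-(∫ t in Set.Ioi (0 : ℝ), (1 - g t)) + ∫ t in (0 : ℝ)..s, (1 - g t))

theorem continuous_tailExp (hi : Integrable fun t => 1 - g t) : Continuous (tailExp g) :=
  Real.continuous_exp.comp (continuous_const.add
    (intervalIntegral.continuous_primitive (fun _ _ => hi.intervalIntegrable) 0))

theorem tendsto_tailExp (hi : Integrable fun t => 1 - g t) :
    Tendsto (tailExp g) atTop (𝓝 1) := by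
  have h := (intervalIntegral_tendsto_integral_Ioi (0 : ℝ) hi.integrableOn tendsto_id).const_add
    (-(∫ t in Set.Ioi (0 : ℝ), (1 - g t)))
  rw [neg_add_cancel] at h
  have h' := (Real.continuous_exp.tendsto 0).comp h
  rwa [Real.exp_zero] at h'

theorem tailExp_le_one (h1 : ∀ t, g t ≤ 1) (hi : Integrable fun t => 1 - g t) {s : ℝ}
    (hs : 0 ≤ s) : tailExp g s ≤ 1 := by
  rw [tailExp, Real.exp_le_one_iff, intervalIntegral.integral_of_le hs]
  have := setIntegral_mono_set (μ := volume) (s := Set.Ioc 0 s) (t := Set.Ioi 0) hi.integrableOn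
    (ae_of_all _ fun t => sub_nonneg.2 (h1 t)) (Set.Ioc_subset_Ioi_self.eventuallyLE)
  linarith

/-- The renewal equation of the tail functional. -/
theorem lintegral_mul_tailExp (h0 : ∀ t, 0 ≤ g t) (hm : Measurable g)
    (hc : ∀ t, 0 < t → ContinuousAt g t) (hi : Integrable fun t => 1 - g t) {s : ℝ} (hs : 0 ≤ s) :
    ∫⁻ t, ENNReal.ofReal (g (s + t)) * ENNReal.ofReal (tailExp g (s + t)) ∂expMeasure 1 =
      ENNReal.ofReal (tailExp g s) := by
  have hcont := continuous_tailExp hi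
  have hpos : ∀ u, 0 < tailExp g u := fun u => Real.exp_pos _
  rw [lintegral_expMeasure_one (by
    exact (hm.comp (measurable_const_add s)).ennreal_ofReal.mul
      (hcont.measurable.comp (measurable_const_add s)).ennreal_ofReal)]
  -- As F' = (1 - g)F for the tail functional F, the integrand e^{-t} g(s+t) F(s+t) has the explicit
  -- primitive -e^{-t} F(s+t), which rises from -F(s) to 0.
  have hder : ∀ t ∈ Set.Ioi (0 : ℝ), HasDerivAt (fun t => -(Real.exp (-t) * tailExp g (s + t)))
      (Real.exp (-t) * (g (s + t) * tailExp g (s + t))) t := by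
    intro t ht
    have hst : 0 < s + t := add_pos_of_nonneg_of_pos hs ht
    have hF : HasDerivAt (tailExp g) (tailExp g (s + t) * (1 - g (s + t))) (s + t) := by
      have h := (intervalIntegral.integral_hasDerivAt_right (a := 0) (b := s + t)
        (f := fun t => 1 - g t) hi.intervalIntegrable
        (hi.aestronglyMeasurable.stronglyMeasurableAtFilter) ((hc _ hst).const_sub 1))
      exact (h.const_add _).exp
    have hF' : HasDerivAt (fun t => tailExp g (s + t)) (tailExp g (s + t) * (1 - g (s + t))) t :=
      hF.comp_const_add s t
    have he : HasDerivAt (fun t : ℝ => Real.exp (-t)) (-Real.exp (-t)) t := by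
      simpa using (hasDerivAt_neg t).exp
    refine (he.mul hF').neg.congr_deriv ?_
    ring
  have hnn : ∀ t ∈ Set.Ioi (0 : ℝ), 0 ≤ Real.exp (-t) * (g (s + t) * tailExp g (s + t)) :=
    fun t _ => mul_nonneg (Real.exp_pos _).le (mul_nonneg (h0 _) (hpos _).le)
  have hcw : ContinuousWithinAt (fun t => -(Real.exp (-t) * tailExp g (s + t))) (Set.Ici 0) 0 := by
    refine Continuous.continuousWithinAt ?_
    exact ((Real.continuous_exp.comp continuous_neg).mul
      (hcont.comp (continuous_const.add continuous_id))).neg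
  have hlim : Tendsto (fun t => -(Real.exp (-t) * tailExp g (s + t))) atTop (𝓝 0) := by
    have h2 : Tendsto (fun t => tailExp g (s + t)) atTop (𝓝 1) :=
      (tendsto_tailExp hi).comp (tendsto_atTop_add_const_left _ s tendsto_id)
    simpa using ((Real.tendsto_exp_neg_atTop_nhds_zero).mul h2).neg
  have hint := integrableOn_Ioi_deriv_of_nonneg hcw hder hnn hlim
  have hval := integral_Ioi_of_hasDerivAt_of_tendsto hcw hder hint hlim
  simp only [neg_zero, Real.exp_zero, one_mul, add_zero, sub_neg_eq_add, zero_add] at hval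
  rw [← hval, ofReal_integral_eq_lintegral_ofReal hint
    ((ae_restrict_iff' measurableSet_Ioi).2 (ae_of_all _ hnn))]
  refine setLIntegral_congr_fun measurableSet_Ioi fun t _ => ?_
  rw [ENNReal.ofReal_mul (Real.exp_pos _).le, ENNReal.ofReal_mul (h0 _)]

/-- The renewal equation iterated N times: conditioning on the first waiting time moves the starting
point from s to s + t. The starting point has to be arbitrary for the induction. -/
theorem lintegral_prod_arrival_mul_tailExp (h0 : ∀ t, 0 ≤ g t)
    (hm : Measurable g) (hc : ∀ t, 0 < t → ContinuousAt g t) (hi : Integrable fun t => 1 - g t)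
    (N : ℕ) : ∀ {s : ℝ}, 0 ≤ s →
    ∫⁻ ε, (∏ j ∈ Finset.range N, ENNReal.ofReal (g (s + ∑ i ∈ Finset.range (j + 1), ε i))) *
      ENNReal.ofReal (tailExp g (s + ∑ i ∈ Finset.range N, ε i)) ∂expSeqLaw =
      ENNReal.ofReal (tailExp g s) := by
  have hcm := (continuous_tailExp hi).measurable
  induction N with
  | zero => intro s hs; simp
  | succ N ih =>
    intro s hs
    have hmeas : Measurable fun ε : ℕ → ℝ =>
        (∏ j ∈ Finset.range N, ENNReal.ofReal (g (s + ∑ i ∈ Finset.range (j + 1), ε i))) *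
        ENNReal.ofReal (tailExp g (s + ∑ i ∈ Finset.range N, ε i)) := by fun_prop
    rw [lintegral_expSeqLaw (by fun_prop)]
    rw [← lintegral_mul_tailExp h0 hm hc hi hs]
    refine lintegral_congr_ae ?_
    filter_upwards [ae_expMeasure_pos] with t ht
    rw [← ih (add_nonneg hs ht.le), ← lintegral_const_mul _ (by fun_prop)]
    refine lintegral_congr fun ε => ?_
    rw [Finset.prod_range_succ']
    simp only [sum_consSeq, Finset.range_zero, Finset.sum_empty, add_zero, ← add_assoc]
    ring

/-- The factor F(Γ_N) in the exact identity for N points is at most one and tends to one as the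
arrival times diverge. Since the products are at most one, dropping it costs at most E(1 - F(Γ_N)).
-/
theorem tendsto_lintegral_prod_arrival (h0 : ∀ t, 0 ≤ g t) (h1 : ∀ t, g t ≤ 1)
    (hm : Measurable g) (hc : ∀ t, 0 < t → ContinuousAt g t) (hi : Integrable fun t => 1 - g t) :
    Tendsto (fun N => ∫⁻ ε, ∏ j ∈ Finset.range N,
      ENNReal.ofReal (g (∑ i ∈ Finset.range (j + 1), ε i)) ∂expSeqLaw) atTop
      (𝓝 (ENNReal.ofReal (Real.exp (-∫ t in Set.Ioi (0 : ℝ), (1 - g t))))) := by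
  have hcm := (continuous_tailExp hi).measurable
  have hP : ∀ N (ε : ℕ → ℝ), ∏ j ∈ Finset.range N,
      ENNReal.ofReal (g (∑ i ∈ Finset.range (j + 1), ε i)) ≤ 1 := fun N ε =>
    Finset.prod_le_one' fun j _ => ENNReal.ofReal_le_one.2 (h1 _)
  have hF0 : tailExp g 0 = Real.exp (-∫ t in Set.Ioi (0 : ℝ), (1 - g t)) := by simp [tailExp]
  have hsmall : Tendsto (fun N => ∫⁻ ε, (1 - ENNReal.ofReal (tailExp g
      (∑ i ∈ Finset.range N, ε i))) ∂expSeqLaw) atTop (𝓝 0) := by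
    have : (0 : ℝ≥0∞) = ∫⁻ _ : ℕ → ℝ, 0 ∂expSeqLaw := by simp
    rw [this]
    refine tendsto_lintegral_of_dominated_convergence (fun _ => 1) (fun N => by fun_prop)
      (fun N => ae_of_all _ fun ε => tsub_le_self) (by simp) ?_
    filter_upwards [tendsto_arrival] with ε hε
    have h := ENNReal.tendsto_ofReal ((tendsto_tailExp hi).comp hε)
    rw [ENNReal.ofReal_one] at h
    simpa using ENNReal.Tendsto.sub tendsto_const_nhds h (.inl ENNReal.one_ne_top)
  have hmain : ∀ N, ∫⁻ ε, (∏ j ∈ Finset.range N,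
      ENNReal.ofReal (g (∑ i ∈ Finset.range (j + 1), ε i))) *
      ENNReal.ofReal (tailExp g (∑ i ∈ Finset.range N, ε i)) ∂expSeqLaw =
      ENNReal.ofReal (tailExp g 0) := fun N => by
    simpa using lintegral_prod_arrival_mul_tailExp h0 hm hc hi N le_rfl
  rw [← hF0]
  refine tendsto_of_tendsto_of_tendsto_of_le_of_le tendsto_const_nhds
    (by simpa using hsmall.const_add (ENNReal.ofReal (tailExp g 0))) (fun N => ?_) (fun N => ?_)
  · rw [← hmain N]
    refine lintegral_mono_ae ?_
    filter_upwards [ae_expSeqLaw_pos] with ε hε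
    exact mul_le_of_le_one_right' (ENNReal.ofReal_le_one.2 (tailExp_le_one h1 hi
      (Finset.sum_nonneg fun i _ => (hε i).le)))
  · rw [← hmain N, ← lintegral_add_left (by fun_prop)]
    refine lintegral_mono fun ε => ?_
    set P := ∏ j ∈ Finset.range N, ENNReal.ofReal (g (∑ i ∈ Finset.range (j + 1), ε i)) with hPd
    set F := ENNReal.ofReal (tailExp g (∑ i ∈ Finset.range N, ε i))
    calc P = P * 1 := (mul_one P).symm
      _ ≤ P * (F + (1 - F)) := by gcongr; exact le_add_tsub
      _ = P * F + P * (1 - F) := mul_add _ _ _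
      _ ≤ P * F + (1 - F) := by gcongr; exact mul_le_of_le_one_left' (hP N ε)

end Renewal


/-! ### Laplace transform of marked Poisson sums -/

/-- The points `Γ_j^{-1/m}` in terms of the waiting times. -/
def stablePoint (m : ℝ) (ε : ℕ → ℝ) (j : ℕ) : ℝ :=
  (∑ i ∈ Finset.range (j + 1), ε i) ^ (-(1 / m))

@[fun_prop]
theorem measurable_stablePoint (m : ℝ) (j : ℕ) : Measurable fun ε => stablePoint m ε j := by
  unfold stablePoint
  fun_prop

section Laplace

variable {Ω : Type*} [MeasurableSpace Ω] {Q : Measure Ω} [IsProbabilityMeasure Q]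
  {Y : Ω → ℝ≥0∞} {m : ℝ}

theorem measurable_stableSum (hY : Measurable Y) : Measurable fun p : (ℕ → ℝ) × (ℕ → Ω) =>
    ∑' j, ENNReal.ofReal (stablePoint m p.1 j) * Y (p.2 j) :=
  Measurable.tsum fun j => ((measurable_stablePoint m j).comp measurable_fst).ennreal_ofReal.mul
    (hY.comp ((measurable_pi_apply j).comp measurable_snd))

/-- Tonelli reduces this to the deterministic identity `lintegral_one_sub_expNeg`. Read from right
to left, it recovers the moment of order m from the Laplace transform. -/
theorem lintegral_Ioi_one_sub_laplace (hY : Measurable Y) (h0 : 0 < m) :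
    ∫⁻ t in Set.Ioi (0 : ℝ), (1 - ∫⁻ ω, expNeg (ENNReal.ofReal (t ^ (-(1 / m))) * Y ω) ∂Q) =
      stableConst m * ∫⁻ ω, Y ω ^ m ∂Q := by
  have hm : Measurable fun p : ℝ × Ω => expNeg (ENNReal.ofReal (p.1 ^ (-(1 / m))) * Y p.2) :=
    measurable_expNeg.comp (by fun_prop)
  have hmt : ∀ t : ℝ, Measurable fun ω => expNeg (ENNReal.ofReal (t ^ (-(1 / m))) * Y ω) :=
    fun t => measurable_expNeg.comp (by fun_prop)
  have h1 : ∀ t : ℝ, 1 - ∫⁻ ω, expNeg (ENNReal.ofReal (t ^ (-(1 / m))) * Y ω) ∂Q =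
      ∫⁻ ω, (1 - expNeg (ENNReal.ofReal (t ^ (-(1 / m))) * Y ω)) ∂Q := fun t => by
    rw [lintegral_sub (hmt t)
      ((lintegral_mono fun ω => expNeg_le_one _).trans_lt (by simp)).ne
      (ae_of_all _ fun ω => expNeg_le_one _)]
    simp
  simp only [h1]
  rw [lintegral_lintegral_swap (by
    exact (measurable_const.sub hm).aemeasurable)]
  simp only [lintegral_one_sub_expNeg h0]
  exact lintegral_const_mul _ (hY.pow_const m)

/-- Integrating out the marks turns the transform into E ∏ G(Γ_j), to which the renewal argument
applies. Boundedness of the marks gives the continuity of G and, through a finite moment of order m,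
the integrability of 1 - G. -/
theorem lintegral_expNeg_stableSum_of_le (hY : Measurable Y) {K : ℝ≥0∞} (hK : K ≠ ⊤)
    (hYK : ∀ ω, Y ω ≤ K) (h0 : 0 < m) (h1 : m < 1) :
    ∫⁻ p, expNeg (∑' j, ENNReal.ofReal (stablePoint m p.1 j) * Y (p.2 j))
      ∂(expSeqLaw.prod (Measure.infinitePi fun _ : ℕ => Q)) =
      expNeg (stableConst m * ∫⁻ ω, Y ω ^ m ∂Q) := by
  have hm : Measurable (Function.uncurry fun (t : ℝ) ω =>
      expNeg (ENNReal.ofReal (t ^ (-(1 / m))) * Y ω)) :=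
    measurable_expNeg.comp (by fun_prop)
  have hmt : ∀ t : ℝ, Measurable fun ω => expNeg (ENNReal.ofReal (t ^ (-(1 / m))) * Y ω) :=
    fun t => measurable_expNeg.comp (by fun_prop)
  set G : ℝ → ℝ≥0∞ := fun t => ∫⁻ ω, expNeg (ENNReal.ofReal (t ^ (-(1 / m))) * Y ω) ∂Q with hG
  have hGm : Measurable G := Measurable.lintegral_prod_right hm
  have hG1 : ∀ t, G t ≤ 1 := fun t =>
    (lintegral_mono fun ω => expNeg_le_one _).trans (by simp)
  have hGt : ∀ t, G t ≠ ⊤ := fun t => ((hG1 t).trans_lt ENNReal.one_lt_top).ne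
  have hGc : ∀ t, 0 < t → ContinuousAt G t := fun t ht => by
    refine tendsto_lintegral_filter_of_dominated_convergence (fun _ => 1)
      (Eventually.of_forall fun s => hmt s)
      (Eventually.of_forall fun s => ae_of_all _ fun ω => expNeg_le_one _) (by simp)
      (ae_of_all _ fun ω => ?_)
    refine (continuous_expNeg.tendsto _).comp (ENNReal.Tendsto.mul_const ?_
      (.inr ((hYK ω).trans_lt hK.lt_top).ne))
    exact ENNReal.tendsto_ofReal (Real.continuousAt_rpow_const t _ (.inl ht.ne'))
  -- Extension by the value one makes 1 - g integrable on the whole line without changing g at the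
  -- arrival times.
  set g : ℝ → ℝ := fun t => if 0 < t then (G t).toReal else 1 with hg
  have hgm : Measurable g :=
    Measurable.ite measurableSet_Ioi hGm.ennreal_toReal measurable_const
  have hg0 : ∀ t, 0 ≤ g t := fun t => by
    by_cases h : 0 < t <;> simp [hg, h]
  have hg1 : ∀ t, g t ≤ 1 := fun t => by
    by_cases h : 0 < t
    · simpa [hg, h] using ENNReal.toReal_mono ENNReal.one_ne_top (hG1 t)
    · simp [hg, h]
  have hgG : ∀ t, 0 < t → ENNReal.ofReal (g t) = G t := fun t ht => by
    simp [hg, ht, ENNReal.ofReal_toReal (hGt t)]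
  have hgc : ∀ t, 0 < t → ContinuousAt g t := fun t ht => by
    have h : ContinuousAt (fun t => (G t).toReal) t :=
      (ENNReal.tendsto_toReal (hGt t)).comp (hGc t ht)
    refine h.congr ?_
    filter_upwards [lt_mem_nhds ht] with s hs
    simp [hg, hs]
  have hint : ∫⁻ t in Set.Ioi (0 : ℝ), ENNReal.ofReal (1 - g t) =
      stableConst m * ∫⁻ ω, Y ω ^ m ∂Q := by
    rw [← lintegral_Ioi_one_sub_laplace hY h0]
    refine setLIntegral_congr_fun measurableSet_Ioi fun t ht => ?_
    rw [ENNReal.ofReal_sub _ (hg0 t), hgG t ht, ENNReal.ofReal_one]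
  have hfin : stableConst m * ∫⁻ ω, Y ω ^ m ∂Q < ⊤ := by
    refine ENNReal.mul_lt_top (stableConst_lt_top h0 h1) ?_
    calc _ ≤ ∫⁻ _, K ^ m ∂Q := lintegral_mono fun ω => ENNReal.rpow_le_rpow (hYK ω) h0.le
      _ < ⊤ := by simpa using ENNReal.rpow_lt_top_of_nonneg h0.le hK
  have hion : IntegrableOn (fun t => 1 - g t) (Set.Ioi 0) := by
    refine ⟨(measurable_const.sub hgm).aestronglyMeasurable, ?_⟩
    rw [hasFiniteIntegral_iff_ofReal (ae_of_all _ fun t => sub_nonneg.2 (hg1 t)), hint]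
    exact hfin
  have hi : Integrable fun t => 1 - g t := by
    refine (integrableOn_iff_integrable_of_support_subset fun t ht => ?_).1 hion
    by_contra hn
    exact ht (by simp [hg, show ¬ (0 < t) from hn])
  have hlim := tendsto_lintegral_prod_arrival hg0 hg1 hgm hgc hi
  have hval : ENNReal.ofReal (Real.exp (-∫ t in Set.Ioi (0 : ℝ), (1 - g t))) =
      expNeg (stableConst m * ∫⁻ ω, Y ω ^ m ∂Q) := by
    rw [← hint, ← ofReal_integral_eq_lintegral_ofReal hion
      (ae_of_all _ fun t => sub_nonneg.2 (hg1 t)),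
      expNeg_ofReal (integral_nonneg fun t => sub_nonneg.2 (hg1 t))]
  rw [hval] at hlim
  have hY' : ∀ j, Measurable fun p : (ℕ → ℝ) × (ℕ → Ω) =>
      expNeg (ENNReal.ofReal (stablePoint m p.1 j) * Y (p.2 j)) := fun j =>
    measurable_expNeg.comp (((measurable_stablePoint m j).comp measurable_fst).ennreal_ofReal.mul
      (hY.comp ((measurable_pi_apply j).comp measurable_snd)))
  have hlim' : Tendsto (fun N => ∫⁻ p, ∏ j ∈ Finset.range N,
      expNeg (ENNReal.ofReal (stablePoint m p.1 j) * Y (p.2 j))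
      ∂(expSeqLaw.prod (Measure.infinitePi fun _ : ℕ => Q))) atTop
      (𝓝 (∫⁻ p, expNeg (∑' j, ENNReal.ofReal (stablePoint m p.1 j) * Y (p.2 j))
      ∂(expSeqLaw.prod (Measure.infinitePi fun _ : ℕ => Q)))) :=
    tendsto_lintegral_of_dominated_convergence (fun _ => 1)
      (fun N => Finset.measurable_fun_prod _ fun j _ => hY' j)
      (fun N => ae_of_all _ fun p => Finset.prod_le_one' fun i _ => expNeg_le_one _)
      (by simp) (ae_of_all _ fun p => tendsto_prod_expNeg _)
  refine tendsto_nhds_unique hlim' (hlim.congr fun N => ?_)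
  rw [lintegral_prod _ (Finset.measurable_fun_prod _ fun j _ => hY' j).aemeasurable]
  refine lintegral_congr_ae ?_
  filter_upwards [ae_expSeqLaw_pos] with ε hε
  rw [lintegral_infinitePi_prod Q (Finset.range N)
    (f := fun j ω => expNeg (ENNReal.ofReal (stablePoint m ε j) * Y ω))
    fun j => measurable_expNeg.comp (hY.const_mul _)]
  refine Finset.prod_congr rfl fun j _ => ?_
  exact hgG _ (Finset.sum_pos (fun i _ => hε i) (by simp))

/-- Laplace transform of a sum over the points of a Poisson process with i.i.d. marks. -/
theorem lintegral_expNeg_stableSum (hY : Measurable Y) (h0 : 0 < m) (h1 : m < 1) :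
    ∫⁻ p, expNeg (∑' j, ENNReal.ofReal (stablePoint m p.1 j) * Y (p.2 j))
      ∂(expSeqLaw.prod (Measure.infinitePi fun _ : ℕ => Q)) =
      expNeg (stableConst m * ∫⁻ ω, Y ω ^ m ∂Q) := by
  -- Truncation of the marks; both sides pass to the limit by monotone convergence and continuity of
  -- e^{-x} on [0,∞], also when the limiting moment is infinite.
  set T : ℕ → Ω → ℝ≥0∞ := fun K ω => min (Y ω) K with hT
  have hTm : ∀ K, Measurable (T K) := fun K => hY.min measurable_const
  have hmono : ∀ ω, Monotone fun K => T K ω := fun ω a b h =>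
    min_le_min le_rfl (by exact_mod_cast h)
  have hlim : ∀ ω, Tendsto (fun K => T K ω) atTop (𝓝 (Y ω)) := fun ω => by
    have h : Tendsto (fun K : ℕ => min (Y ω) (K : ℝ≥0∞)) atTop (𝓝 (min (Y ω) ⊤)) :=
      tendsto_const_nhds.min ENNReal.tendsto_nat_nhds_top
    simpa using h
  have hsum : ∀ p : (ℕ → ℝ) × (ℕ → Ω), Tendsto (fun K => ∑' j,
      ENNReal.ofReal (stablePoint m p.1 j) * T K (p.2 j)) atTop
      (𝓝 (∑' j, ENNReal.ofReal (stablePoint m p.1 j) * Y (p.2 j))) := fun p => by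
    simp only [← lintegral_count]
    refine lintegral_tendsto_of_tendsto_of_monotone (fun K => (measurable_from_nat).aemeasurable)
      (ae_of_all _ fun j a b h => ?_) (ae_of_all _ fun j => ?_)
    · exact mul_le_mul_right (hmono _ h) _
    · exact ENNReal.Tendsto.const_mul (hlim _) (.inr ENNReal.ofReal_ne_top)
  have hL : Tendsto (fun K => ∫⁻ p, expNeg (∑' j,
      ENNReal.ofReal (stablePoint m p.1 j) * T K (p.2 j))
      ∂(expSeqLaw.prod (Measure.infinitePi fun _ : ℕ => Q))) atTop
      (𝓝 (∫⁻ p, expNeg (∑' j, ENNReal.ofReal (stablePoint m p.1 j) * Y (p.2 j))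
      ∂(expSeqLaw.prod (Measure.infinitePi fun _ : ℕ => Q)))) :=
    tendsto_lintegral_of_dominated_convergence (fun _ => 1)
      (fun K => measurable_expNeg.comp (measurable_stableSum (hTm K)))
      (fun K => ae_of_all _ fun p => expNeg_le_one _) (by simp)
      (ae_of_all _ fun p => (continuous_expNeg.tendsto _).comp (hsum p))
  have hR : Tendsto (fun K => expNeg (stableConst m * ∫⁻ ω, T K ω ^ m ∂Q)) atTop
      (𝓝 (expNeg (stableConst m * ∫⁻ ω, Y ω ^ m ∂Q))) := by
    refine (continuous_expNeg.tendsto _).comp (ENNReal.Tendsto.const_mul ?_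
      (.inr (stableConst_lt_top h0 h1).ne))
    refine lintegral_tendsto_of_tendsto_of_monotone
      (fun K => ((hTm K).pow_const m).aemeasurable)
      (ae_of_all _ fun ω a b h => ENNReal.rpow_le_rpow (hmono ω h) h0.le)
      (ae_of_all _ fun ω => ?_)
    exact (ENNReal.continuous_rpow_const.tendsto _).comp (hlim ω)
  refine tendsto_nhds_unique hL (hR.congr fun K => ?_)
  exact (lintegral_expNeg_stableSum_of_le (hTm K) (ENNReal.natCast_ne_top K)
    (fun ω => min_le_right _ _) h0 h1).symm

end Laplace


/-! ### Sums over the leaves and their Laplace recursion -/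

section Tree

variable {S E : Type*}

/-- Sum over the leaves of a tree of depth `r`, in which every node carries the waiting times of a
Poisson process and a label: the function `ψ` is evaluated at the state reached at the leaf, where
states evolve along the edges by `step`, and is weighted by the product of the points of the
processes along the path. -/
def treeSum (ψ : S → ℝ≥0∞) :
    (r : ℕ) → (ℕ → ℝ) → (ℕ → S → E → S) → S → (List ℕ → (ℕ → ℝ) × E) → ℝ≥0∞
  | 0, _, _, s, _ => ψ s
  | r + 1, m, step, s, ω =>
      ∑' a, ENNReal.ofReal (stablePoint (m 0) (ω []).1 a) *
        treeSum ψ r (fun p => m (p + 1)) (fun p => step (p + 1)) (step 0 s (ω [a]).2)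
          (fun b => ω (a :: b))

/-- The initial state already incorporates the label of the root, so of the root data only the
waiting times are read. This allows the label of the root to be replaced by an independent copy. -/
theorem treeSum_congr_root (ψ : S → ℝ≥0∞) (r : ℕ) (m : ℕ → ℝ) (step : ℕ → S → E → S) (s : S)
    {ω ω' : List ℕ → (ℕ → ℝ) × E} (h0 : (ω []).1 = (ω' []).1)
    (h1 : ∀ a b, ω (a :: b) = ω' (a :: b)) :
    treeSum ψ r m step s ω = treeSum ψ r m step s ω' := by
  cases r with
  | zero => rfl
  | succ r => simp only [treeSum, h0, h1]

theorem treeSum_sum {ι : Type*} [Fintype ι] (c : ι → ℝ≥0∞) (ψ : ι → S → ℝ≥0∞) (r : ℕ) :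
    ∀ (m : ℕ → ℝ) (step : ℕ → S → E → S) (s : S) (ω : List ℕ → (ℕ → ℝ) × E),
    treeSum (fun s => ∑ i, c i * ψ i s) r m step s ω = ∑ i, c i * treeSum (ψ i) r m step s ω := by
  induction r with
  | zero => intros; rfl
  | succ r ih =>
    intro m step s ω
    simp only [treeSum, ih, Finset.mul_sum, ← ENNReal.tsum_mul_left]
    rw [Summable.tsum_finsetSum fun i _ => ENNReal.summable]
    exact Finset.sum_congr rfl fun i _ => tsum_congr fun a => mul_left_comm _ _ _

theorem treeSum_const_state (c : ℝ≥0∞) (r : ℕ) :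
    ∀ (m : ℕ → ℝ) (step : ℕ → S → E → S) (s s' : S) (ω : List ℕ → (ℕ → ℝ) × E),
    treeSum (fun _ => c) r m step s ω = treeSum (fun _ => c) r m step s' ω := by
  induction r with
  | zero => intros; rfl
  | succ r ih =>
    intro m step s s' ω
    simp only [treeSum]
    exact tsum_congr fun a => by rw [ih]

variable [MeasurableSpace S] [MeasurableSpace E]

theorem measurable_treeSum {ψ : S → ℝ≥0∞} (hψ : Measurable ψ) (r : ℕ) :
    ∀ (m : ℕ → ℝ) {step : ℕ → S → E → S}, (∀ p, Measurable (Function.uncurry (step p))) →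
    Measurable (Function.uncurry (treeSum ψ r m step)) := by
  induction r with
  | zero => exact fun m step _ => hψ.comp measurable_fst
  | succ r ih =>
    intro m step hstep
    refine Measurable.tsum fun a => Measurable.mul ?_ ?_
    · exact ((measurable_stablePoint _ _).comp (measurable_fst.comp
        ((measurable_pi_apply []).comp measurable_snd))).ennreal_ofReal
    · refine (ih (fun p => m (p + 1)) (step := fun p => step (p + 1))
        fun p => hstep (p + 1)).comp (Measurable.prodMk ?_ ?_)
      · exact (hstep 0).comp (measurable_fst.prodMk (measurable_snd.comp
          ((measurable_pi_apply [a]).comp measurable_snd)))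
      · exact measurable_pi_iff.2 fun b => (measurable_pi_apply (a :: b)).comp measurable_snd

theorem measurable_treeSum_right {ψ : S → ℝ≥0∞} (hψ : Measurable ψ) (r : ℕ) (m : ℕ → ℝ)
    {step : ℕ → S → E → S} (hs : ∀ p, Measurable (Function.uncurry (step p))) (s : S) :
    Measurable (treeSum ψ r m step s) :=
  (measurable_treeSum hψ r m hs).comp (measurable_const.prodMk measurable_id)

/-- Law of the i.i.d. node data of the tree. -/
def treeLaw (ν : Measure E) : Measure (List ℕ → (ℕ → ℝ) × E) :=
  Measure.infinitePi fun _ => expSeqLaw.prod ν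

variable {ν : Measure E} [IsProbabilityMeasure ν]

instance : IsProbabilityMeasure (treeLaw ν) := by unfold treeLaw; infer_instance

/-- Assemble node data from those of the root and of the subtrees at its children. -/
def treeCons {X : Type*} (x : X) (η : ℕ → List ℕ → X) : List ℕ → X
  | [] => x
  | a :: b => η a b

theorem measurable_treeCons {X : Type*} [MeasurableSpace X] :
    Measurable fun p : X × (ℕ → List ℕ → X) => treeCons p.1 p.2 := by
  refine measurable_pi_iff.2 fun b => ?_
  cases b with
  | nil => exact measurable_fst
  | cons a b => exact (measurable_pi_apply b).comp ((measurable_pi_apply a).comp measurable_snd)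

theorem lintegral_treeLaw {f : (List ℕ → (ℕ → ℝ) × E) → ℝ≥0∞} (hf : Measurable f) :
    ∫⁻ ω, f ω ∂treeLaw ν = ∫⁻ p, f (treeCons p.1 p.2)
      ∂((expSeqLaw.prod ν).prod (Measure.infinitePi fun _ : ℕ => treeLaw ν)) := by
  have hc := hf.comp (measurable_treeCons (X := (ℕ → ℝ) × E))
  have h := infinitePi_map_tree (expSeqLaw.prod ν)
  unfold treeLaw
  rw [← h]
  refine ((lintegral_map hc (by fun_prop)).trans (lintegral_congr fun ω => ?_)).symm
  refine congrArg f ?_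
  funext b
  cases b <;> rfl

/-- A functional of the label of the root and of all the other node data can be integrated with an
independent copy of the label of the root. -/
theorem lintegral_treeLaw_root {Φ : E → (List ℕ → (ℕ → ℝ) × E) → ℝ≥0∞}
    (hΦ : Measurable (Function.uncurry Φ))
    (hind : ∀ z ω ω', (ω []).1 = (ω' []).1 → (∀ a b, ω (a :: b) = ω' (a :: b)) → Φ z ω = Φ z ω') :
    ∫⁻ ω, Φ (ω []).2 ω ∂treeLaw ν = ∫⁻ z, ∫⁻ ω, Φ z ω ∂treeLaw ν ∂ν := by
  have hm : ∀ z, Measurable (Φ z) := fun z => hΦ.comp (measurable_const.prodMk measurable_id)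
  have hcons : Measurable fun q : E × ((ℕ → ℝ) × E) × (ℕ → List ℕ → (ℕ → ℝ) × E) =>
      Φ q.1 (treeCons q.2.1 q.2.2) :=
    hΦ.comp (measurable_fst.prodMk (measurable_treeCons.comp measurable_snd))
  rw [lintegral_treeLaw (by
    exact hΦ.comp ((measurable_snd.comp (measurable_pi_apply [])).prodMk measurable_id))]
  have hR : ∀ z, ∫⁻ ω, Φ z ω ∂treeLaw ν = ∫⁻ ε, ∫⁻ η, Φ z (treeCons (ε, z) η)
      ∂(Measure.infinitePi fun _ : ℕ => treeLaw ν) ∂expSeqLaw := fun z => by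
    have h2 : Measurable fun p : ((ℕ → ℝ) × E) × (ℕ → List ℕ → (ℕ → ℝ) × E) =>
        Φ z (treeCons p.1 p.2) := (hm z).comp measurable_treeCons
    rw [lintegral_treeLaw (hm z), lintegral_prod _ h2.aemeasurable]
    have h1 : Measurable fun x : (ℕ → ℝ) × E => ∫⁻ η, Φ z (treeCons x η)
        ∂(Measure.infinitePi fun _ : ℕ => treeLaw ν) :=
      Measurable.lintegral_prod_right ((hm z).comp measurable_treeCons)
    rw [lintegral_prod _ h1.aemeasurable]
    refine lintegral_congr fun ε => ?_
    have : ∀ y η, Φ z (treeCons (ε, y) η) = Φ z (treeCons (ε, z) η) := fun y η =>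
      hind z _ _ rfl fun a b => rfl
    simp [this]
  simp only [hR]
  have hL : Measurable fun p : ((ℕ → ℝ) × E) × (ℕ → List ℕ → (ℕ → ℝ) × E) =>
      Φ p.1.2 (treeCons p.1 p.2) :=
    hcons.comp ((measurable_snd.comp measurable_fst).prodMk measurable_id)
  change ∫⁻ p : ((ℕ → ℝ) × E) × (ℕ → List ℕ → (ℕ → ℝ) × E), Φ p.1.2 (treeCons p.1 p.2) ∂_ = _
  rw [lintegral_prod _ hL.aemeasurable]
  exact lintegral_prod_symm _ (Measurable.lintegral_prod_right hL).aemeasurable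

theorem lintegral_expNeg_stableSum_prod {Ω : Type*} [MeasurableSpace Ω]
    {Q : Measure Ω} [IsProbabilityMeasure Q] {Y : Ω → ℝ≥0∞} {m : ℝ} (hY : Measurable Y)
    (h0 : 0 < m) (h1 : m < 1) :
    ∫⁻ p, expNeg (∑' j, ENNReal.ofReal (stablePoint m p.1.1 j) * Y (p.2 j))
      ∂((expSeqLaw.prod ν).prod (Measure.infinitePi fun _ : ℕ => Q)) =
      expNeg (stableConst m * ∫⁻ ω, Y ω ^ m ∂Q) := by
  rw [← lintegral_expNeg_stableSum hY h0 h1]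
  have hmp : MeasurePreserving (Prod.map Prod.fst id)
      ((expSeqLaw.prod ν).prod (Measure.infinitePi fun _ : ℕ => Q))
      (expSeqLaw.prod (Measure.infinitePi fun _ : ℕ => Q)) :=
    measurePreserving_fst.prod (.id _)
  exact hmp.lintegral_comp (measurable_expNeg.comp (measurable_stableSum hY))

/-- Recursion for the Laplace transform of a sum over the leaves of the tree. -/
theorem lintegral_expNeg_treeSum {ψ : S → ℝ≥0∞} (hψ : Measurable ψ) (r : ℕ) (m : ℕ → ℝ)
    {step : ℕ → S → E → S} (hstep : ∀ p, Measurable (Function.uncurry (step p)))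
    (h0 : 0 < m 0) (h1 : m 0 < 1) (c : ℝ≥0∞) (s : S) :
    ∫⁻ ω, expNeg (c * treeSum ψ (r + 1) m step s ω) ∂treeLaw ν =
      expNeg (stableConst (m 0) * ∫⁻ z, ∫⁻ ω, (c * treeSum ψ r (fun p => m (p + 1))
        (fun p => step (p + 1)) (step 0 s z) ω) ^ m 0 ∂treeLaw ν ∂ν) := by
  -- The mark of a child is the contribution of its whole subtree; the child's own label, which
  -- drives the step to it, sits at the root of the subtree data.
  set Y : (List ℕ → (ℕ → ℝ) × E) → ℝ≥0∞ := fun ω => c * treeSum ψ r (fun p => m (p + 1))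
        (fun p => step (p + 1)) (step 0 s (ω []).2) ω with hY
  have hT := measurable_treeSum (E := E) hψ r (fun p => m (p + 1)) (step := fun p => step (p + 1))
    fun p => hstep (p + 1)
  have hs0 : Measurable (step 0 s) := (hstep 0).comp (measurable_const.prodMk measurable_id)
  have hYm : Measurable Y := (hT.comp ((hs0.comp (measurable_snd.comp
    (measurable_pi_apply []))).prodMk measurable_id)).const_mul c
  have hroot : ∫⁻ ω, Y ω ^ m 0 ∂treeLaw ν = ∫⁻ z, ∫⁻ ω, (c * treeSum ψ r (fun p => m (p + 1))
        (fun p => step (p + 1)) (step 0 s z) ω) ^ m 0 ∂treeLaw ν ∂ν :=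
    lintegral_treeLaw_root (Φ := fun z ω => (c * treeSum ψ r (fun p => m (p + 1))
        (fun p => step (p + 1)) (step 0 s z) ω) ^ m 0)
      (((hT.comp ((hs0.comp measurable_fst).prodMk measurable_snd)).const_mul c).pow_const _)
      fun z ω ω' h h' => by rw [treeSum_congr_root ψ r _ _ _ h h']
  rw [← hroot, ← lintegral_expNeg_stableSum_prod (ν := ν) hYm h0 h1]
  have hm : Measurable fun ω => expNeg (c * treeSum ψ (r + 1) m step s ω) :=
    measurable_expNeg.comp ((measurable_treeSum_right hψ (r + 1) m hstep s).const_mul c)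
  rw [lintegral_treeLaw hm]
  have heq : ∀ p : ((ℕ → ℝ) × E) × (ℕ → List ℕ → (ℕ → ℝ) × E),
      c * treeSum ψ (r + 1) m step s (treeCons p.1 p.2) =
      ∑' a, ENNReal.ofReal (stablePoint (m 0) p.1.1 a) * Y (p.2 a) := fun p => by
    simp only [treeSum, ← ENNReal.tsum_mul_left, treeCons, hY]
    exact tsum_congr fun a => mul_left_comm _ _ _
  exact lintegral_congr fun p => congrArg expNeg (heq p)

end Tree

/-! ### Tilting a cascade, and finiteness of its mass -/

/-- Both moments, multiplied by `stableConst m`, are the same integral of one minus the Laplace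
transform. The constant is positive and finite, so it cancels even when the moments are infinite. -/
theorem lintegral_rpow_eq_of_laplace {Ω Ω' : Type*} [MeasurableSpace Ω] [MeasurableSpace Ω']
    {Q : Measure Ω} {Q' : Measure Ω'} [IsProbabilityMeasure Q] [IsProbabilityMeasure Q']
    {Y : Ω → ℝ≥0∞} {Y' : Ω' → ℝ≥0∞} (hY : Measurable Y) (hY' : Measurable Y')
    (h : ∀ c, ∫⁻ ω, expNeg (c * Y ω) ∂Q = ∫⁻ ω, expNeg (c * Y' ω) ∂Q') {m : ℝ} (h0 : 0 < m)
    (h1 : m < 1) : ∫⁻ ω, Y ω ^ m ∂Q = ∫⁻ ω, Y' ω ^ m ∂Q' := by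
  have e := lintegral_Ioi_one_sub_laplace (Q := Q) hY h0
  have e' := lintegral_Ioi_one_sub_laplace (Q := Q') hY' h0
  simp only [h] at e
  exact (ENNReal.mul_right_inj (stableConst_pos m).ne' (stableConst_lt_top h0 h1).ne).1
    (e.symm.trans e')

section Tilt

variable {S E E' : Type*} [MeasurableSpace S] [MeasurableSpace E] [MeasurableSpace E']
  {ν : Measure E} [IsProbabilityMeasure ν] {ν' : Measure E'} [IsProbabilityMeasure ν']

/-- Tilting of the labels of a cascade, at the level of Laplace transforms. -/
theorem laplace_treeSum_tilt (r : ℕ) : ∀ (m : ℕ → ℝ) (step : ℕ → S → E → S)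
    (step' : ℕ → S → E' → S) (W : ℕ → S → ℝ≥0∞),
    (∀ p < r, 0 < m p ∧ m p < 1) → (∀ p, Measurable (Function.uncurry (step p))) →
    (∀ p, Measurable (Function.uncurry (step' p))) → (∀ p, Measurable (W p)) →
    (∀ p < r, ∀ s, ∀ f : S → ℝ≥0∞, Measurable f →
      ∫⁻ x, W (p + 1) (step p s x) ^ m p * f (step p s x) ∂ν =
        W p s ^ m p * ∫⁻ x, f (step' p s x) ∂ν') →
    ∀ ψ : S → ℝ≥0∞, Measurable ψ → ∀ (c : ℝ≥0∞) (s : S),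
    ∫⁻ ω, expNeg (c * treeSum (fun s => W r s * ψ s) r m step s ω) ∂treeLaw ν =
      ∫⁻ ω, expNeg (c * (W 0 s * treeSum ψ r m step' s ω)) ∂treeLaw ν' := by
  induction r with
  | zero =>
    intro m step step' W _ _ _ _ _ ψ _ c s
    simp [treeSum]
  | succ r ih =>
    intro m step step' W hm hs hs' hW htilt ψ hψ c s
    obtain ⟨h0, h1⟩ := hm 0 r.succ_pos
    have hWψ : Measurable fun s => W (r + 1) s * ψ s := (hW (r + 1)).mul hψ
    have hT := measurable_treeSum (E := E) hWψ r (fun p => m (p + 1))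
      (step := fun p => step (p + 1)) fun p => hs (p + 1)
    have hT' := measurable_treeSum (E := E') hψ r (fun p => m (p + 1))
      (step := fun p => step' (p + 1)) fun p => hs' (p + 1)
    have hTs : ∀ s, Measurable (treeSum (fun s => W (r + 1) s * ψ s) r (fun p => m (p + 1))
      (fun p => step (p + 1)) s) := fun s => hT.comp (measurable_const.prodMk measurable_id)
    have hTs' : ∀ s, Measurable (treeSum ψ r (fun p => m (p + 1))
      (fun p => step' (p + 1)) s) := fun s => hT'.comp (measurable_const.prodMk measurable_id)
    -- The induction hypothesis holds for every c, hence fixes the moment of order `m 0` of the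
    -- subtree sums. The factor W 1 leaves with that same exponent, which is the form the tilting
    -- hypothesis at level 0 absorbs.
    have hfrac : ∀ s, ∫⁻ ω, treeSum (fun s => W (r + 1) s * ψ s) r (fun p => m (p + 1))
        (fun p => step (p + 1)) s ω ^ m 0 ∂treeLaw ν =
        W 1 s ^ m 0 * ∫⁻ ω, treeSum ψ r (fun p => m (p + 1)) (fun p => step' (p + 1)) s ω ^ m 0
          ∂treeLaw ν' := fun s => by
      have e := lintegral_rpow_eq_of_laplace (Q := treeLaw ν) (Q' := treeLaw ν') (hTs s)
        ((hTs' s).const_mul (W 1 s)) (fun c => ih (fun p => m (p + 1)) (fun p => step (p + 1))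
          (fun p => step' (p + 1)) (fun p => W (p + 1)) (fun p hp => hm (p + 1) (by omega))
          (fun p => hs (p + 1)) (fun p => hs' (p + 1)) (fun p => hW (p + 1))
          (fun p hp => htilt (p + 1) (by omega)) ψ hψ c s) h0 h1
      rw [e, ← lintegral_const_mul _ ((hTs' s).pow_const _)]
      simp only [ENNReal.mul_rpow_of_nonneg _ _ h0.le]
    rw [lintegral_expNeg_treeSum hWψ r m hs h0 h1]
    simp only [← mul_assoc]
    rw [lintegral_expNeg_treeSum hψ r m hs' h0 h1]
    congr 2
    simp only [ENNReal.mul_rpow_of_nonneg _ _ h0.le]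
    have hf : Measurable fun s => ∫⁻ ω, treeSum ψ r (fun p => m (p + 1))
        (fun p => step' (p + 1)) s ω ^ m 0 ∂treeLaw ν' :=
      Measurable.lintegral_prod_right (hT'.pow_const _)
    have hs0 : Measurable (step 0 s) := (hs 0).comp (measurable_const.prodMk measurable_id)
    have hs0' : Measurable (step' 0 s) := (hs' 0).comp (measurable_const.prodMk measurable_id)
    have hf' : Measurable fun z => ∫⁻ ω, treeSum ψ r (fun p => m (p + 1))
        (fun p => step' (p + 1)) (step' 0 s z) ω ^ m 0 ∂treeLaw ν' := hf.comp hs0'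
    calc _ = ∫⁻ z, c ^ m 0 * (W 1 (step 0 s z) ^ m 0 * ∫⁻ ω, treeSum ψ r (fun p => m (p + 1))
          (fun p => step' (p + 1)) (step 0 s z) ω ^ m 0 ∂treeLaw ν') ∂ν := by
          refine lintegral_congr fun z => ?_
          rw [lintegral_const_mul _ ((hTs _).pow_const _), hfrac]
      _ = c ^ m 0 * ∫⁻ z, (W 1 (step 0 s z) ^ m 0 * ∫⁻ ω, treeSum ψ r (fun p => m (p + 1))
          (fun p => step' (p + 1)) (step 0 s z) ω ^ m 0 ∂treeLaw ν') ∂ν :=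
          lintegral_const_mul _ ((((hW 1).comp hs0).pow_const _).mul (hf.comp hs0))
      _ = c ^ m 0 * (W 0 s ^ m 0 * ∫⁻ z, ∫⁻ ω, treeSum ψ r (fun p => m (p + 1))
          (fun p => step' (p + 1)) (step' 0 s z) ω ^ m 0 ∂treeLaw ν' ∂ν') := by
          rw [htilt 0 r.succ_pos s _ hf]
      _ = _ := by
          rw [← mul_assoc, ← lintegral_const_mul _ hf']
          exact lintegral_congr fun z => (lintegral_const_mul _ ((hTs' _).pow_const _)).symm

/-- The total mass of a cascade has small fractional moments. -/
theorem lintegral_treeSum_one_rpow_lt_top (r : ℕ) : ∀ (m : ℕ → ℝ) (step : ℕ → S → E → S),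
    (∀ p < r, 0 < m p ∧ m p < 1) → (∀ p, p + 1 < r → m p < m (p + 1)) →
    (∀ p, Measurable (Function.uncurry (step p))) →
    ∀ m' : ℝ, 0 < m' → m' < 1 → (0 < r → m' < m 0) → ∀ s : S,
    ∫⁻ ω, treeSum (fun _ => 1) r m step s ω ^ m' ∂treeLaw ν < ⊤ := by
  induction r with
  | zero =>
    intro m step _ _ _ m' _ _ _ s
    simp [treeSum]
  | succ r ih =>
    intro m step hm hlt hs m' h0' h1' hm' s
    obtain ⟨h0, h1⟩ := hm 0 r.succ_pos
    -- The subtrees have first parameter `m 1` > `m 0`, so their moment of order `m 0` is covered by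
    -- the induction hypothesis.
    have hA := ih (fun p => m (p + 1)) (fun p => step (p + 1)) (fun p hp => hm _ (by omega))
      (fun p hp => hlt _ (by omega)) (fun p => hs _) (m 0) h0 h1 (fun hr => hlt 0 (by omega)) s
    set A := ∫⁻ ω, treeSum (fun _ => (1 : ℝ≥0∞)) r (fun p => m (p + 1)) (fun p => step (p + 1))
      s ω ^ m 0 ∂treeLaw ν with hAdef
    have hTm : Measurable (treeSum (E := E) (fun _ : S => (1 : ℝ≥0∞)) (r + 1) m step s) :=
      measurable_treeSum_right measurable_const (r + 1) m hs s
    have hTr : Measurable (treeSum (E := E) (fun _ : S => (1 : ℝ≥0∞)) r (fun p => m (p + 1))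
        (fun p => step (p + 1)) s) :=
      measurable_treeSum_right measurable_const r _ (fun p => hs (p + 1)) s
    -- The total mass is a positive stable variable of index `m 0`. Its moment of order m' becomes
    -- the integral of 1 - exp(-K t^{-m 0 / m'}), which converges since `m 0` / m' > 1.
    have hLap : ∀ c : ℝ≥0∞, ∫⁻ ω, expNeg (c * treeSum (fun _ => 1) (r + 1) m step s ω) ∂treeLaw ν =
        expNeg (stableConst (m 0) * A * c ^ m 0) := fun c => by
      rw [lintegral_expNeg_treeSum measurable_const r m hs h0 h1]
      congr 1
      rw [mul_assoc]
      congr 1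
      have hst : ∀ z ω, treeSum (fun _ => (1 : ℝ≥0∞)) r (fun p => m (p + 1))
          (fun p => step (p + 1)) (step 0 s z) ω = treeSum (fun _ => 1) r (fun p => m (p + 1))
          (fun p => step (p + 1)) s ω := fun z ω => treeSum_const_state _ _ _ _ _ _ _
      simp only [hst, ENNReal.mul_rpow_of_nonneg _ _ h0.le]
      rw [lintegral_const, measure_univ, mul_one, lintegral_const_mul _ (hTr.pow_const _), mul_comm]
    have e := lintegral_Ioi_one_sub_laplace (Q := treeLaw ν) hTm h0'
    have hfin : stableConst m' * ∫⁻ ω, treeSum (fun _ => 1) (r + 1) m step s ω ^ m' ∂treeLaw ν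
        < ⊤ := by
      rw [← e]
      have hc : stableConst (m 0) * A ≠ ⊤ :=
        (ENNReal.mul_lt_top (stableConst_lt_top h0 h1) hA).ne
      refine lt_of_eq_of_lt ?_ (lintegral_one_sub_expNeg_rpow_lt_top hc
        ((one_lt_div h0').2 (hm' r.succ_pos)))
      refine setLIntegral_congr_fun measurableSet_Ioi fun t ht => ?_
      have ht' : (0 : ℝ) < t := ht
      rw [hLap, ENNReal.ofReal_rpow_of_nonneg (Real.rpow_nonneg ht'.le _) h0.le,
        ← Real.rpow_mul ht'.le, show -(1 / m') * m 0 = -(m 0 / m') by ring]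
    by_contra htop
    rw [not_lt_top_iff.1 htop, ENNReal.mul_top (stableConst_pos m').ne'] at hfin
    exact lt_irrefl _ hfin

theorem ae_treeSum_one_lt_top {r : ℕ} {m : ℕ → ℝ} {step : ℕ → S → E → S}
    (hm : ∀ p < r, 0 < m p ∧ m p < 1) (hlt : ∀ p, p + 1 < r → m p < m (p + 1))
    (hs : ∀ p, Measurable (Function.uncurry (step p))) (s : S) :
    ∀ᵐ ω ∂treeLaw ν, treeSum (fun _ => 1) r m step s ω < ⊤ := by
  rcases r.eq_zero_or_pos with rfl | hr
  · simp [treeSum]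
  obtain ⟨h0, h1⟩ := hm 0 hr
  have h := lintegral_treeSum_one_rpow_lt_top (ν := ν) r m step hm hlt hs (m 0 / 2) (by linarith)
    (by linarith) (fun _ => by linarith) s
  have hTm : Measurable (treeSum (E := E) (fun _ : S => (1 : ℝ≥0∞)) r m step s) :=
      measurable_treeSum_right measurable_const r m hs s
  filter_upwards [ae_lt_top (hTm.pow_const _) h.ne] with ω hω
  by_contra htop
  rw [not_lt_top_iff.1 htop, ENNReal.top_rpow_of_pos (by linarith)] at hω
  exact lt_irrefl _ hω

end Tilt


/-! ### From Laplace transforms to joint laws -/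

/-- A probability measure on `[0,∞]^ι` is determined by its Laplace transform. -/
theorem ext_of_lintegral_expNeg {ι : Type*} [Fintype ι] {P P' : Measure (ι → ℝ≥0∞)}
    [IsProbabilityMeasure P] [IsProbabilityMeasure P']
    (h : ∀ c : ι → ℝ≥0∞, ∫⁻ v, expNeg (∑ i, c i * v i) ∂P = ∫⁻ v, expNeg (∑ i, c i * v i) ∂P') :
    P = P' := by
  classical
  have hcont : Continuous fun x => (expNeg x).toReal :=
    continuous_iff_continuousAt.2 fun x =>
      (ENNReal.tendsto_toReal (expNeg_ne_top x)).comp (continuous_expNeg.tendsto x)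
  have hle : ∀ x, (expNeg x).toReal ≤ 1 := fun x => by
    simpa using ENNReal.toReal_mono ENNReal.one_ne_top (expNeg_le_one x)
  let b : ι → BoundedContinuousFunction (ι → ℝ≥0∞) ℝ := fun i =>
    BoundedContinuousFunction.ofNormedAddCommGroup (fun v => (expNeg (v i)).toReal)
      (hcont.comp (continuous_apply i)) 1 fun v => by
        rw [Real.norm_of_nonneg ENNReal.toReal_nonneg]
        exact hle _
  -- The algebra generated by the functions e^{-v_i} separates points of [0,∞]^ι and consists of
  -- bounded continuous functions, so it determines the measure.
  let A : StarSubalgebra ℝ (BoundedContinuousFunction (ι → ℝ≥0∞) ℝ) :=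
    { Algebra.adjoin ℝ (Set.range b) with
      star_mem' := fun {a} ha => by
        have : star a = a := by ext; simp
        rwa [this] }
  refine ext_of_forall_mem_subalgebra_integral_eq_of_polish (𝕜 := ℝ) (A := A) ?_ fun g hg => ?_
  · intro x y hxy
    obtain ⟨i, hi⟩ := Function.ne_iff.1 hxy
    refine ⟨fun v => (expNeg (v i)).toReal, ⟨BoundedContinuousFunction.toContinuousMap (b i),
      ⟨b i, Algebra.subset_adjoin ⟨i, rfl⟩, rfl⟩, rfl⟩, fun h => hi ?_⟩
    exact expNeg_strictAnti.injective
      ((ENNReal.toReal_eq_toReal_iff' (expNeg_ne_top _) (expNeg_ne_top _)).1 h)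
  -- The algebra is the linear span of the monomials in the generators, and a monomial is e^{-∑ n_i
  -- v_i}: a Laplace transform at integer arguments.
  · have hmono : ∀ x ∈ Submonoid.closure (Set.range b), ∃ n : ι → ℕ, ∀ v,
        x v = (expNeg (∑ i, (n i : ℝ≥0∞) * v i)).toReal := fun x hx => by
      induction hx using Submonoid.closure_induction with
      | mem x hx =>
        obtain ⟨i, rfl⟩ := hx
        refine ⟨Pi.single i 1, fun v => ?_⟩
        rw [Finset.sum_eq_single i (fun j _ hj => by simp [Pi.single_eq_of_ne hj]) (by simp)]
        simp [b]
      | one => exact ⟨0, fun v => by simp [expNeg_zero]⟩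
      | mul x y _ _ hx hy =>
        obtain ⟨n, hn⟩ := hx
        obtain ⟨n', hn'⟩ := hy
        refine ⟨n + n', fun v => ?_⟩
        simp only [BoundedContinuousFunction.coe_mul, Pi.mul_apply, hn, hn', Pi.add_apply,
          Nat.cast_add, add_mul, Finset.sum_add_distrib, expNeg_add, ENNReal.toReal_mul]
    have hspan : g ∈ Submodule.span ℝ (Submonoid.closure (Set.range b) : Set _) := by
      rw [← Algebra.adjoin_eq_span]
      exact hg
    induction hspan using Submodule.span_induction with
    | mem x hx =>
      obtain ⟨n, hn⟩ := hmono x hx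
      have hm : Measurable fun v : ι → ℝ≥0∞ => expNeg (∑ i, (n i : ℝ≥0∞) * v i) :=
        measurable_expNeg.comp (by fun_prop)
      simp only [hn]
      rw [integral_toReal hm.aemeasurable (ae_of_all _ fun v => (expNeg_ne_top _).lt_top),
        integral_toReal hm.aemeasurable (ae_of_all _ fun v => (expNeg_ne_top _).lt_top), h]
    | zero => simp
    | add x y hx hy ihx ihy =>
      simp only [BoundedContinuousFunction.coe_add, Pi.add_apply]
      rw [integral_add (x.integrable _) (y.integrable _),
        integral_add (x.integrable _) (y.integrable _),
        ihx (by rw [← Algebra.adjoin_eq_span] at hx; exact hx),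
        ihy (by rw [← Algebra.adjoin_eq_span] at hy; exact hy)]
    | smul a x hx ihx =>
      simp only [BoundedContinuousFunction.coe_smul, integral_smul]
      rw [ihx (by rw [← Algebra.adjoin_eq_span] at hx; exact hx)]

section Tilt

variable {S E E' : Type*} [MeasurableSpace S] [MeasurableSpace E] [MeasurableSpace E']
  {ν : Measure E} [IsProbabilityMeasure ν] {ν' : Measure E'} [IsProbabilityMeasure ν']

/-- Tilting of the labels of a cascade: equality in law of finitely many weighted sums. -/
theorem map_treeSum_tilt {ι : Type*} [Fintype ι] {r : ℕ} {m : ℕ → ℝ} {step : ℕ → S → E → S}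
    {step' : ℕ → S → E' → S} {W : ℕ → S → ℝ≥0∞}
    (hm : ∀ p < r, 0 < m p ∧ m p < 1) (hs : ∀ p, Measurable (Function.uncurry (step p)))
    (hs' : ∀ p, Measurable (Function.uncurry (step' p))) (hW : ∀ p, Measurable (W p))
    (htilt : ∀ p < r, ∀ s, ∀ f : S → ℝ≥0∞, Measurable f →
      ∫⁻ x, W (p + 1) (step p s x) ^ m p * f (step p s x) ∂ν =
        W p s ^ m p * ∫⁻ x, f (step' p s x) ∂ν')
    {ψ : ι → S → ℝ≥0∞} (hψ : ∀ i, Measurable (ψ i)) (s : S) :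
    (treeLaw ν).map (fun ω i => treeSum (fun s => W r s * ψ i s) r m step s ω) =
      (treeLaw ν').map (fun ω i => W 0 s * treeSum (ψ i) r m step' s ω) := by
  have hm1 : Measurable fun ω i => treeSum (fun s => W r s * ψ i s) r m step s ω :=
    measurable_pi_iff.2 fun i => measurable_treeSum_right ((hW r).mul (hψ i)) r m hs s
  have hm2 : Measurable fun ω i => W 0 s * treeSum (ψ i) r m step' s ω :=
    measurable_pi_iff.2 fun i => (measurable_treeSum_right (hψ i) r m hs' s).const_mul _
  have := Measure.isProbabilityMeasure_map (μ := treeLaw ν) hm1.aemeasurable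
  have := Measure.isProbabilityMeasure_map (μ := treeLaw ν') hm2.aemeasurable
  refine ext_of_lintegral_expNeg fun c => ?_
  have hc : Measurable fun v : ι → ℝ≥0∞ => expNeg (∑ i, c i * v i) :=
    measurable_expNeg.comp (by fun_prop)
  rw [lintegral_map hc hm1, lintegral_map hc hm2]
  -- A linear combination of leaf sums is the leaf sum of the combined test function, so the
  -- one-dimensional result already yields the joint transform.
  have h := laplace_treeSum_tilt (ν := ν) (ν' := ν') r m step step' W hm hs hs' hW htilt
    (fun s => ∑ i, c i * ψ i s) (Finset.measurable_fun_sum _ fun i _ => (hψ i).const_mul _) 1 s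
  simp only [one_mul, treeSum_sum, Finset.mul_sum] at h
  simp only [mul_left_comm (W _ _), treeSum_sum c (fun i s => W r s * ψ i s)] at h
  exact h

end Tilt


/-! ### The mixture ξ: bounds and primitives -/

section Mixture

variable {β : ℕ → ℝ}

theorem coeff_le (hβ : ∀ p : ℕ, 2 ≤ p → |β p| ≤ 1 / (p : ℝ) ^ 2) {p : ℕ} (hp : 2 ≤ p) :
    β p ^ 2 ≤ 1 / (p : ℝ) ^ 4 := by
  have h := pow_le_pow_left₀ (abs_nonneg _) (hβ p hp) 2
  rw [sq_abs] at h
  refine h.trans_eq ?_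
  rw [div_pow, one_pow, ← pow_mul]

theorem summable_sq_coeff (hβ : ∀ p : ℕ, 2 ≤ p → |β p| ≤ 1 / (p : ℝ) ^ 2) :
    Summable fun p : ℕ => if 2 ≤ p then (p : ℝ) ^ 2 * β p ^ 2 else 0 := by
  refine Summable.of_nonneg_of_le (fun p => by split_ifs <;> positivity) (fun p => ?_)
    (Real.summable_one_div_nat_pow.2 one_lt_two)
  split_ifs with hp
  · have h0 : (0 : ℝ) < p := by positivity
    calc (p : ℝ) ^ 2 * β p ^ 2 ≤ (p : ℝ) ^ 2 * (1 / (p : ℝ) ^ 4) := by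
          gcongr; exact coeff_le hβ hp
      _ = 1 / (p : ℝ) ^ 2 := by field_simp
  · positivity

theorem xiD_term_le {x : ℝ} (h0 : 0 ≤ x) (h1 : x ≤ 1) (p : ℕ) :
    (if 2 ≤ p then (p : ℝ) * β p ^ 2 * x ^ (p - 1) else 0) ≤
      if 2 ≤ p then (p : ℝ) ^ 2 * β p ^ 2 else 0 := by
  split_ifs with hp
  · have h2 : (1 : ℝ) ≤ p := by exact_mod_cast (by omega : 1 ≤ p)
    calc (p : ℝ) * β p ^ 2 * x ^ (p - 1) ≤ p * β p ^ 2 * 1 := by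
          gcongr; exact pow_le_one₀ h0 h1
      _ ≤ (p : ℝ) ^ 2 * β p ^ 2 := by
          rw [mul_one]
          gcongr
          exact le_self_pow₀ h2 two_ne_zero
  · rfl

theorem xiD_term_nonneg {x : ℝ} (h0 : 0 ≤ x) (p : ℕ) :
    0 ≤ if 2 ≤ p then (p : ℝ) * β p ^ 2 * x ^ (p - 1) else 0 := by
  split_ifs <;> positivity

theorem summable_xiD (hβ : ∀ p : ℕ, 2 ≤ p → |β p| ≤ 1 / (p : ℝ) ^ 2) {x : ℝ} (h0 : 0 ≤ x)
    (h1 : x ≤ 1) : Summable fun p : ℕ => if 2 ≤ p then (p : ℝ) * β p ^ 2 * x ^ (p - 1) else 0 :=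
  Summable.of_nonneg_of_le (xiD_term_nonneg h0) (xiD_term_le h0 h1) (summable_sq_coeff hβ)

theorem xiD_nonneg {x : ℝ} (h0 : 0 ≤ x) : 0 ≤ xiD β x := tsum_nonneg (xiD_term_nonneg h0)

theorem xiD_mono (hβ : ∀ p : ℕ, 2 ≤ p → |β p| ≤ 1 / (p : ℝ) ^ 2) {x y : ℝ} (h0 : 0 ≤ x)
    (hxy : x ≤ y) (h1 : y ≤ 1) : xiD β x ≤ xiD β y := by
  refine Summable.tsum_le_tsum (fun p => ?_) (summable_xiD hβ h0 (hxy.trans h1))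
    (summable_xiD hβ (h0.trans hxy) h1)
  split_ifs
  · gcongr
  · rfl

/-- The terms are at most p^{-3} ≤ 1/((p-1)p(p+1)), a telescoping series with sum 1/4 over p ≥ 2.
The value 1/4 later yields E exp(Z²) ≤ √2 and keeps the Gaussian integrals of the potentials finite.
-/
theorem xiD_one_le (hβ : ∀ p : ℕ, 2 ≤ p → |β p| ≤ 1 / (p : ℝ) ^ 2) : xiD β 1 ≤ 1 / 4 := by
  refine Real.tsum_le_of_sum_range_le (xiD_term_nonneg zero_le_one) fun N => ?_
  have key : ∀ N : ℕ, ∑ p ∈ Finset.range (N + 2),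
      (if 2 ≤ p then (p : ℝ) * β p ^ 2 * (1 : ℝ) ^ (p - 1) else 0) ≤
        1 / 4 - 1 / (2 * ((N : ℝ) + 1) * (N + 2)) := fun N => by
    induction N with
    | zero => norm_num [Finset.sum_range_succ]
    | succ N ih =>
      rw [Finset.sum_range_succ]
      have hle := coeff_le hβ (p := N + 2) (by omega)
      rw [if_pos (by omega), one_pow, mul_one]
      push_cast at hle ⊢
      have hN : (0 : ℝ) ≤ N := by positivity
      have h3 : ((N : ℝ) + 2) * β (N + 2) ^ 2 ≤ 1 / ((N + 1) * (N + 2) * (N + 3)) := by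
        calc ((N : ℝ) + 2) * β (N + 2) ^ 2 ≤ ((N : ℝ) + 2) * (1 / ((N : ℝ) + 2) ^ 4) := by gcongr
          _ = 1 / ((N : ℝ) + 2) ^ 3 := by field_simp
          _ ≤ _ := by
            apply one_div_le_one_div_of_le (by positivity)
            nlinarith
      have h4 : (1 : ℝ) / (2 * (N + 1) * (N + 2)) - 1 / (2 * (N + 1 + 1) * (N + 1 + 2)) =
          1 / ((N + 1) * (N + 2) * (N + 3)) := by
        rw [show (N : ℝ) + 1 + 1 = N + 2 by ring, show (N : ℝ) + 1 + 2 = N + 3 by ring]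
        field_simp
        ring
      linarith
  have hpos : (0 : ℝ) ≤ 1 / (2 * ((N : ℝ) + 1) * (N + 2)) := by positivity
  calc _ ≤ ∑ p ∈ Finset.range (N + 2), _ := Finset.sum_le_sum_of_subset_of_nonneg
        (Finset.range_subset_range.2 (by omega)) fun p _ _ => xiD_term_nonneg zero_le_one p
    _ ≤ _ := (key N).trans (by linarith)

/-- Termwise p(p-1) + p = p², so xξ'' + ξ' has a series dominated on [0,1] by the summable p²β_p².
This replaces any differentiation at the endpoint 1. -/
theorem xiDD_xiD_hasSum (hβ : ∀ p : ℕ, 2 ≤ p → |β p| ≤ 1 / (p : ℝ) ^ 2) {x : ℝ} (h0 : 0 ≤ x)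
    (h1 : x ≤ 1) : HasSum (fun p : ℕ => if 2 ≤ p then (p : ℝ) ^ 2 * β p ^ 2 * x ^ (p - 1) else 0)
      (x * xiDD β x + xiD β x) := by
  have hs : Summable fun p : ℕ =>
      if 2 ≤ p then (p : ℝ) * ((p : ℝ) - 1) * β p ^ 2 * x ^ (p - 2) else 0 := by
    refine Summable.of_nonneg_of_le (fun p => ?_) (fun p => ?_) (summable_sq_coeff hβ)
    · split_ifs with hp
      · have h2 : (1 : ℝ) ≤ p := by exact_mod_cast (by omega : 1 ≤ p)
        have := sub_nonneg.2 h2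
        positivity
      · rfl
    · split_ifs with hp
      · have h2 : (1 : ℝ) ≤ p := by exact_mod_cast (by omega : 1 ≤ p)
        have := sub_nonneg.2 h2
        calc (p : ℝ) * ((p : ℝ) - 1) * β p ^ 2 * x ^ (p - 2) ≤ p * ((p : ℝ) - 1) * β p ^ 2 * 1 := by
              gcongr; exact pow_le_one₀ h0 h1
          _ ≤ (p : ℝ) ^ 2 * β p ^ 2 := by nlinarith [sq_nonneg (β p)]
      · rfl
  have h := (hs.hasSum.mul_left x).add (summable_xiD hβ h0 h1).hasSum
  refine (congrArg (fun f => HasSum f (x * xiDD β x + xiD β x)) (funext fun p => ?_)).mp h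
  split_ifs with hp
  · obtain ⟨j, rfl⟩ := Nat.exists_eq_add_of_le hp
    rw [show 2 + j - 2 = j by omega, show 2 + j - 1 = j + 1 by omega]
    ring
  · simp

theorem abs_xiDD_term_le {x : ℝ} (h0 : 0 ≤ x) (h1 : x ≤ 1) (p : ℕ) :
    ‖if 2 ≤ p then (p : ℝ) ^ 2 * β p ^ 2 * x ^ (p - 1) else 0‖ ≤
      if 2 ≤ p then (p : ℝ) ^ 2 * β p ^ 2 else 0 := by
  split_ifs with hp
  · rw [Real.norm_of_nonneg (by positivity)]
    exact mul_le_of_le_one_right (by positivity) (pow_le_one₀ h0 h1)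
  · simp

theorem continuousOn_xiDD_xiD (hβ : ∀ p : ℕ, 2 ≤ p → |β p| ≤ 1 / (p : ℝ) ^ 2) :
    ContinuousOn (fun x => x * xiDD β x + xiD β x) (Set.Icc 0 1) := by
  refine (continuousOn_tsum (f := fun (p : ℕ) (x : ℝ) =>
    if 2 ≤ p then (p : ℝ) ^ 2 * β p ^ 2 * x ^ (p - 1) else 0) (fun p => ?_)
    (summable_sq_coeff hβ) fun p x hx => abs_xiDD_term_le hx.1 hx.2 p).congr fun x hx =>
      (xiDD_xiD_hasSum hβ hx.1 hx.2).tsum_eq.symm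
  split_ifs <;> fun_prop

/-- The integrand is formally (xξ'(x))'; the primitive is justified by integrating the dominated
series term by term. -/
theorem integral_xiDD_xiD (hβ : ∀ p : ℕ, 2 ≤ p → |β p| ≤ 1 / (p : ℝ) ^ 2) {q : ℝ} (h0 : 0 ≤ q)
    (h1 : q ≤ 1) : ∫ x in q..1, (x * xiDD β x + xiD β x) = xiD β 1 - q * xiD β q := by
  have hI : ∀ x ∈ Set.uIoc q 1, 0 ≤ x ∧ x ≤ 1 := fun x hx => by
    rw [Set.uIoc_of_le h1] at hx
    exact ⟨h0.trans hx.1.le, hx.2⟩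
  have hs := intervalIntegral.hasSum_integral_of_dominated_convergence (μ := volume) (a := q) (b := 1)
    (F := fun (p : ℕ) (x : ℝ) => if 2 ≤ p then (p : ℝ) ^ 2 * β p ^ 2 * x ^ (p - 1) else 0)
    (f := fun x => x * xiDD β x + xiD β x)
    (fun p _ => if 2 ≤ p then (p : ℝ) ^ 2 * β p ^ 2 else 0)
    (fun p => by split_ifs <;> exact Continuous.aestronglyMeasurable (by fun_prop))
    (fun p => ae_of_all _ fun x hx => abs_xiDD_term_le (hI x hx).1 (hI x hx).2 p)
    (ae_of_all _ fun x _ => summable_sq_coeff hβ) intervalIntegrable_const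
    (ae_of_all _ fun x hx => xiDD_xiD_hasSum hβ (hI x hx).1 (hI x hx).2)
  have h := (summable_xiD hβ zero_le_one le_rfl).hasSum.sub
    ((summable_xiD hβ h0 h1).hasSum.mul_left q)
  refine hs.unique ((congrArg (fun f => HasSum f (xiD β 1 - q * xiD β q))
    (funext fun p => ?_)).mp h)
  split_ifs with hp
  · obtain ⟨j, rfl⟩ := Nat.exists_eq_add_of_le hp
    rw [intervalIntegral.integral_const_mul, integral_pow, show 2 + j - 1 = j + 1 by omega]
    push_cast
    have : (j : ℝ) + 1 + 1 ≠ 0 := by positivity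
    field_simp
    ring
  · simp

end Mixture

/-! ### Cumulative weights, S, Ŝ and the increments -/

namespace FiniteRSB

variable (ζ : FiniteRSB) {β : ℕ → ℝ}

theorem q_strictMono {i j : ℕ} (hij : i < j) (hj : j ≤ ζ.r) : ζ.q i < ζ.q j := by
  induction j, hij using Nat.le_induction with
  | base => exact ζ.q_lt i (by omega)
  | succ j _ ih => exact (ih (by omega)).trans (ζ.q_lt j (by omega))

theorem q_mono {i j : ℕ} (hij : i ≤ j) (hj : j ≤ ζ.r) : ζ.q i ≤ ζ.q j := by
  rcases hij.eq_or_lt with rfl | h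
  · rfl
  · exact (ζ.q_strictMono h hj).le

theorem q_nonneg' {p : ℕ} (hp : p ≤ ζ.r) : 0 ≤ ζ.q p :=
  ζ.q_nonneg.trans (ζ.q_mono p.zero_le hp)

theorem q_le_one' {p : ℕ} (hp : p ≤ ζ.r) : ζ.q p ≤ 1 := (ζ.q_mono hp le_rfl).trans ζ.q_le_one

theorem cdf_eq (t : ℝ) :
    ζ.cdf t = ∑ p ∈ Finset.range (ζ.r + 1), if ζ.q p ≤ t then ζ.mass p else 0 := by
  rw [cdf, Measure.real, measure, Measure.coe_finsetSum, Finset.sum_apply,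
    ENNReal.toReal_sum (fun p _ => by
      simp only [Measure.smul_apply, smul_eq_mul]
      exact ENNReal.mul_ne_top ENNReal.ofReal_ne_top (measure_ne_top _ _))]
  refine Finset.sum_congr rfl fun p hp => ?_
  have hp' : p ≤ ζ.r := by simpa [Nat.lt_succ_iff] using hp
  rw [Measure.smul_apply, Measure.dirac_apply' _ measurableSet_Icc, smul_eq_mul,
    ENNReal.toReal_mul, ENNReal.toReal_ofReal (ζ.mass_pos p hp').le]
  by_cases h : ζ.q p ≤ t <;> simp [Set.indicator, h, ζ.q_nonneg' hp']

theorem cdf_q {p : ℕ} (hp : p ≤ ζ.r) : ζ.cdf (ζ.q p) = ∑ j ∈ Finset.range (p + 1), ζ.mass j := by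
  rw [cdf_eq, ← Finset.sum_filter]
  refine Finset.sum_congr ?_ fun _ _ => rfl
  ext j
  simp only [Finset.mem_filter, Finset.mem_range]
  constructor
  · rintro ⟨hj, h⟩
    by_contra hn
    exact absurd h (not_le.2 (ζ.q_strictMono (by omega) (by omega)))
  · intro h
    exact ⟨by omega, ζ.q_mono (by omega) hp⟩

theorem cdf_q_pos {p : ℕ} (hp : p ≤ ζ.r) : 0 < ζ.cdf (ζ.q p) := by
  rw [ζ.cdf_q hp]
  exact Finset.sum_pos (fun j hj => ζ.mass_pos j (by simp at hj; omega)) (by simp)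

theorem cdf_q_lt {p : ℕ} (hp : p + 1 ≤ ζ.r) : ζ.cdf (ζ.q p) < ζ.cdf (ζ.q (p + 1)) := by
  rw [ζ.cdf_q hp, ζ.cdf_q (by omega), Finset.sum_range_succ _ (p + 1)]
  linarith [ζ.mass_pos (p + 1) hp]

theorem cdf_q_last : ζ.cdf (ζ.q ζ.r) = 1 := by rw [ζ.cdf_q le_rfl, ζ.mass_sum]

theorem cdf_q_lt_one {p : ℕ} (hp : p < ζ.r) : ζ.cdf (ζ.q p) < 1 := by
  rw [← ζ.mass_sum, ζ.cdf_q hp.le]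
  refine Finset.sum_lt_sum_of_subset (Finset.range_subset_range.2 (by omega)) (i := ζ.r)
    (by simp) (by simp; omega) (ζ.mass_pos _ le_rfl) fun j hj _ => (ζ.mass_pos j ?_).le
  simp at hj
  omega

/-- Summation by parts: the increments of the distribution function along the support are the
masses. -/
theorem Shat_eq : ζ.Shat β = xiD β ζ.qStar -
    ∑ p ∈ Finset.range (ζ.r + 1), ζ.mass p * (ζ.q p * xiD β (ζ.q p)) := by
  have key : ∀ N ≤ ζ.r, ∑ p ∈ Finset.range N,
      (ζ.q (p + 1) * xiD β (ζ.q (p + 1)) - ζ.q p * xiD β (ζ.q p)) * ζ.cdf (ζ.q p) =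
      ζ.q N * xiD β (ζ.q N) * ζ.cdf (ζ.q N) -
        ∑ p ∈ Finset.range (N + 1), ζ.mass p * (ζ.q p * xiD β (ζ.q p)) := fun N hN => by
    induction N with
    | zero => simp [ζ.cdf_q ζ.r.zero_le]; ring
    | succ N ih =>
      rw [Finset.sum_range_succ, ih (by omega), Finset.sum_range_succ _ (N + 1),
        ζ.cdf_q hN, ζ.cdf_q (by omega), Finset.sum_range_succ ζ.mass (N + 1)]
      ring
  rw [Shat, key _ le_rfl, cdf_q_last, qStar]
  ring

/-- The distribution function is a mixture of indicators of [q_p, ∞), and each indicator contributes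
ξ'(1) - q_p ξ'(q_p). -/
theorem S_eq (hβ : ∀ p : ℕ, 2 ≤ p → |β p| ≤ 1 / (p : ℝ) ^ 2) : ζ.S β = xiD β 1 -
    ∑ p ∈ Finset.range (ζ.r + 1), ζ.mass p * (ζ.q p * xiD β (ζ.q p)) := by
  have hint : IntervalIntegrable (fun x => x * xiDD β x + xiD β x) volume 0 1 :=
    ContinuousOn.intervalIntegrable (by
      rw [Set.uIcc_of_le zero_le_one]
      exact continuousOn_xiDD_xiD hβ)
  have hterm : ∀ q, 0 ≤ q → q ≤ 1 → ∫ l in (0 : ℝ)..1,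
      (Set.Ici q).indicator (fun x => x * xiDD β x + xiD β x) l = xiD β 1 - q * xiD β q := by
    intro q h0 h1
    rw [← integral_xiDD_xiD hβ h0 h1, intervalIntegral.integral_of_le zero_le_one,
      intervalIntegral.integral_of_le h1, setIntegral_indicator measurableSet_Ici]
    refine setIntegral_congr_set ?_
    have hne : ∀ᵐ x : ℝ, x ≠ q := by simp [ae_iff]
    filter_upwards [hne] with x hx
    refine propext ⟨fun h => ⟨lt_of_le_of_ne h.2 hx.symm, h.1.2⟩,
      fun h => ⟨⟨h0.trans_lt h.1, h.2⟩, h.1.le⟩⟩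
  have hcdf : ∀ l, ζ.cdf l * (l * xiDD β l + xiD β l) = ∑ p ∈ Finset.range (ζ.r + 1),
      ζ.mass p * (Set.Ici (ζ.q p)).indicator (fun x => x * xiDD β x + xiD β x) l := fun l => by
    rw [cdf_eq, Finset.sum_mul]
    refine Finset.sum_congr rfl fun p _ => ?_
    by_cases h : ζ.q p ≤ l <;> simp [Set.indicator, h]
  simp only [S, hcdf]
  rw [intervalIntegral.integral_finsetSum]
  · have h1 : ∀ p ∈ Finset.range (ζ.r + 1), ∫ l in (0 : ℝ)..1, ζ.mass p *
        (Set.Ici (ζ.q p)).indicator (fun x => x * xiDD β x + xiD β x) l =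
        ζ.mass p * xiD β 1 - ζ.mass p * (ζ.q p * xiD β (ζ.q p)) := fun p hp => by
      have hp' : p ≤ ζ.r := by simpa [Nat.lt_succ_iff] using hp
      rw [intervalIntegral.integral_const_mul, hterm _ (ζ.q_nonneg' hp') (ζ.q_le_one' hp'), mul_sub]
    rw [Finset.sum_congr rfl h1, Finset.sum_sub_distrib, ← Finset.sum_mul, ζ.mass_sum, one_mul]
  · intro p _
    refine IntervalIntegrable.const_mul ?_ _
    rw [intervalIntegrable_iff] at hint ⊢
    exact hint.indicator measurableSet_Ici

/-- S and Ŝ subtract the same average of qξ'(q), from ξ'(1) and ξ'(q_*) respectively. The difference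
is the variance of y in ρ, which the Gaussian integral over y returns to the exponent. -/
theorem S_eq_Shat (hβ : ∀ p : ℕ, 2 ≤ p → |β p| ≤ 1 / (p : ℝ) ^ 2) :
    ζ.S β = ζ.Shat β + (xiD β 1 - xiD β ζ.qStar) := by
  rw [S_eq ζ hβ, Shat_eq]
  ring

theorem xiD_qStar_le (hβ : ∀ p : ℕ, 2 ≤ p → |β p| ≤ 1 / (p : ℝ) ^ 2) :
    xiD β ζ.qStar ≤ xiD β 1 := xiD_mono hβ (ζ.q_nonneg' le_rfl) ζ.q_le_one le_rfl

theorem Shat_nonneg (hβ : ∀ p : ℕ, 2 ≤ p → |β p| ≤ 1 / (p : ℝ) ^ 2) : 0 ≤ ζ.Shat β := by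
  rw [Shat_eq]
  have h : ∑ p ∈ Finset.range (ζ.r + 1), ζ.mass p * (ζ.q p * xiD β (ζ.q p)) ≤
      ∑ p ∈ Finset.range (ζ.r + 1), ζ.mass p * xiD β ζ.qStar := by
    refine Finset.sum_le_sum fun p hp => ?_
    have hp' : p ≤ ζ.r := by simpa [Nat.lt_succ_iff] using hp
    have h0 := ζ.q_nonneg' hp'
    refine mul_le_mul_of_nonneg_left ?_ (ζ.mass_pos p hp').le
    exact (mul_le_of_le_one_left (xiD_nonneg h0) (ζ.q_le_one' hp')).trans
      (xiD_mono hβ h0 (ζ.q_mono hp' le_rfl) ζ.q_le_one)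
  rw [← Finset.sum_mul, ζ.mass_sum, one_mul] at h
  linarith

theorem Shat_le (hβ : ∀ p : ℕ, 2 ≤ p → |β p| ≤ 1 / (p : ℝ) ^ 2) : ζ.Shat β ≤ 1 / 4 := by
  rw [Shat_eq]
  have h : 0 ≤ ∑ p ∈ Finset.range (ζ.r + 1), ζ.mass p * (ζ.q p * xiD β (ζ.q p)) := by
    refine Finset.sum_nonneg fun p hp => ?_
    have hp' : p ≤ ζ.r := by simpa [Nat.lt_succ_iff] using hp
    exact mul_nonneg (ζ.mass_pos p hp').le
      (mul_nonneg (ζ.q_nonneg' hp') (xiD_nonneg (ζ.q_nonneg' hp')))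
  linarith [ζ.xiD_qStar_le hβ, xiD_one_le hβ]

theorem incVar_nonneg (hβ : ∀ p : ℕ, 2 ≤ p → |β p| ≤ 1 / (p : ℝ) ^ 2) {p : ℕ} (hp : p ≤ ζ.r) :
    0 ≤ ζ.incVar β p := by
  cases p with
  | zero => exact xiD_nonneg ζ.q_nonneg
  | succ p => exact sub_nonneg.2 (xiD_mono hβ (ζ.q_nonneg' (by omega)) (ζ.q_mono (by omega) hp)
      (ζ.q_le_one' hp))

theorem sum_incVar (N : ℕ) : ∑ p ∈ Finset.range (N + 1), ζ.incVar β p = xiD β (ζ.q N) := by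
  induction N with
  | zero => simp [incVar]
  | succ N ih => rw [Finset.sum_range_succ, ih, incVar]; ring

end FiniteRSB


/-! Moments of Gaussian densities restricted to a set, and their Gibbs averages. -/

section Elementary

/-- Convexity: the power lies above its tangent at y. Averaging with y equal to the mean gives
Jensen's inequality, both for spin integrals and for weighted series. -/
theorem tangent_le_pow {u y : ℝ} (hu : 0 ≤ u) (hy : 0 ≤ y) (N : ℕ) :
    y ^ (N + 1) + (N + 1) * y ^ N * (u - y) ≤ u ^ (N + 1) := by
  induction N with
  | zero => simp
  | succ N ih =>
    have h := mul_le_mul_of_nonneg_left ih hu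
    have h2 : 0 ≤ (N + 1) * y ^ N * (u - y) ^ 2 := by positivity
    calc _ = u * (y ^ (N + 1) + (N + 1) * y ^ N * (u - y)) - (N + 1) * y ^ N * (u - y) ^ 2 := by
          push_cast; ring
      _ ≤ u * u ^ (N + 1) := by linarith
      _ = u ^ (N + 1 + 1) := by ring

/-- Factors are exchanged one at a time. The weights h keep the growth in the field apart from the
constants. -/
theorem abs_prod_sub_prod_le {ι : Type*} (s : Finset ι) {a b h : ι → ℝ} {K δ : ℝ} (hK : 1 ≤ K)
    (hδ : 0 ≤ δ) (hh : ∀ i, 0 ≤ h i) (ha : ∀ i, |a i| ≤ K * h i) (hb : ∀ i, |b i| ≤ K * h i)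
    (hab : ∀ i, |a i - b i| ≤ δ * h i) :
    |∏ i ∈ s, a i - ∏ i ∈ s, b i| ≤ s.card * δ * K ^ s.card * ∏ i ∈ s, h i := by
  classical
  induction s using Finset.induction_on with
  | empty => simp
  | insert j s hj ih =>
    have hP : |∏ i ∈ s, a i| ≤ K ^ s.card * ∏ i ∈ s, h i := by
      rw [Finset.abs_prod, ← Finset.prod_const, ← Finset.prod_mul_distrib]
      exact Finset.prod_le_prod (fun _ _ => abs_nonneg _) fun i _ => ha i
    have hp : 0 ≤ ∏ i ∈ s, h i := Finset.prod_nonneg fun i _ => hh i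
    rw [Finset.prod_insert hj, Finset.prod_insert hj, Finset.prod_insert hj,
      Finset.card_insert_of_notMem hj]
    have e : a j * ∏ i ∈ s, a i - b j * ∏ i ∈ s, b i =
        (a j - b j) * ∏ i ∈ s, a i + b j * (∏ i ∈ s, a i - ∏ i ∈ s, b i) := by ring
    have hKp : (0 : ℝ) ≤ K ^ s.card := by positivity
    calc _ ≤ |a j - b j| * |∏ i ∈ s, a i| + |b j| * |∏ i ∈ s, a i - ∏ i ∈ s, b i| := by
          rw [e, ← abs_mul, ← abs_mul]; exact abs_add_le _ _
      _ ≤ δ * h j * (K ^ s.card * ∏ i ∈ s, h i) +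
          K * h j * (s.card * δ * K ^ s.card * ∏ i ∈ s, h i) := by
          gcongr
          · exact mul_nonneg hδ (hh j)
          · exact hab j
          · exact mul_nonneg (by linarith) (hh j)
          · exact hb j
      _ = δ * K ^ s.card * (1 + K * s.card) * (h j * ∏ i ∈ s, h i) := by ring
      _ ≤ δ * K ^ s.card * (K * (s.card + 1)) * (h j * ∏ i ∈ s, h i) := by
          have := mul_nonneg (hh j) hp
          gcongr
          linarith
      _ = _ := by push_cast; ring

end Elementary

section Moments

/-- `∫_I s^d exp(-a s²/2 + xs) ds`. -/
def momentOn (a : ℝ) (I : Set ℝ) (d : ℕ) (x : ℝ) : ℝ :=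
  ∫ s in I, s ^ d * Real.exp (-(1 / 2) * a * s ^ 2 + x * s)

/-- `∫_I |s|^d exp(-a s²/2 + xs) ds`. -/
def absMomentOn (a : ℝ) (I : Set ℝ) (d : ℕ) (x : ℝ) : ℝ :=
  ∫ s in I, |s| ^ d * Real.exp (-(1 / 2) * a * s ^ 2 + x * s)

/-- `∫_I |s|^d exp(-s²/4) ds`. -/
def quarterMoment (I : Set ℝ) (d : ℕ) : ℝ :=
  ∫ s in I, |s| ^ d * Real.exp (-(1 / 4) * s ^ 2)

theorem integrable_quarter (d : ℕ) :
    Integrable fun s : ℝ => |s| ^ d * Real.exp (-(1 / 4) * s ^ 2) := by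
  have h := (integrable_rpow_mul_exp_neg_mul_sq (b := 1 / 4) (by norm_num) (s := d)
    (by linarith [(Nat.cast_nonneg d : (0 : ℝ) ≤ d)])).norm
  refine h.congr (ae_of_all _ fun s => ?_)
  simp [Real.rpow_natCast]

theorem quarterMoment_nonneg (I : Set ℝ) (d : ℕ) : 0 ≤ quarterMoment I d :=
  integral_nonneg fun s => by positivity

variable {a : ℝ}

/-- For a ≥ 1 the exponent is at most xs - s²/2 = x² - s²/4 - (x - s/2)². This separates the field
from the spin, so that all constants are moments of exp(-s²/4). -/
theorem exp_le_quarter (ha : 1 ≤ a) (x s : ℝ) : Real.exp (-(1 / 2) * a * s ^ 2 + x * s) ≤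
    Real.exp (x ^ 2) * Real.exp (-(1 / 4) * s ^ 2) := by
  rw [← Real.exp_add, Real.exp_le_exp]
  nlinarith [sq_nonneg (x - s / 2), mul_nonneg (sub_nonneg.2 ha) (sq_nonneg s)]

theorem integrable_absMoment (ha : 1 ≤ a) (d : ℕ) (x : ℝ) :
    Integrable fun s : ℝ => |s| ^ d * Real.exp (-(1 / 2) * a * s ^ 2 + x * s) := by
  refine ((integrable_quarter d).const_mul (Real.exp (x ^ 2))).mono'
    (Continuous.aestronglyMeasurable (by fun_prop)) (ae_of_all _ fun s => ?_)
  rw [Real.norm_of_nonneg (by positivity)]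
  calc _ ≤ |s| ^ d * (Real.exp (x ^ 2) * Real.exp (-(1 / 4) * s ^ 2)) := by
        gcongr; exact exp_le_quarter ha x s
    _ = _ := by ring

theorem integrable_moment (ha : 1 ≤ a) (d : ℕ) (x : ℝ) :
    Integrable fun s : ℝ => s ^ d * Real.exp (-(1 / 2) * a * s ^ 2 + x * s) := by
  refine (integrable_absMoment ha d x).mono'
    (Continuous.aestronglyMeasurable (by fun_prop)) (ae_of_all _ fun s => ?_)
  simp

theorem abs_momentOn_le (I : Set ℝ) (d : ℕ) (x : ℝ) :
    |momentOn a I d x| ≤ absMomentOn a I d x := by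
  rw [← Real.norm_eq_abs]
  refine (norm_integral_le_integral_norm _).trans_eq (integral_congr_ae (ae_of_all _ fun s => ?_))
  simp

theorem absMomentOn_nonneg (I : Set ℝ) (d : ℕ) (x : ℝ) : 0 ≤ absMomentOn a I d x :=
  integral_nonneg fun s => by positivity

theorem absMomentOn_le_quarter (ha : 1 ≤ a) (I : Set ℝ) (d : ℕ) (x : ℝ) :
    absMomentOn a I d x ≤ quarterMoment I d * Real.exp (x ^ 2) := by
  rw [absMomentOn, quarterMoment, mul_comm _ (Real.exp (x ^ 2)), ← integral_const_mul]
  refine integral_mono (integrable_absMoment ha d x).integrableOn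
    ((integrable_quarter d).const_mul _).integrableOn fun s => ?_
  calc _ ≤ |s| ^ d * (Real.exp (x ^ 2) * Real.exp (-(1 / 4) * s ^ 2)) := by
        gcongr; exact exp_le_quarter ha x s
    _ = _ := by ring

theorem quarterMoment_mono (I : Set ℝ) (d : ℕ) : quarterMoment I d ≤ quarterMoment Set.univ d :=
  setIntegral_mono_set (integrable_quarter d).integrableOn (ae_of_all _ fun s => by positivity)
    (Set.subset_univ I).eventuallyLE

theorem absMomentOn_le (ha : 1 ≤ a) (I : Set ℝ) (d : ℕ) (x : ℝ) :
    absMomentOn a I d x ≤ quarterMoment Set.univ d * Real.exp (x ^ 2) :=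
  (absMomentOn_le_quarter ha I d x).trans
    (mul_le_mul_of_nonneg_right (quarterMoment_mono I d) (Real.exp_pos _).le)

theorem abs_momentOn_sub_le (ha : 1 ≤ a) {I : Set ℝ} (hI : MeasurableSet I) (d : ℕ) (x : ℝ) :
    |momentOn a I d x - momentOn a Set.univ d x| ≤ quarterMoment Iᶜ d * Real.exp (x ^ 2) := by
  have h : momentOn a I d x - momentOn a Set.univ d x = -momentOn a Iᶜ d x := by
    have := integral_add_compl hI (integrable_moment ha d x)
    simp only [momentOn, Measure.restrict_univ]
    linarith
  rw [h, abs_neg]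
  exact (abs_momentOn_le _ d x).trans (absMomentOn_le_quarter ha _ d x)

theorem momentOn_zero_eq (I : Set ℝ) (x : ℝ) : momentOn a I 0 x = absMomentOn a I 0 x := by
  simp [momentOn, absMomentOn]

/-- On the symmetric interval e^{xs} ≥ 1 + xs and the odd part integrates to zero, so the bound does
not depend on x. The condition a ≤ 2 gives exp(-as²/2) ≥ exp(-C²) there. -/
theorem momentOn_zero_ge (ha : 1 ≤ a) (ha2 : a ≤ 2) {C : ℝ} (hC : 0 < C) {I : Set ℝ}
    (hI : Set.Ioc (-C) C ⊆ I) (x : ℝ) : 2 * C * Real.exp (-C ^ 2) ≤ momentOn a I 0 x := by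
  have hint : IntegrableOn (fun s : ℝ => Real.exp (-C ^ 2) * (1 + x * s)) (Set.Ioc (-C) C) :=
    (Continuous.integrableOn_Icc (by fun_prop)).mono_set Set.Ioc_subset_Icc_self
  have hval : ∫ s in Set.Ioc (-C) C, Real.exp (-C ^ 2) * (1 + x * s) =
      2 * C * Real.exp (-C ^ 2) := by
    rw [← intervalIntegral.integral_of_le (by linarith), intervalIntegral.integral_const_mul,
      intervalIntegral.integral_add (by simp) (Continuous.intervalIntegrable (by fun_prop) _ _),
      intervalIntegral.integral_const_mul, integral_id]
    simp
    ring
  have hm := integrable_moment ha 0 x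
  rw [← hval]
  calc _ ≤ ∫ s in Set.Ioc (-C) C, s ^ 0 * Real.exp (-(1 / 2) * a * s ^ 2 + x * s) := by
        refine setIntegral_mono_on hint hm.integrableOn measurableSet_Ioc fun s hs => ?_
        rw [pow_zero, one_mul, Real.exp_add]
        have h1 : s ^ 2 ≤ C ^ 2 := sq_le_sq' hs.1.le hs.2
        have h2 : Real.exp (-C ^ 2) ≤ Real.exp (-(1 / 2) * a * s ^ 2) := by
          rw [Real.exp_le_exp]
          nlinarith [sq_nonneg s]
        calc _ ≤ Real.exp (-C ^ 2) * Real.exp (x * s) := by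
              gcongr; linarith [Real.add_one_le_exp (x * s)]
          _ ≤ _ := by gcongr
    _ ≤ _ := setIntegral_mono_set hm.integrableOn
        (ae_of_all _ fun s => by positivity) hI.eventuallyLE

/-- Power mean inequality for the moments. -/
theorem absMomentOn_pow_le (ha : 1 ≤ a) (I : Set ℝ) (d N : ℕ) (x : ℝ)
    (h0 : 0 < momentOn a I 0 x) : absMomentOn a I d x ^ (N + 1) ≤
      absMomentOn a I (d * (N + 1)) x * momentOn a I 0 x ^ N := by
  set A := absMomentOn a I d x with hA
  set m := momentOn a I 0 x with hm
  set y := A / m with hy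
  have hA0 : 0 ≤ A := absMomentOn_nonneg I d x
  have hy0 : 0 ≤ y := div_nonneg hA0 h0.le
  have hi := fun d => (integrable_absMoment ha d x).integrableOn (s := I)
  -- The tangent inequality at the mean y = A / m, with u = |s|^d, integrated against the
  -- unnormalised weight.
  have hle : ∫ s in I, ((y ^ (N + 1) - (N + 1) * y ^ N * y) *
      (|s| ^ 0 * Real.exp (-(1 / 2) * a * s ^ 2 + x * s)) +
      (N + 1) * y ^ N * (|s| ^ d * Real.exp (-(1 / 2) * a * s ^ 2 + x * s))) ≤
      absMomentOn a I (d * (N + 1)) x := by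
    refine integral_mono (((hi 0).const_mul _).add ((hi d).const_mul _)) (hi _) fun s => ?_
    have h := tangent_le_pow (pow_nonneg (abs_nonneg s) d) hy0 N
    have he := Real.exp_pos (-(1 / 2) * a * s ^ 2 + x * s)
    rw [← pow_mul] at h
    have h' := mul_le_mul_of_nonneg_right h he.le
    dsimp only
    linarith
  rw [integral_add ((hi 0).const_mul _) ((hi d).const_mul _), integral_const_mul,
    integral_const_mul] at hle
  have h1 : ∫ s in I, |s| ^ 0 * Real.exp (-(1 / 2) * a * s ^ 2 + x * s) = m := by
    rw [hm, momentOn_zero_eq]; rfl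
  have h2 : ∫ s in I, |s| ^ d * Real.exp (-(1 / 2) * a * s ^ 2 + x * s) = A := rfl
  rw [h1, h2] at hle
  have h3 : A = y * m := by rw [hy]; field_simp
  have h4 : y ^ (N + 1) * m ≤ absMomentOn a I (d * (N + 1)) x := by
    have : (y ^ (N + 1) - (N + 1) * y ^ N * y) * m + (N + 1) * y ^ N * A = y ^ (N + 1) * m := by
      rw [h3]; ring
    linarith
  calc A ^ (N + 1) = y ^ (N + 1) * m * m ^ N := by rw [h3]; ring
    _ ≤ _ := by gcongr

theorem tendsto_quarterMoment_compl (d : ℕ) :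
    Tendsto (fun C : ℝ => quarterMoment (Set.Ioc (-C) C)ᶜ d) atTop (𝓝 0) := by
  have h := intervalIntegral_tendsto_integral (integrable_quarter d) tendsto_neg_atTop_atBot
    tendsto_id
  have h2 : Tendsto (fun C : ℝ => quarterMoment Set.univ d -
      ∫ s in (-C)..C, |s| ^ d * Real.exp (-(1 / 4) * s ^ 2)) atTop (𝓝 0) := by
    have := h.const_sub (quarterMoment Set.univ d)
    simpa [quarterMoment] using this
  refine h2.congr' ?_
  filter_upwards [eventually_ge_atTop 0] with C hC
  have := integral_add_compl (measurableSet_Ioc (a := -C) (b := C)) (integrable_quarter d)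
  rw [intervalIntegral.integral_of_le (by linarith)]
  simp only [quarterMoment, Measure.restrict_univ]
  linarith

end Moments


/-! ### Gibbs averages over a weighted index set -/

section Gibbs

variable {α : Type*} {w : α → ℝ}

/-- Jensen's inequality for A/Z under the probability weights proportional to wZ; the hypothesis on
A, B, Z is the same inequality one level below, for the spin integrals. -/
theorem tsum_div_tsum_pow_le (hw : ∀ j, 0 ≤ w j) {A B Z : α → ℝ} (hA : ∀ j, 0 ≤ A j)
    (hZ : ∀ j, 0 < Z j) (N : ℕ) (hAB : ∀ j, A j ^ (N + 1) ≤ B j * Z j ^ N)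
    (hsA : Summable fun j => w j * A j) (hsB : Summable fun j => w j * B j)
    (hsZ : Summable fun j => w j * Z j) (hpos : 0 < ∑' j, w j * Z j) :
    ((∑' j, w j * A j) / ∑' j, w j * Z j) ^ (N + 1) ≤ (∑' j, w j * B j) / ∑' j, w j * Z j := by
  set D := ∑' j, w j * Z j with hD
  set y := (∑' j, w j * A j) / D with hy
  have hy0 : 0 ≤ y := div_nonneg (tsum_nonneg fun j => mul_nonneg (hw j) (hA j)) hpos.le
  have hyD : (∑' j, w j * A j) = y * D := by rw [hy]; field_simp
  have hpt : ∀ j, (y ^ (N + 1) - (N + 1) * y ^ N * y) * (w j * Z j) +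
      (N + 1) * y ^ N * (w j * A j) ≤ w j * B j := fun j => by
    have h := tangent_le_pow (div_nonneg (hA j) (hZ j).le) hy0 N
    have h2 : Z j * (A j / Z j) ^ (N + 1) ≤ B j := by
      have hz := hZ j
      rw [div_pow, pow_succ (Z j), ← mul_div_assoc, mul_comm (Z j) (A j ^ _),
        mul_div_mul_right _ _ hz.ne']
      rw [div_le_iff₀ (by positivity)]
      exact hAB j
    have h3 := mul_le_mul_of_nonneg_left ((mul_le_mul_of_nonneg_left h (hZ j).le).trans h2) (hw j)
    have h4 : Z j * (A j / Z j) = A j := mul_div_cancel₀ _ (hZ j).ne'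
    calc _ = w j * (Z j * y ^ (N + 1) + (N + 1) * y ^ N * (Z j * (A j / Z j) - Z j * y)) := by
          rw [h4]; ring
      _ ≤ w j * B j := by linarith
  have hsum := Summable.tsum_le_tsum hpt ((hsZ.mul_left _).add (hsA.mul_left _)) hsB
  rw [Summable.tsum_add (hsZ.mul_left _) (hsA.mul_left _), tsum_mul_left, tsum_mul_left, hyD,
    ← hD] at hsum
  rw [le_div_iff₀ hpos]
  linarith

variable {n : ℕ} (w) (x : Fin n → α → ℝ)

/-- `∑_α w_α ∏_i ∫_I s^{d_i} exp(-a s²/2 + x_{i,α} s) ds`. -/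
def gibbsSum (a : ℝ) (I : Set ℝ) (d : Fin n → ℕ) : ℝ :=
  ∑' j, w j * ∏ i, momentOn a I (d i) (x i j)

/-- `∑_α w_α ∏_i exp(x_{i,α}²)`. -/
def squareSum : ℝ := ∑' j, w j * ∏ i, Real.exp (x i j ^ 2)

variable {w x} {a : ℝ}

theorem summable_of_abs_le_mul (hw : ∀ j, 0 ≤ w j)
    (hH : Summable fun j => w j * ∏ i, Real.exp (x i j ^ 2)) {f : α → ℝ} {K : ℝ}
    (hf : ∀ j, |f j| ≤ K * ∏ i, Real.exp (x i j ^ 2)) : Summable fun j => w j * f j := by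
  refine Summable.of_norm_bounded (hH.mul_left K) fun j => ?_
  rw [norm_mul, Real.norm_of_nonneg (hw j), Real.norm_eq_abs]
  calc w j * |f j| ≤ w j * (K * ∏ i, Real.exp (x i j ^ 2)) :=
        mul_le_mul_of_nonneg_left (hf j) (hw j)
    _ = _ := by ring

theorem abs_tsum_le_mul (hw : ∀ j, 0 ≤ w j)
    (hH : Summable fun j => w j * ∏ i, Real.exp (x i j ^ 2)) {f : α → ℝ} {K : ℝ}
    (hf : ∀ j, |f j| ≤ K * ∏ i, Real.exp (x i j ^ 2)) :
    |∑' j, w j * f j| ≤ K * squareSum w x := by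
  rw [squareSum, ← tsum_mul_left, ← Real.norm_eq_abs]
  refine tsum_of_norm_bounded (hH.mul_left K).hasSum fun j => ?_
  rw [norm_mul, Real.norm_of_nonneg (hw j), Real.norm_eq_abs]
  calc w j * |f j| ≤ w j * (K * ∏ i, Real.exp (x i j ^ 2)) :=
        mul_le_mul_of_nonneg_left (hf j) (hw j)
    _ = _ := by ring

theorem one_le_squareSum (hw : ∀ j, 0 ≤ w j) (hw1 : HasSum w 1)
    (hH : Summable fun j => w j * ∏ i, Real.exp (x i j ^ 2)) : 1 ≤ squareSum w x := by
  rw [← hw1.tsum_eq]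
  refine Summable.tsum_le_tsum (fun j => le_mul_of_one_le_right (hw j) ?_) hw1.summable hH
  exact Finset.one_le_prod fun i _ => Real.one_le_exp (sq_nonneg _)

theorem prod_absMomentOn_le (ha : 1 ≤ a) {K : ℝ} {d : Fin n → ℕ}
    (hK : ∀ i, quarterMoment Set.univ (d i) ≤ K) (I : Set ℝ) (j : α) :
    ∏ i, absMomentOn a I (d i) (x i j) ≤ K ^ n * ∏ i, Real.exp (x i j ^ 2) := by
  have : K ^ n = ∏ _i : Fin n, K := by simp
  rw [this, ← Finset.prod_mul_distrib]
  exact Finset.prod_le_prod (fun i _ => absMomentOn_nonneg _ _ _) fun i _ =>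
    (absMomentOn_le ha I _ _).trans (mul_le_mul_of_nonneg_right (hK i) (Real.exp_pos _).le)

theorem abs_prod_momentOn_le (I : Set ℝ) (d : Fin n → ℕ) (j : α) :
    |∏ i, momentOn a I (d i) (x i j)| ≤ ∏ i, absMomentOn a I (d i) (x i j) := by
  rw [Finset.abs_prod]
  exact Finset.prod_le_prod (fun i _ => abs_nonneg _) fun i _ => abs_momentOn_le I _ _

theorem summable_gibbs (hw : ∀ j, 0 ≤ w j)
    (hH : Summable fun j => w j * ∏ i, Real.exp (x i j ^ 2)) (ha : 1 ≤ a) (I : Set ℝ)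
    (d : Fin n → ℕ) : Summable fun j => w j * ∏ i, momentOn a I (d i) (x i j) := by
  refine summable_of_abs_le_mul hw hH (K := (∑ i, quarterMoment Set.univ (d i)) ^ n) fun j =>
    (abs_prod_momentOn_le I d j).trans (prod_absMomentOn_le ha (fun i => ?_) I j)
  exact Finset.single_le_sum (f := fun i => quarterMoment Set.univ (d i))
    (fun i _ => quarterMoment_nonneg _ _) (Finset.mem_univ i)

theorem le_gibbsSum_zero (hw : ∀ j, 0 ≤ w j) (hw1 : HasSum w 1)
    (hH : Summable fun j => w j * ∏ i, Real.exp (x i j ^ 2)) (ha : 1 ≤ a) {I : Set ℝ} {c : ℝ}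
    (hc : 0 < c) (hcI : ∀ y, c ≤ momentOn a I 0 y) : c ^ n ≤ gibbsSum w x a I 0 := by
  have h : ∑' j, w j * c ^ n = c ^ n := by rw [tsum_mul_right, hw1.tsum_eq, one_mul]
  rw [← h]
  refine Summable.tsum_le_tsum (fun j => mul_le_mul_of_nonneg_left ?_ (hw j))
    (hw1.summable.mul_right _) (summable_gibbs hw hH ha I 0)
  have : c ^ n = ∏ _i : Fin n, c := by simp
  rw [this]
  exact Finset.prod_le_prod (fun i _ => hc.le) fun i _ => hcI _

/-- Two applications of Jensen move the power onto the spin moments, after which only one numerator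
and one denominator remain. The bound is thus linear in `squareSum` whatever N is, so its first
moment controls all moments of the ratio. -/
theorem abs_gibbs_pow_le (hw : ∀ j, 0 ≤ w j) (hw1 : HasSum w 1)
    (hH : Summable fun j => w j * ∏ i, Real.exp (x i j ^ 2)) (ha : 1 ≤ a) {I : Set ℝ} {c : ℝ}
    (hc : 0 < c) (hcI : ∀ y, c ≤ momentOn a I 0 y) {d : Fin n → ℕ} {N : ℕ} {K : ℝ}
    (hK : ∀ i, quarterMoment Set.univ (d i * (N + 1)) ≤ K) (hK0 : 0 ≤ K) :
    |gibbsSum w x a I d / gibbsSum w x a I 0| ^ (N + 1) ≤ (K / c) ^ n * squareSum w x := by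
  have hD := le_gibbsSum_zero hw hw1 hH ha hc hcI
  have hDpos : 0 < gibbsSum w x a I 0 := (pow_pos hc n).trans_le hD
  have hS : ∀ d : Fin n → ℕ, Summable fun j => w j * ∏ i, absMomentOn a I (d i) (x i j) := fun d =>
    summable_of_abs_le_mul hw hH (K := (∑ i, quarterMoment Set.univ (d i)) ^ n) fun j => by
      rw [abs_of_nonneg (Finset.prod_nonneg fun i _ => absMomentOn_nonneg _ _ _)]
      exact prod_absMomentOn_le ha (fun i => Finset.single_le_sum
        (f := fun i => quarterMoment Set.univ (d i))
        (fun i _ => quarterMoment_nonneg _ _) (Finset.mem_univ i)) I j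
  have hnum : |gibbsSum w x a I d| ≤ ∑' j, w j * ∏ i, absMomentOn a I (d i) (x i j) := by
    rw [← Real.norm_eq_abs]
    refine tsum_of_norm_bounded (hS d).hasSum fun j => ?_
    rw [norm_mul, Real.norm_of_nonneg (hw j), Real.norm_eq_abs]
    exact mul_le_mul_of_nonneg_left (abs_prod_momentOn_le I d j) (hw j)
  have hJ := tsum_div_tsum_pow_le hw (A := fun j => ∏ i, absMomentOn a I (d i) (x i j))
    (B := fun j => ∏ i, absMomentOn a I (d i * (N + 1)) (x i j))
    (Z := fun j => ∏ i, momentOn a I 0 (x i j))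
    (fun j => Finset.prod_nonneg fun i _ => absMomentOn_nonneg _ _ _)
    (fun j => Finset.prod_pos fun i _ => hc.trans_le (hcI _)) N
    (fun j => by
      rw [← Finset.prod_pow, ← Finset.prod_pow, ← Finset.prod_mul_distrib]
      exact Finset.prod_le_prod (fun i _ => pow_nonneg (absMomentOn_nonneg _ _ _) _) fun i _ =>
        absMomentOn_pow_le ha I _ N _ (hc.trans_le (hcI _)))
    (hS d) (hS fun i => d i * (N + 1)) (summable_gibbs hw hH ha I 0) hDpos
  rw [abs_div, abs_of_pos hDpos]
  have hB : ∑' j, w j * ∏ i, absMomentOn a I (d i * (N + 1)) (x i j) ≤ K ^ n * squareSum w x :=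
    (le_abs_self _).trans (abs_tsum_le_mul hw hH fun j => by
      rw [abs_of_nonneg (Finset.prod_nonneg fun i _ => absMomentOn_nonneg _ _ _)]
      exact prod_absMomentOn_le ha hK I j)
  have hsq : 0 ≤ squareSum w x := zero_le_one.trans (one_le_squareSum hw hw1 hH)
  calc _ ≤ ((∑' j, w j * ∏ i, absMomentOn a I (d i) (x i j)) / gibbsSum w x a I 0) ^ (N + 1) := by
        gcongr
    _ ≤ (∑' j, w j * ∏ i, absMomentOn a I (d i * (N + 1)) (x i j)) / gibbsSum w x a I 0 := hJ
    _ ≤ K ^ n * squareSum w x / c ^ n := by gcongr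
    _ = _ := by rw [div_pow]; ring

theorem abs_gibbsSum_sub_le (hw : ∀ j, 0 ≤ w j)
    (hH : Summable fun j => w j * ∏ i, Real.exp (x i j ^ 2)) (ha : 1 ≤ a) {I : Set ℝ}
    (hI : MeasurableSet I) {d : Fin n → ℕ} {K δ : ℝ} (hK1 : 1 ≤ K) (hδ : 0 ≤ δ)
    (hK : ∀ i, quarterMoment Set.univ (d i) ≤ K) (hdelta : ∀ i, quarterMoment Iᶜ (d i) ≤ δ) :
    |gibbsSum w x a I d - gibbsSum w x a Set.univ d| ≤ n * δ * K ^ n * squareSum w x := by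
  rw [gibbsSum, gibbsSum, ← Summable.tsum_sub (summable_gibbs hw hH ha I d)
    (summable_gibbs hw hH ha Set.univ d)]
  simp_rw [← mul_sub]
  refine abs_tsum_le_mul hw hH fun j => ?_
  have hle : ∀ I i, |momentOn a I (d i) (x i j)| ≤ K * Real.exp (x i j ^ 2) := fun I i =>
    ((abs_momentOn_le I _ _).trans (absMomentOn_le ha I _ _)).trans
      (mul_le_mul_of_nonneg_right (hK i) (Real.exp_pos _).le)
  simpa using abs_prod_sub_prod_le Finset.univ hK1 hδ (fun i => (Real.exp_pos (x i j ^ 2)).le)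
    (hle I) (hle Set.univ) fun i => (abs_momentOn_sub_le ha hI _ _).trans
      (mul_le_mul_of_nonneg_right (hdelta i) (Real.exp_pos _).le)

/-- N'/D' - N/D = ((N' - N) - (N/D)(D' - D))/D', so the unperturbed ratio occurs only as a factor
whose powers are already controlled. -/
theorem abs_div_sub_div_le {N N' D D' c Δ : ℝ} (hc : 0 < c) (hD : 0 < D) (hD' : c ≤ D')
    (hN : |N' - N| ≤ Δ) (hDD : |D' - D| ≤ Δ) : |N' / D' - N / D| ≤ Δ / c * (1 + |N / D|) := by
  have hD'0 : 0 < D' := hc.trans_le hD'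
  have h : N' / D' - N / D = ((N' - N) - N / D * (D' - D)) / D' := by field_simp; ring
  have hΔ : 0 ≤ Δ := (abs_nonneg _).trans hN
  rw [h, abs_div, abs_of_pos hD'0]
  calc _ ≤ (|N' - N| + |N / D| * |D' - D|) / D' := by
        gcongr
        exact (abs_sub _ _).trans_eq (by rw [abs_mul])
    _ ≤ (Δ + |N / D| * Δ) / c := by gcongr
    _ = _ := by ring

theorem prod_abs_le_of_pow_le {k : ℕ} {R : Fin k → ℝ} {L : ℝ} (hL : 1 ≤ L)
    (hR : ∀ l, |R l| ^ (2 * k + 1 + 1) ≤ L) : |∏ l, R l| ≤ L := by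
  obtain ⟨Y, hY1, hYL⟩ : ∃ Y : ℝ, 1 ≤ Y ∧ Y ^ (2 * k + 1 + 1) = L :=
    ⟨L ^ (((2 * k + 1 + 1 : ℕ) : ℝ)⁻¹), Real.one_le_rpow hL (by positivity),
      Real.rpow_inv_natCast_pow (by linarith) (by omega)⟩
  have hRY : ∀ l, |R l| ≤ Y := fun l =>
    le_of_pow_le_pow_left₀ (by omega) (by linarith) ((hR l).trans_eq hYL.symm)
  rw [Finset.abs_prod, ← hYL]
  calc ∏ l, |R l| ≤ ∏ _l : Fin k, Y :=
        Finset.prod_le_prod (fun _ _ => abs_nonneg _) fun l _ => hRY l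
    _ = Y ^ k := by simp
    _ ≤ _ := pow_le_pow_right₀ hY1 (by omega)

/-- The fine bound on a difference carries an extra H, which is not integrable against the other
factors. Interpolating with the crude bound 2Y lowers δH to √(δH), and the power 2k+2 is chosen so
that the product is again linear in H. -/
theorem abs_prod_sub_le_of_pow_le {k : ℕ} {R R' : Fin k → ℝ} {H L δ : ℝ} (hH : 1 ≤ H)
    (hL : 1 ≤ L) (hδ : 0 ≤ δ) (hR : ∀ l, |R l| ^ (2 * k + 1 + 1) ≤ L * H)
    (hR' : ∀ l, |R' l| ^ (2 * k + 1 + 1) ≤ L * H)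
    (hd : ∀ l, |R' l - R l| ≤ δ * H * (1 + |R l|)) :
    |∏ l, R' l - ∏ l, R l| ≤ 2 * k * √δ * (L * H) := by
  have hLH : 1 ≤ L * H := one_le_mul_of_one_le_of_one_le hL hH
  obtain ⟨Y, hY1, hYL⟩ : ∃ Y : ℝ, 1 ≤ Y ∧ Y ^ (2 * k + 1 + 1) = L * H :=
    ⟨(L * H) ^ (((2 * k + 1 + 1 : ℕ) : ℝ)⁻¹), Real.one_le_rpow hLH (by positivity),
      Real.rpow_inv_natCast_pow (by linarith) (by omega)⟩
  have hY : ∀ {R : Fin k → ℝ}, (∀ l, |R l| ^ (2 * k + 1 + 1) ≤ L * H) → ∀ l, |R l| ≤ Y * 1 :=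
    fun h l => by
      rw [mul_one]
      exact le_of_pow_le_pow_left₀ (by omega) (by linarith) ((h l).trans_eq hYL.symm)
  have hsH : √H ≤ Y ^ (k + 1) := by
    refine Real.sqrt_le_iff.2 ⟨by positivity, ?_⟩
    rw [← pow_mul, show (k + 1) * 2 = 2 * k + 1 + 1 by ring, hYL]
    exact le_mul_of_one_le_left (by linarith) hL
  -- One Y comes from the ratios and Y^{k+1} from √H; multiplied by the Y^k of the telescoping
  -- bound, this is Y^{2k+2} = LH.
  have hdiff : ∀ l, |R' l - R l| ≤ 2 * √δ * Y ^ (k + 2) * 1 := fun l => by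
    have h1 := hY hR l
    have h2 := hY hR' l
    have hmin : |R' l - R l| ≤ 2 * Y * √(δ * H) := by
      rcases le_total 1 (δ * H) with h | h
      · calc |R' l - R l| ≤ |R' l| + |R l| := abs_sub _ _
          _ ≤ 2 * Y * 1 := by linarith
          _ ≤ _ := by gcongr; exact Real.one_le_sqrt.2 h
      · have h0 : 0 ≤ δ * H := by positivity
        calc |R' l - R l| ≤ δ * H * (1 + |R l|) := hd l
          _ ≤ √(δ * H) * (2 * Y) := by
            gcongr
            · exact Real.le_sqrt_of_sq_le (by nlinarith)
            · linarith
          _ = _ := by ring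
    rw [Real.sqrt_mul hδ] at hmin
    calc _ ≤ 2 * Y * (√δ * √H) := hmin
      _ ≤ 2 * Y * (√δ * Y ^ (k + 1)) := by gcongr
      _ = _ := by ring
  have h := abs_prod_sub_prod_le Finset.univ hY1 (by positivity) (fun _ => zero_le_one)
    (hY hR') (hY hR) hdiff
  rw [← hYL]
  refine h.trans_eq ?_
  simp only [Finset.card_univ, Fintype.card_fin, Finset.prod_const_one]
  ring

end Gibbs

/-! ### Products of ratios for several replicas -/

section Replicas

variable {α : Type*} {w : α → ℝ} {k n : ℕ} {x : Fin n → α → ℝ} {a : ℝ}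

/-- A bound for all the Gaussian moments that enter the estimates. -/
def momentBound (e : Fin k → Fin n → ℕ) : ℝ :=
  1 + quarterMoment Set.univ 0 + ∑ l, ∑ i, (quarterMoment Set.univ (e l i) +
    quarterMoment Set.univ (e l i * (2 * k + 1 + 1)))

/-- A bound for the tails of the Gaussian moments that enter the estimates. -/
def tailBound (e : Fin k → Fin n → ℕ) (C : ℝ) : ℝ :=
  quarterMoment (Set.Ioc (-C) C)ᶜ 0 + ∑ l, ∑ i, quarterMoment (Set.Ioc (-C) C)ᶜ (e l i)

theorem le_sum_sum (f : Fin k → Fin n → ℝ) (hf : ∀ l i, 0 ≤ f l i) (l : Fin k)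
    (i : Fin n) : f l i ≤ ∑ l, ∑ i, f l i :=
  (Finset.single_le_sum (f := fun i => f l i) (fun i _ => hf l i) (Finset.mem_univ i)).trans
    (Finset.single_le_sum (f := fun l => ∑ i, f l i)
      (fun l _ => Finset.sum_nonneg fun i _ => hf l i) (Finset.mem_univ l))

theorem sum_moment_nonneg (e : Fin k → Fin n → ℕ) : 0 ≤ ∑ l, ∑ i,
    (quarterMoment Set.univ (e l i) + quarterMoment Set.univ (e l i * (2 * k + 1 + 1))) :=
  Finset.sum_nonneg fun _ _ => Finset.sum_nonneg fun _ _ =>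
    add_nonneg (quarterMoment_nonneg _ _) (quarterMoment_nonneg _ _)

theorem one_le_momentBound (e : Fin k → Fin n → ℕ) : 1 ≤ momentBound e := by
  have := sum_moment_nonneg e
  have := quarterMoment_nonneg Set.univ 0
  rw [momentBound]
  linarith

theorem quarterMoment_zero_le_momentBound (e : Fin k → Fin n → ℕ) :
    quarterMoment Set.univ 0 ≤ momentBound e := by
  have := sum_moment_nonneg e
  rw [momentBound]
  linarith

theorem quarterMoment_le_momentBound (e : Fin k → Fin n → ℕ) (l : Fin k) (i : Fin n) :
    quarterMoment Set.univ (e l i) ≤ momentBound e ∧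
      quarterMoment Set.univ (e l i * (2 * k + 1 + 1)) ≤ momentBound e := by
  have h := le_sum_sum (fun l i => quarterMoment Set.univ (e l i) +
    quarterMoment Set.univ (e l i * (2 * k + 1 + 1))) (fun _ _ =>
    add_nonneg (quarterMoment_nonneg _ _) (quarterMoment_nonneg _ _)) l i
  have h0 := quarterMoment_nonneg Set.univ 0
  have h1 := quarterMoment_nonneg Set.univ (e l i)
  have h2 := quarterMoment_nonneg Set.univ (e l i * (2 * k + 1 + 1))
  rw [momentBound]
  exact ⟨by linarith, by linarith⟩

theorem tailBound_nonneg (e : Fin k → Fin n → ℕ) (C : ℝ) : 0 ≤ tailBound e C :=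
  add_nonneg (quarterMoment_nonneg _ _)
    (Finset.sum_nonneg fun _ _ => Finset.sum_nonneg fun _ _ => quarterMoment_nonneg _ _)

theorem quarterMoment_le_tailBound (e : Fin k → Fin n → ℕ) (C : ℝ) (l : Fin k) (i : Fin n) :
    quarterMoment (Set.Ioc (-C) C)ᶜ (e l i) ≤ tailBound e C := by
  have := le_sum_sum (fun l i => quarterMoment (Set.Ioc (-C) C)ᶜ (e l i))
    (fun _ _ => quarterMoment_nonneg _ _) l i
  have := quarterMoment_nonneg (Set.Ioc (-C) C)ᶜ 0
  rw [tailBound]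
  linarith

theorem quarterMoment_zero_le_tailBound (e : Fin k → Fin n → ℕ) (C : ℝ) :
    quarterMoment (Set.Ioc (-C) C)ᶜ 0 ≤ tailBound e C :=
  le_add_of_nonneg_right
    (Finset.sum_nonneg fun _ _ => Finset.sum_nonneg fun _ _ => quarterMoment_nonneg _ _)

theorem tendsto_tailBound (e : Fin k → Fin n → ℕ) : Tendsto (tailBound e) atTop (𝓝 0) := by
  have h := (tendsto_quarterMoment_compl 0).add (tendsto_finsetSum Finset.univ fun l _ =>
    tendsto_finsetSum Finset.univ fun i _ => tendsto_quarterMoment_compl (e l i))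
  simp only [Finset.sum_const_zero, add_zero] at h
  exact h

theorem abs_prod_gibbs_le (hw : ∀ j, 0 ≤ w j) (hw1 : HasSum w 1)
    (hH : Summable fun j => w j * ∏ i, Real.exp (x i j ^ 2)) (ha : 1 ≤ a) {I : Set ℝ} {c : ℝ}
    (hc : 0 < c) (hc1 : c ≤ 1) (hcI : ∀ y, c ≤ momentOn a I 0 y) (e : Fin k → Fin n → ℕ) :
    |∏ l, gibbsSum w x a I (e l) / gibbsSum w x a I 0| ≤
      (momentBound e / c) ^ n * squareSum w x := by
  have h1 := one_le_momentBound e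
  refine prod_abs_le_of_pow_le (one_le_mul_of_one_le_of_one_le
    (one_le_pow₀ ((one_le_div hc).2 (hc1.trans h1))) (one_le_squareSum hw hw1 hH)) fun l => ?_
  exact abs_gibbs_pow_le hw hw1 hH ha hc hcI
    (fun i => (quarterMoment_le_momentBound e l i).2) (by linarith)

theorem abs_prod_gibbs_sub_le (hw : ∀ j, 0 ≤ w j) (hw1 : HasSum w 1)
    (hH : Summable fun j => w j * ∏ i, Real.exp (x i j ^ 2)) (ha : 1 ≤ a) {c C : ℝ}
    (hc : 0 < c) (hc1 : c ≤ 1) (hcI : ∀ y, c ≤ momentOn a (Set.Ioc (-C) C) 0 y)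
    (hcu : ∀ y, c ≤ momentOn a Set.univ 0 y) (e : Fin k → Fin n → ℕ) :
    |∏ l, gibbsSum w x a (Set.Ioc (-C) C) (e l) / gibbsSum w x a (Set.Ioc (-C) C) 0 -
        ∏ l, gibbsSum w x a Set.univ (e l) / gibbsSum w x a Set.univ 0| ≤
      2 * k * √(n * tailBound e C * (momentBound e / c) ^ n) *
        ((momentBound e / c) ^ n * squareSum w x) := by
  have h1 := one_le_momentBound e
  have hδ := tailBound_nonneg e C
  have hL : 1 ≤ (momentBound e / c) ^ n := one_le_pow₀ ((one_le_div hc).2 (hc1.trans h1))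
  refine abs_prod_sub_le_of_pow_le (one_le_squareSum hw hw1 hH) hL (by positivity)
    (fun l => ?_) (fun l => ?_) fun l => ?_
  · exact abs_gibbs_pow_le hw hw1 hH ha hc hcu
      (fun i => (quarterMoment_le_momentBound e l i).2) (by linarith)
  · exact abs_gibbs_pow_le hw hw1 hH ha hc hcI
      (fun i => (quarterMoment_le_momentBound e l i).2) (by linarith)
  · refine (abs_div_sub_div_le (pow_pos hc n) ((pow_pos hc n).trans_le
      (le_gibbsSum_zero hw hw1 hH ha hc hcu)) (le_gibbsSum_zero hw hw1 hH ha hc hcI)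
      (abs_gibbsSum_sub_le hw hH ha measurableSet_Ioc h1 hδ
        (fun i => (quarterMoment_le_momentBound e l i).1)
        fun i => quarterMoment_le_tailBound e C l i)
      (abs_gibbsSum_sub_le hw hH ha measurableSet_Ioc h1 hδ
        (fun i => quarterMoment_zero_le_momentBound e)
        fun i => quarterMoment_zero_le_tailBound e C)).trans_eq ?_
    rw [div_pow]
    ring

end Replicas


/-! ### Gaussian integrals of exponentials of squares -/

section GaussianSquare

open scoped NNReal

theorem lintegral_exp_sq_gaussianReal {v : ℝ≥0} {A : ℝ} (h : 2 * A * v < 1) (s : ℝ) :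
    ∫⁻ z, ENNReal.ofReal (Real.exp (A * (s + z) ^ 2)) ∂(gaussianReal 0 v) =
      ENNReal.ofReal ((√(1 - 2 * A * v))⁻¹ * Real.exp (A / (1 - 2 * A * v) * s ^ 2)) := by
  rcases eq_or_ne v 0 with rfl | hv
  · simp [gaussianReal_zero_var, lintegral_dirac]
  have hv0 : (0 : ℝ) < v := by positivity
  set b : ℝ := (1 - 2 * A * v) / (2 * v) with hb
  have hq : 0 < 1 - 2 * A * v := by linarith
  have hb0 : 0 < b := by positivity
  rw [gaussianReal_of_var_ne_zero 0 hv, lintegral_withDensity_eq_lintegral_mul _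
    (measurable_gaussianPDF 0 v) (by fun_prop)]
  have hpt : ∀ z, (gaussianPDF 0 v * fun z => ENNReal.ofReal (Real.exp (A * (s + z) ^ 2))) z =
      ENNReal.ofReal ((√(2 * Real.pi * v))⁻¹ * Real.exp (A / (1 - 2 * A * v) * s ^ 2) *
        Real.exp (-b * (z - A * s / b) ^ 2)) := fun z => by
    rw [Pi.mul_apply, gaussianPDF, ← ENNReal.ofReal_mul (gaussianPDFReal_nonneg _ _ _),
      gaussianPDFReal, mul_assoc (√(2 * Real.pi * v))⁻¹, mul_assoc (√(2 * Real.pi * v))⁻¹,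
      ← Real.exp_add, ← Real.exp_add]
    congr 3
    have hz : -b * (z - A * s / b) ^ 2 = -b * z ^ 2 + 2 * A * s * z - A ^ 2 * s ^ 2 / b := by
      field_simp
      ring
    have hA : A / (1 - 2 * A * v) * s ^ 2 = A * s ^ 2 + A ^ 2 * s ^ 2 / b := by
      have hq' : 1 - 2 * A * v ≠ 0 := hq.ne'
      rw [hb, div_div_eq_mul_div, div_mul_eq_mul_div, eq_comm, eq_div_iff hq', add_mul,
        div_mul_cancel₀ _ hq']
      ring
    have hbv : -b = A - 1 / (2 * v) := by
      rw [hb]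
      field_simp
      ring
    rw [hz, hA, hbv]
    ring
  rw [lintegral_congr hpt, ← ofReal_integral_eq_lintegral_ofReal
    (((integrable_exp_neg_mul_sq hb0).comp_sub_right _).const_mul _)
    (ae_of_all _ fun z => by positivity), integral_const_mul,
    integral_sub_right_eq_self (fun z => Real.exp (-b * z ^ 2)), integral_gaussian]
  congr 1
  have : √(Real.pi / b) = √(2 * Real.pi * v) * (√(1 - 2 * A * v))⁻¹ := by
    rw [← Real.sqrt_inv, ← Real.sqrt_mul (by positivity), hb]
    congr 1
    field_simp
  rw [this]
  have h2 : √(2 * Real.pi * v) ≠ 0 := by positivity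
  field_simp

theorem lintegral_exp_mul_gaussianReal (v : ℝ≥0) (t : ℝ) :
    ∫⁻ z, ENNReal.ofReal (Real.exp (t * z)) ∂(gaussianReal 0 v) =
      ENNReal.ofReal (Real.exp (v * t ^ 2 / 2)) := by
  rw [← ofReal_integral_eq_lintegral_ofReal (integrable_exp_mul_gaussianReal t)
    (ae_of_all _ fun z => (Real.exp_pos _).le)]
  have := mgf_gaussianReal (p := gaussianReal 0 v) (X := id) Measure.map_id t
  rw [mgf] at this
  simp only [id, zero_mul, zero_add] at this
  rw [this]

/-- Linearisation: e^{z²} = E e^{zy} for y of variance 2. For fixed y the integrand factorises over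
the independent coordinates, which leaves an integral in y involving only the total variance. -/
theorem lintegral_exp_sq_sum {ι : Type*} (s : Finset ι) (c : ι → ℝ) :
    ∫⁻ g, ENNReal.ofReal (Real.exp ((∑ b ∈ s, c b * g b) ^ 2))
        ∂(Measure.infinitePi fun _ : ι => gaussianReal 0 1) =
      ∫⁻ y, ENNReal.ofReal (Real.exp ((∑ b ∈ s, c b ^ 2) / 2 * y ^ 2)) ∂(gaussianReal 0 2) := by
  have h1 : ∀ z : ℝ, ENNReal.ofReal (Real.exp (z ^ 2)) =
      ∫⁻ y, ENNReal.ofReal (Real.exp (z * y)) ∂(gaussianReal 0 2) := fun z => by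
    rw [lintegral_exp_mul_gaussianReal]
    simp
  have hm : Measurable fun p : (ι → ℝ) × ℝ =>
      ENNReal.ofReal (Real.exp ((∑ b ∈ s, c b * p.1 b) * p.2)) := by fun_prop
  simp_rw [h1]
  rw [lintegral_lintegral_swap hm.aemeasurable]
  refine lintegral_congr fun y => ?_
  have h2 : ∀ g : ι → ℝ, ENNReal.ofReal (Real.exp ((∑ b ∈ s, c b * g b) * y)) =
      ∏ b ∈ s, ENNReal.ofReal (Real.exp (c b * y * g b)) := fun g => by
    rw [← ENNReal.ofReal_prod_of_nonneg fun b _ => (Real.exp_pos _).le, ← Real.exp_sum,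
      Finset.sum_mul]
    congr 2
    exact Finset.sum_congr rfl fun b _ => by ring
  simp_rw [h2]
  rw [lintegral_infinitePi_prod _ s (f := fun b z => ENNReal.ofReal (Real.exp (c b * y * z)))
    (fun b => by fun_prop)]
  simp_rw [lintegral_exp_mul_gaussianReal]
  rw [← ENNReal.ofReal_prod_of_nonneg fun b _ => (Real.exp_pos _).le, ← Real.exp_sum,
    Finset.sum_div, Finset.sum_mul]
  congr 2
  refine Finset.sum_congr rfl fun b _ => ?_
  simp
  ring

end GaussianSquare

/-! ### Exponential moments of the cavity fields -/

section CavityField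

variable (ζ : FiniteRSB) {β : ℕ → ℝ} {n : ℕ}

theorem length_ancestor {r : ℕ} (α : Leaf r) {p : ℕ} (hp : p ≤ r) : (ancestor α p).length = p := by
  simp [ancestor, hp]

theorem cavityField_eq (g : FieldNoise n) (i : Fin n) (α : Leaf ζ.r) :
    cavityField ζ β g i α = ∑ b ∈ (Finset.range (ζ.r + 1)).image (ancestor α),
      √(ζ.incVar β b.length) * g (i, b) := by
  have hlen : ∀ p ∈ Finset.range (ζ.r + 1), (ancestor α p).length = p := fun p hp =>
    length_ancestor α (by simp at hp; omega)
  rw [Finset.sum_image fun p hp q hq h => by rw [← hlen p hp, h, hlen q hq], cavityField]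
  exact Finset.sum_congr rfl fun p hp => by rw [hlen p hp]

theorem sum_sq_incVar (hβ : ∀ p : ℕ, 2 ≤ p → |β p| ≤ 1 / (p : ℝ) ^ 2) (α : Leaf ζ.r) :
    ∑ b ∈ (Finset.range (ζ.r + 1)).image (ancestor α), √(ζ.incVar β b.length) ^ 2 =
      xiD β ζ.qStar := by
  have hlen : ∀ p ∈ Finset.range (ζ.r + 1), (ancestor α p).length = p := fun p hp =>
    length_ancestor α (by simp at hp; omega)
  rw [Finset.sum_image fun p hp q hq h => by rw [← hlen p hp, h, hlen q hq], FiniteRSB.qStar,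
    ← ζ.sum_incVar]
  exact Finset.sum_congr rfl fun p hp => by
    rw [hlen p hp, Real.sq_sqrt (ζ.incVar_nonneg hβ (by simp at hp; omega))]

/-- The exponential moment `E ∏_i exp(Z^i(h_α)²)` is bounded uniformly in `ζ`. -/
theorem lintegral_prod_exp_sq_cavityField_le (hβ : ∀ p : ℕ, 2 ≤ p → |β p| ≤ 1 / (p : ℝ) ^ 2)
    (α : Leaf ζ.r) :
    ∫⁻ g, ∏ i, ENNReal.ofReal (Real.exp (cavityField ζ β g i α ^ 2)) ∂(fieldLaw n) ≤
      ENNReal.ofReal ((√(1 / 2))⁻¹) ^ n := by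
  have hcurry := Measure.infinitePi_map_curry (fun (_ : Fin n) (_ : List ℕ) => gaussianReal 0 1)
  set f : (List ℕ → ℝ) → ℝ≥0∞ := fun g => ENNReal.ofReal (Real.exp
    ((∑ b ∈ (Finset.range (ζ.r + 1)).image (ancestor α), √(ζ.incVar β b.length) * g b) ^ 2)) with hf
  have hfm : Measurable f := by fun_prop
  have h1 : ∫⁻ g, ∏ i, ENNReal.ofReal (Real.exp (cavityField ζ β g i α ^ 2)) ∂(fieldLaw n) =
      ∫⁻ g, ∏ i, f (g i) ∂(Measure.infinitePi fun _ : Fin n =>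
        Measure.infinitePi fun _ : List ℕ => gaussianReal 0 1) := by
    have hm : Measurable fun g : Fin n → List ℕ → ℝ => ∏ i, f (g i) := by fun_prop
    rw [← hcurry, lintegral_map hm (MeasurableEquiv.measurable _)]
    refine lintegral_congr fun g => Finset.prod_congr rfl fun i _ => ?_
    rw [cavityField_eq]
    rfl
  rw [h1, lintegral_infinitePi_prod _ Finset.univ (f := fun _ => f) fun _ => hfm,
    Finset.prod_const, Finset.card_univ, Fintype.card_fin]
  gcongr
  rw [hf, lintegral_exp_sq_sum, sum_sq_incVar ζ hβ]
  have hV : xiD β ζ.qStar ≤ 1 / 4 := (ζ.xiD_qStar_le hβ).trans (xiD_one_le hβ)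
  -- The variance is at most 1/4, so the coefficient of y² is at most 1/8, and 1 - 2·(1/8)·2 = 1/2.
  have h2 := lintegral_exp_sq_gaussianReal (v := 2) (A := 1 / 8) (by norm_num) 0
  simp only [zero_add] at h2
  calc _ ≤ ∫⁻ y, ENNReal.ofReal (Real.exp (1 / 8 * y ^ 2)) ∂(gaussianReal 0 2) := by
        refine lintegral_mono fun y => ENNReal.ofReal_le_ofReal (Real.exp_le_exp.2 ?_)
        exact mul_le_mul_of_nonneg_right (by linarith) (sq_nonneg y)
    _ ≤ _ := by rw [h2]; norm_num

end CavityField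


/-! ### Densities of product measures -/

section ProductDensity

theorem infinitePi_withDensity {ι X : Type*} [Fintype ι] [MeasurableSpace X] (μ : Measure X)
    [IsProbabilityMeasure μ] {D : ι → X → ℝ≥0∞} (hD : ∀ i, Measurable (D i))
    [∀ i, IsProbabilityMeasure (μ.withDensity (D i))] :
    (Measure.infinitePi fun _ : ι => μ).withDensity (fun z => ∏ i, D i (z i)) =
      Measure.infinitePi fun i => μ.withDensity (D i) := by
  classical
  refine Measure.eq_infinitePi _ fun s t ht => ?_
  have hbox : MeasurableSet (Set.pi (s : Set ι) t) :=
    MeasurableSet.pi s.countable_toSet fun i _ => ht i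
  have hpt : ∀ z : ι → X, (Set.pi (s : Set ι) t).indicator (fun z => ∏ i, D i (z i)) z =
      ∏ i, (if i ∈ s then (t i).indicator (D i) else D i) (z i) := fun z => by
    by_cases hz : z ∈ Set.pi (s : Set ι) t
    · rw [Set.indicator_of_mem hz]
      refine Finset.prod_congr rfl fun i _ => ?_
      split_ifs with hi
      · rw [Set.indicator_of_mem (hz i hi)]
      · rfl
    · rw [Set.indicator_of_notMem hz]
      obtain ⟨i, hi, hzi⟩ : ∃ i ∈ s, z i ∉ t i := by simpa [Set.mem_pi] using hz
      exact (Finset.prod_eq_zero (Finset.mem_univ i) (by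
        rw [if_pos hi, Set.indicator_of_notMem hzi])).symm
  rw [withDensity_apply _ hbox, ← lintegral_indicator hbox, lintegral_congr hpt,
    lintegral_infinitePi_prod μ Finset.univ
      (f := fun i => if i ∈ s then (t i).indicator (D i) else D i) fun i => by
        split_ifs
        · exact (hD i).indicator (ht i)
        · exact hD i]
  rw [← Finset.prod_subset (Finset.subset_univ s)]
  · refine Finset.prod_congr rfl fun i hi => ?_
    rw [if_pos hi, lintegral_indicator (ht i), withDensity_apply _ (ht i)]
  · intro i _ hi
    have := measure_univ (μ := μ.withDensity (D i))
    rwa [withDensity_apply _ MeasurableSet.univ, Measure.restrict_univ,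
      show D i = if i ∈ s then (t i).indicator (D i) else D i from (if_neg hi).symm] at this

end ProductDensity

/-! ### The potentials X_p as quadratic functions -/

section Potential

variable (ζ : FiniteRSB) {β : ℕ → ℝ}

open scoped NNReal

theorem lintegral_exp_quadratic {A B m : ℝ} {v : ℝ≥0} (h : 2 * (m * A) * v < 1) (s : ℝ) :
    ∫⁻ z, ENNReal.ofReal (Real.exp (m * (A * (s + z) ^ 2 + B))) ∂(gaussianReal 0 v) =
      ENNReal.ofReal (Real.exp (m * B) * ((√(1 - 2 * (m * A) * v))⁻¹ *
        Real.exp (m * A / (1 - 2 * (m * A) * v) * s ^ 2))) := by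
  rw [ENNReal.ofReal_mul (Real.exp_pos _).le, ← lintegral_exp_sq_gaussianReal h,
    ← lintegral_const_mul _ (by fun_prop)]
  refine lintegral_congr fun z => ?_
  rw [← ENNReal.ofReal_mul (Real.exp_pos _).le, ← Real.exp_add]
  ring_nf

/-- One step of the recursion that defines the potentials, on quadratic functions. -/
theorem exists_quadratic_step {X Y : List ℝ → ℝ} {A B m : ℝ} {v : ℝ≥0} (hm : 0 < m)
    (h : 2 * (m * A) * v < 1) (hX : ∀ x, X x = A * x.sum ^ 2 + B)
    (hY : ∀ x, Y x = 1 / m * Real.log (∫ z, Real.exp (m * X (x ++ [z])) ∂(gaussianReal 0 v))) :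
    (∃ B', ∀ x, Y x = A / (1 - 2 * (m * A) * v) * x.sum ^ 2 + B') ∧
      ∀ x, ∫⁻ z, ENNReal.ofReal (Real.exp (m * X (x ++ [z]))) ∂(gaussianReal 0 v) =
        ENNReal.ofReal (Real.exp (m * Y x)) := by
  set q := 1 - 2 * (m * A) * v with hq
  have hq0 : 0 < q := by linarith
  have hl : ∀ x : List ℝ, ∫⁻ z, ENNReal.ofReal (Real.exp (m * X (x ++ [z])))
      ∂(gaussianReal 0 v) = ENNReal.ofReal (Real.exp (m * B) * ((√q)⁻¹ *
        Real.exp (m * A / q * x.sum ^ 2))) := fun x => by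
    simp_rw [hX, List.sum_append, List.sum_singleton]
    exact lintegral_exp_quadratic h _
  have hi : ∀ x : List ℝ, ∫ z, Real.exp (m * X (x ++ [z])) ∂(gaussianReal 0 v) =
      Real.exp (m * B) * ((√q)⁻¹ * Real.exp (m * A / q * x.sum ^ 2)) := fun x => by
    rw [integral_eq_lintegral_of_nonneg_ae (ae_of_all _ fun z => (Real.exp_pos _).le) ?_, hl x,
      ENNReal.toReal_ofReal (by positivity)]
    simp_rw [hX, List.sum_append, List.sum_singleton]
    fun_prop
  have hsq : 0 < (√q)⁻¹ := by positivity
  constructor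
  · refine ⟨B + 1 / m * Real.log (√q)⁻¹, fun x => ?_⟩
    rw [hY, hi, Real.log_mul (Real.exp_pos _).ne' (by positivity), Real.log_mul hsq.ne'
      (Real.exp_pos _).ne', Real.log_exp, Real.log_exp]
    field_simp
    ring
  · intro x
    rw [hl, hY, hi, ← mul_assoc m, mul_one_div_cancel hm.ne', one_mul, Real.exp_log (by positivity)]

variable {ζ}

/-- One level lowers 1/(2A) by m times the variance of the increment, and m < 1. Starting from 1 + Ŝ
≥ 1, all levels together lower it by at most ξ'(q_*) ≤ 1/4, so the Gaussian integral of each step is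
finite; the lower bound on 1/(2A) is the invariant that records this. -/
theorem potentialAux_step (hβ : ∀ p : ℕ, 2 ≤ p → |β p| ≤ 1 / (p : ℝ) ^ 2) {j : ℕ}
    (hj : j + 1 ≤ ζ.r) {A B : ℝ} (hA : 0 < A)
    (hAb : 1 - (xiD β ζ.qStar - xiD β (ζ.q (ζ.r - j))) ≤ 1 / (2 * A))
    (hX : ∀ x, potentialAux ζ β j x = A * x.sum ^ 2 + B) :
    (∃ A B, 0 < A ∧ 1 - (xiD β ζ.qStar - xiD β (ζ.q (ζ.r - (j + 1)))) ≤ 1 / (2 * A) ∧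
      ∀ x, potentialAux ζ β (j + 1) x = A * x.sum ^ 2 + B) ∧
    ∀ x, ∫⁻ z, ENNReal.ofReal (Real.exp (ζ.cdf (ζ.q (ζ.r - (j + 1))) *
        potentialAux ζ β j (x ++ [z]))) ∂(gaussianReal 0 (ζ.incVar β (ζ.r - j)).toNNReal) =
      ENNReal.ofReal (Real.exp (ζ.cdf (ζ.q (ζ.r - (j + 1))) * potentialAux ζ β (j + 1) x)) := by
  set m := ζ.cdf (ζ.q (ζ.r - (j + 1))) with hm
  have hm0 : 0 < m := ζ.cdf_q_pos (by omega)
  have hm1 : m < 1 := ζ.cdf_q_lt_one (by omega)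
  have e1 : ζ.r - j = ζ.r - (j + 1) + 1 := by omega
  have hv0 : 0 ≤ ζ.incVar β (ζ.r - j) := ζ.incVar_nonneg hβ (by omega)
  have hv : ζ.incVar β (ζ.r - j) =
      xiD β (ζ.q (ζ.r - j)) - xiD β (ζ.q (ζ.r - (j + 1))) := by
    rw [e1, FiniteRSB.incVar]
  have hV : xiD β ζ.qStar ≤ 1 / 4 := (ζ.xiD_qStar_le hβ).trans (xiD_one_le hβ)
  have hq0 : 0 ≤ xiD β (ζ.q (ζ.r - (j + 1))) := xiD_nonneg (ζ.q_nonneg' (by omega))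
  have hmv : m * ζ.incVar β (ζ.r - j) ≤ ζ.incVar β (ζ.r - j) := mul_le_of_le_one_left hv0 hm1.le
  have hcoe : (((ζ.incVar β (ζ.r - j)).toNNReal : ℝ≥0) : ℝ) = ζ.incVar β (ζ.r - j) :=
    Real.coe_toNNReal _ hv0
  have hAv : 1 / (2 * A) * (2 * A) = 1 := by field_simp
  have hpos : 0 < 1 / (2 * A) - m * ζ.incVar β (ζ.r - j) := by linarith
  have hlt : 2 * (m * A) * ((ζ.incVar β (ζ.r - j)).toNNReal : ℝ≥0) < 1 := by
    rw [hcoe]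
    have := mul_pos hpos (by positivity : 0 < 2 * A)
    linarith
  obtain ⟨⟨B', hB'⟩, hY⟩ := exists_quadratic_step (Y := potentialAux ζ β (j + 1)) hm0 hlt hX
    fun x => rfl
  refine ⟨⟨_, B', div_pos hA (by linarith), ?_, hB'⟩, hY⟩
  have hval : 1 / (2 * (A / (1 - 2 * (m * A) * ((ζ.incVar β (ζ.r - j)).toNNReal : ℝ≥0)))) =
      1 / (2 * A) - m * ζ.incVar β (ζ.r - j) := by
    rw [hcoe, mul_div_assoc', one_div_div, sub_div]
    congr 1
    field_simp
  rw [hval]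
  linarith

/-- The potentials are quadratic in the sum of the increments. -/
theorem exists_potentialAux (hβ : ∀ p : ℕ, 2 ≤ p → |β p| ≤ 1 / (p : ℝ) ^ 2) {j : ℕ}
    (hj : j ≤ ζ.r) :
    ∃ A B, 0 < A ∧ 1 - (xiD β ζ.qStar - xiD β (ζ.q (ζ.r - j))) ≤ 1 / (2 * A) ∧
      ∀ x, potentialAux ζ β j x = A * x.sum ^ 2 + B := by
  induction j with
  | zero =>
    have h0 := ζ.Shat_nonneg hβ
    refine ⟨1 / (2 * (1 + ζ.Shat β)), 0, by positivity, ?_, fun x => ?_⟩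
    · rw [Nat.sub_zero, FiniteRSB.qStar]
      field_simp
      linarith
    · rw [potentialAux]
      ring
  | succ j ih =>
    obtain ⟨A, B, hA, hAb, hX⟩ := ih (by omega)
    exact (potentialAux_step hβ hj hA hAb hX).1

variable (ζ β) in
/-- The potential `X_p` as a function of the sum of the increments. -/
def level (p : ℕ) (s : ℝ) : ℝ := potential ζ β p [s]

/-- The potentials depend on the increments only through their sum, so the state carried along the
tree can be a real number per field instead of a list. -/
theorem potential_eq_level (hβ : ∀ p : ℕ, 2 ≤ p → |β p| ≤ 1 / (p : ℝ) ^ 2) (p : ℕ) (x : List ℝ) :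
    potential ζ β p x = level ζ β p x.sum := by
  obtain ⟨A, B, -, -, h⟩ := exists_potentialAux (ζ := ζ) hβ (j := ζ.r - p) (by omega)
  rw [level, potential, potential, h, h, List.sum_singleton]

theorem measurable_level (hβ : ∀ p : ℕ, 2 ≤ p → |β p| ≤ 1 / (p : ℝ) ^ 2) (p : ℕ) :
    Measurable (level ζ β p) := by
  obtain ⟨A, B, -, -, h⟩ := exists_potentialAux (ζ := ζ) hβ (j := ζ.r - p) (by omega)
  have : level ζ β p = fun s => A * s ^ 2 + B := funext fun s => by
    rw [level, potential, h, List.sum_singleton]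
  rw [this]
  fun_prop

theorem level_last (s : ℝ) : level ζ β ζ.r s = s ^ 2 / (2 * (1 + ζ.Shat β)) := by
  rw [level, potential, Nat.sub_self, potentialAux, List.sum_singleton]

theorem lintegral_exp_level (hβ : ∀ p : ℕ, 2 ≤ p → |β p| ≤ 1 / (p : ℝ) ^ 2) {p : ℕ}
    (hp : p < ζ.r) (s : ℝ) :
    ∫⁻ z, ENNReal.ofReal (Real.exp (ζ.cdf (ζ.q p) * level ζ β (p + 1) (s + z)))
        ∂(gaussianReal 0 (ζ.incVar β (p + 1)).toNNReal) =
      ENNReal.ofReal (Real.exp (ζ.cdf (ζ.q p) * level ζ β p s)) := by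
  obtain ⟨A, B, hA, hAb, hX⟩ := exists_potentialAux (ζ := ζ) hβ (j := ζ.r - (p + 1)) (by omega)
  have h := (potentialAux_step hβ (by omega) hA hAb hX).2 [s]
  rw [show ζ.r - (ζ.r - (p + 1) + 1) = p by omega, show ζ.r - (ζ.r - (p + 1)) = p + 1 by omega,
    show ζ.r - (p + 1) + 1 = ζ.r - p by omega] at h
  have e : ∀ z, level ζ β (p + 1) (s + z) = potentialAux ζ β (ζ.r - (p + 1)) ([s] ++ [z]) :=
    fun z => by
      have := potential_eq_level (ζ := ζ) hβ (p + 1) ([s] ++ [z])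
      rw [List.sum_append, List.sum_singleton, List.sum_singleton] at this
      exact this.symm
  simp_rw [e]
  exact h

end Potential

/-! ### Sampling the tilted increments -/

section TiltedStep

variable (ζ : FiniteRSB) (β : ℕ → ℝ)

/-- Law of the tilted increment at depth `p + 1` when the increments above it add up to `s`. -/
def incLaw (p : ℕ) (s : ℝ) : Measure ℝ :=
  (gaussianReal 0 (ζ.incVar β (p + 1)).toNNReal).withDensity fun z =>
    ENNReal.ofReal (Real.exp (ζ.cdf (ζ.q p) * (level ζ β (p + 1) (s + z) - level ζ β p s)))

variable {ζ β}

theorem tiltedKernel_succ (hβ : ∀ p : ℕ, 2 ≤ p → |β p| ≤ 1 / (p : ℝ) ^ 2) (p : ℕ) (x : List ℝ) :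
    tiltedKernel ζ β (p + 1) x = incLaw ζ β p x.sum := by
  simp only [tiltedKernel, incLaw, potential_eq_level hβ, List.sum_append, List.sum_singleton]

theorem measurable_incDensity (hβ : ∀ p : ℕ, 2 ≤ p → |β p| ≤ 1 / (p : ℝ) ^ 2) (p : ℕ) :
    Measurable fun y : ℝ × ℝ => ENNReal.ofReal (Real.exp (ζ.cdf (ζ.q p) *
      (level ζ β (p + 1) (y.1 + y.2) - level ζ β p y.1))) := by
  have h1 := measurable_level (ζ := ζ) hβ (p + 1)
  have h2 := measurable_level (ζ := ζ) hβ p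
  fun_prop

/-- Subtracting X_p is the normalisation: exp(m X_p) is the Gaussian average of exp(m X_{p+1}). -/
theorem isProbabilityMeasure_incLaw (hβ : ∀ p : ℕ, 2 ≤ p → |β p| ≤ 1 / (p : ℝ) ^ 2) {p : ℕ}
    (hp : p < ζ.r) (s : ℝ) : IsProbabilityMeasure (incLaw ζ β p s) := by
  refine ⟨?_⟩
  have h1 := measurable_level (ζ := ζ) hβ (p + 1)
  have hpt : ∀ z, ENNReal.ofReal (Real.exp (ζ.cdf (ζ.q p) *
      (level ζ β (p + 1) (s + z) - level ζ β p s))) =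
      ENNReal.ofReal (Real.exp (-(ζ.cdf (ζ.q p) * level ζ β p s))) *
        ENNReal.ofReal (Real.exp (ζ.cdf (ζ.q p) * level ζ β (p + 1) (s + z))) := fun z => by
    rw [← ENNReal.ofReal_mul (Real.exp_pos _).le, ← Real.exp_add]
    ring_nf
  rw [incLaw, withDensity_apply _ MeasurableSet.univ, Measure.restrict_univ, lintegral_congr hpt,
    lintegral_const_mul _ (by fun_prop), lintegral_exp_level hβ hp,
    ← ENNReal.ofReal_mul (Real.exp_pos _).le, ← Real.exp_add, neg_add_cancel, Real.exp_zero,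
    ENNReal.ofReal_one]

theorem measurable_incLaw (hβ : ∀ p : ℕ, 2 ≤ p → |β p| ≤ 1 / (p : ℝ) ^ 2) (p : ℕ) {A : Set ℝ}
    (hA : MeasurableSet A) : Measurable fun s => incLaw ζ β p s A := by
  simp_rw [incLaw, withDensity_apply _ hA]
  exact (measurable_incDensity hβ p).lintegral_prod_right'

theorem ae_unitInterval : ∀ᵐ u : unitInterval, 0 < (u : ℝ) ∧ (u : ℝ) < 1 := by
  have h : ∀ a : unitInterval, ∀ᵐ u : unitInterval, u ≠ a := fun a => by simp [ae_iff]
  filter_upwards [h 0, h 1] with u hu0 hu1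
  exact ⟨lt_of_le_of_ne u.2.1 fun h => hu0 (Subtype.ext h.symm),
    lt_of_le_of_ne u.2.2 fun h => hu1 (Subtype.ext h)⟩

open Classical in
/-- The quantile function, modified at the endpoints of the unit interval. -/
def openQuantile (μ : Measure ℝ) (u : unitInterval) : ℝ :=
  if 0 < (u : ℝ) ∧ (u : ℝ) < 1 then quantile μ u else 0

/-- For u in (0,1) the quantile is at most t exactly when u does not exceed the distribution
function at t, and that condition is jointly measurable. At u = 0 and u = 1 the equivalence is not
available, hence the constant value there. -/
theorem measurable_openQuantile {T : Type*} [MeasurableSpace T] {κ : T → Measure ℝ}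
    [∀ s, IsProbabilityMeasure (κ s)] (hκ : ∀ t, Measurable fun s => κ s (Set.Iic t)) :
    Measurable fun y : T × unitInterval => openQuantile (κ y.1) y.2 := by
  have hu : Measurable fun y : T × unitInterval => (y.2 : ℝ) :=
    measurable_subtype_coe.comp measurable_snd
  have hM : MeasurableSet {y : T × unitInterval | 0 < (y.2 : ℝ) ∧ (y.2 : ℝ) < 1} :=
    (measurableSet_lt measurable_const hu).inter (measurableSet_lt hu measurable_const)
  refine measurable_of_Iic fun t => ?_
  have hF : Measurable fun y : T × unitInterval => (κ y.1).real (Set.Iic t) :=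
    (hκ t).ennreal_toReal.comp measurable_fst
  have hpre : (fun y : T × unitInterval => openQuantile (κ y.1) y.2) ⁻¹' Set.Iic t =
      ({y | 0 < (y.2 : ℝ) ∧ (y.2 : ℝ) < 1} ∩ {y | (y.2 : ℝ) ≤ (κ y.1).real (Set.Iic t)}) ∪
      ({y | 0 < (y.2 : ℝ) ∧ (y.2 : ℝ) < 1}ᶜ ∩ {_y | (0 : ℝ) ≤ t}) := by
    ext ⟨s, u⟩
    by_cases h : 0 < (u : ℝ) ∧ (u : ℝ) < 1
    · have hq := quantile_le_iff (κ s) h.1 h.2 t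
      have e : openQuantile (κ s) u = quantile (κ s) u := if_pos h
      simp only [Set.mem_preimage, e, Set.mem_Iic, hq, Set.mem_union,
        Set.mem_inter_iff, Set.mem_ofPred_eq, Set.mem_compl_iff, h, not_true, true_and, false_and,
        or_false, and_self]
    · have e : openQuantile (κ s) u = 0 := if_neg h
      simp only [Set.mem_preimage, e, Set.mem_Iic, Set.mem_union,
        Set.mem_inter_iff, Set.mem_ofPred_eq, Set.mem_compl_iff, h, not_false_eq_true, true_and,
        false_and, false_or]
  rw [hpre]
  exact (hM.inter (measurableSet_le hu hF)).union (hM.compl.inter (MeasurableSet.const _))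

theorem map_openQuantile (μ : Measure ℝ) [IsProbabilityMeasure μ] :
    (volume : Measure unitInterval).map (openQuantile μ) = μ := by
  have h : openQuantile μ =ᵐ[volume] quantile μ := by
    filter_upwards [ae_unitInterval] with u hu
    exact if_pos hu
  rw [Measure.map_congr h, map_quantile]

variable (ζ β) in
open Classical in
/-- The tilted increment at depth `p + 1`, when the increments above it add up to `s`. -/
def sampleInc (p : ℕ) (s : ℝ) (u : unitInterval) : ℝ :=
  -- Below the leaves the value is arbitrary; zero gives measurability for every p, as the lemmas on
  -- trees require.
  if p < ζ.r then openQuantile (incLaw ζ β p s) u else 0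

theorem measurable_sampleInc (hβ : ∀ p : ℕ, 2 ≤ p → |β p| ≤ 1 / (p : ℝ) ^ 2) (p : ℕ) :
    Measurable (Function.uncurry (sampleInc ζ β p)) := by
  by_cases hp : p < ζ.r
  · have := isProbabilityMeasure_incLaw hβ hp
    simp only [Function.uncurry_def, sampleInc, hp, if_true]
    exact measurable_openQuantile fun t => measurable_incLaw hβ p measurableSet_Iic
  · simp only [Function.uncurry_def, sampleInc, hp, if_false]
    exact measurable_const

theorem measurable_sampleInc_right (hβ : ∀ p : ℕ, 2 ≤ p → |β p| ≤ 1 / (p : ℝ) ^ 2) (p : ℕ)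
    (s : ℝ) : Measurable (sampleInc ζ β p s) :=
  Measurable.of_uncurry_left (measurable_sampleInc hβ p)

theorem map_sampleInc (hβ : ∀ p : ℕ, 2 ≤ p → |β p| ≤ 1 / (p : ℝ) ^ 2) {p : ℕ} (hp : p < ζ.r)
    (s : ℝ) : (volume : Measure unitInterval).map (sampleInc ζ β p s) = incLaw ζ β p s := by
  have := isProbabilityMeasure_incLaw hβ hp s
  have e : sampleInc ζ β p s = openQuantile (incLaw ζ β p s) := funext fun u => if_pos hp
  rw [e, map_openQuantile]

end TiltedStep


/-! ### One tilting step for n fields -/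

section FieldTilt

open scoped NNReal

variable (ζ : FiniteRSB) (β : ℕ → ℝ) {n : ℕ}

/-- The cavity fields gain an increment from depth `p` to depth `p + 1`. -/
def gaussStep (p : ℕ) (s g : Fin n → ℝ) : Fin n → ℝ :=
  fun i => s i + √(ζ.incVar β (p + 1)) * g i

/-- The tilted fields gain an increment from depth `p` to depth `p + 1`. -/
def tiltStep (p : ℕ) (s : Fin n → ℝ) (u : Fin n → unitInterval) : Fin n → ℝ :=
  fun i => s i + sampleInc ζ β p (s i) (u i)

/-- The exponential of the sum of the potentials of the fields. -/
def levelWeight (p : ℕ) (s : Fin n → ℝ) : ℝ≥0∞ :=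
  ENNReal.ofReal (Real.exp (∑ i, level ζ β p (s i)))

variable {ζ β}

theorem measurable_gaussStep (p : ℕ) :
    Measurable (Function.uncurry (gaussStep (n := n) ζ β p)) := by
  have : Function.uncurry (gaussStep (n := n) ζ β p) =
      fun y i => y.1 i + √(ζ.incVar β (p + 1)) * y.2 i := rfl
  rw [this]
  fun_prop

theorem measurable_tiltStep (hβ : ∀ p : ℕ, 2 ≤ p → |β p| ≤ 1 / (p : ℝ) ^ 2) (p : ℕ) :
    Measurable (Function.uncurry (tiltStep (n := n) ζ β p)) := by
  refine measurable_pi_iff.2 fun i => ?_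
  have h1 : Measurable fun y : (Fin n → ℝ) × (Fin n → unitInterval) => (y.1 i, y.2 i) := by
    fun_prop
  have h2 := (measurable_sampleInc (ζ := ζ) hβ p).comp h1
  have h3 : Measurable fun y : (Fin n → ℝ) × (Fin n → unitInterval) => y.1 i := by fun_prop
  exact h3.add h2

theorem measurable_levelWeight (hβ : ∀ p : ℕ, 2 ≤ p → |β p| ≤ 1 / (p : ℝ) ^ 2) (p : ℕ) :
    Measurable (levelWeight (n := n) ζ β p) := by
  have := measurable_level (ζ := ζ) hβ p
  unfold levelWeight
  fun_prop

theorem map_sqrt_mul_gaussianReal {v : ℝ} (hv : 0 ≤ v) :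
    (gaussianReal 0 1).map (fun x => √v * x) = gaussianReal 0 v.toNNReal := by
  have h : NNReal.mk (√v ^ 2) (sq_nonneg _) = v.toNNReal :=
    NNReal.eq ((Real.sq_sqrt hv).trans (Real.coe_toNNReal _ hv).symm)
  rw [gaussianReal_map_const_mul, mul_zero, mul_one, h]

theorem map_gauss_increments (hβ : ∀ p : ℕ, 2 ≤ p → |β p| ≤ 1 / (p : ℝ) ^ 2) {p : ℕ}
    (hp : p ≤ ζ.r) : (Measure.infinitePi fun _ : Fin n => gaussianReal 0 1).map
      (fun g i => √(ζ.incVar β p) * g i) =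
      Measure.infinitePi fun _ : Fin n => gaussianReal 0 (ζ.incVar β p).toNNReal := by
  rw [Measure.infinitePi_map_pi (fun _ : Fin n => gaussianReal 0 1)
    (f := fun _ x => √(ζ.incVar β p) * x) fun i => by fun_prop]
  congr 1
  funext i
  exact map_sqrt_mul_gaussianReal (ζ.incVar_nonneg hβ hp)

theorem map_tilt_increments (hβ : ∀ p : ℕ, 2 ≤ p → |β p| ≤ 1 / (p : ℝ) ^ 2) {p : ℕ}
    (hp : p < ζ.r) (s : Fin n → ℝ) :
    (Measure.infinitePi fun _ : Fin n => (volume : Measure unitInterval)).map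
      (fun u i => sampleInc ζ β p (s i) (u i)) =
    (Measure.infinitePi fun _ : Fin n => gaussianReal 0 (ζ.incVar β (p + 1)).toNNReal).withDensity
      fun z => ∏ i, ENNReal.ofReal (Real.exp (ζ.cdf (ζ.q p) *
        (level ζ β (p + 1) (s i + z i) - level ζ β p (s i)))) := by
  have hl := measurable_level (ζ := ζ) hβ (p + 1)
  have hinst : ∀ i, IsProbabilityMeasure ((gaussianReal 0 (ζ.incVar β (p + 1)).toNNReal).withDensity
      fun z => ENNReal.ofReal (Real.exp (ζ.cdf (ζ.q p) *
        (level ζ β (p + 1) (s i + z) - level ζ β p (s i))))) := fun i =>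
    isProbabilityMeasure_incLaw (ζ := ζ) hβ hp (s i)
  have h1 := infinitePi_withDensity (gaussianReal 0 (ζ.incVar β (p + 1)).toNNReal)
    (D := fun i z => ENNReal.ofReal (Real.exp (ζ.cdf (ζ.q p) *
        (level ζ β (p + 1) (s i + z) - level ζ β p (s i))))) fun i => by fun_prop
  rw [h1, Measure.infinitePi_map_pi (fun _ : Fin n => (volume : Measure unitInterval))
    (f := fun i => sampleInc ζ β p (s i)) fun i =>
      measurable_sampleInc_right hβ p (s i)]
  congr 1
  funext i
  exact map_sampleInc hβ hp (s i)

theorem levelWeight_rpow_add (m : ℝ) (p : ℕ) (s z : Fin n → ℝ) :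
    levelWeight ζ β (p + 1) (fun i => s i + z i) ^ m = levelWeight ζ β p s ^ m *
      ∏ i, ENNReal.ofReal (Real.exp (m * (level ζ β (p + 1) (s i + z i) - level ζ β p (s i)))) := by
  rw [levelWeight, levelWeight, ENNReal.ofReal_rpow_of_pos (Real.exp_pos _),
    ENNReal.ofReal_rpow_of_pos (Real.exp_pos _), ← Real.exp_mul, ← Real.exp_mul,
    ← ENNReal.ofReal_prod_of_nonneg fun i _ => (Real.exp_pos _).le,
    ← Real.exp_sum, ← ENNReal.ofReal_mul (Real.exp_pos _).le, ← Real.exp_add, ← Finset.mul_sum,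
    Finset.sum_sub_distrib]
  ring_nf

/-- This is the tilting hypothesis of `map_treeSum_tilt`: raised to the power ζ([0,q_p]), the ratio
of consecutive weights is the product of the densities of the tilted increments. -/
theorem lintegral_levelWeight_gaussStep (hβ : ∀ p : ℕ, 2 ≤ p → |β p| ≤ 1 / (p : ℝ) ^ 2) {p : ℕ}
    (hp : p < ζ.r) (s : Fin n → ℝ) {f : (Fin n → ℝ) → ℝ≥0∞} (hf : Measurable f) :
    ∫⁻ g, levelWeight ζ β (p + 1) (gaussStep ζ β p s g) ^ ζ.cdf (ζ.q p) *
        f (gaussStep ζ β p s g) ∂(Measure.infinitePi fun _ : Fin n => gaussianReal 0 1) =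
      levelWeight ζ β p s ^ ζ.cdf (ζ.q p) * ∫⁻ u, f (tiltStep ζ β p s u)
        ∂(Measure.infinitePi fun _ : Fin n => (volume : Measure unitInterval)) := by
  have hfs : Measurable fun z : Fin n → ℝ => f (fun i => s i + z i) := by fun_prop
  have hwm := measurable_levelWeight (n := n) (ζ := ζ) hβ (p + 1)
  have hl := measurable_level (ζ := ζ) hβ (p + 1)
  have hD : Measurable fun z : Fin n → ℝ => ∏ i, ENNReal.ofReal (Real.exp (ζ.cdf (ζ.q p) *
      (level ζ β (p + 1) (s i + z i) - level ζ β p (s i)))) := by fun_prop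
  have hsm : Measurable fun (u : Fin n → unitInterval) i => sampleInc ζ β p (s i) (u i) :=
    measurable_pi_iff.2 fun i => (measurable_sampleInc_right hβ p (s i)).comp
      (measurable_pi_apply i)
  have hR : ∫⁻ u, f (tiltStep ζ β p s u)
      ∂(Measure.infinitePi fun _ : Fin n => (volume : Measure unitInterval)) = _ :=
    (lintegral_map (μ := Measure.infinitePi fun _ : Fin n =>
      (volume : Measure unitInterval)) hfs hsm).symm
  rw [hR, map_tilt_increments hβ hp, lintegral_withDensity_eq_lintegral_mul _ hD hfs,
    ← lintegral_const_mul _ (hD.mul hfs), ← map_gauss_increments hβ (p := p + 1) hp]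
  have hG : Measurable fun (g : Fin n → ℝ) i => √(ζ.incVar β (p + 1)) * g i := by fun_prop
  refine Eq.trans ?_ (lintegral_map ((hD.mul hfs).const_mul _) hG).symm
  refine lintegral_congr fun g => ?_
  rw [Pi.mul_apply, ← mul_assoc]
  exact congrArg (· * f (gaussStep ζ β p s g))
    (levelWeight_rpow_add (ζ.cdf (ζ.q p)) p s fun i => √(ζ.incVar β (p + 1)) * g i)

end FieldTilt

/-! ### Leaf sums along paths -/

section Paths

variable {S E : Type*}

/-- State at depth `p` of the path to a leaf, when states evolve by `step` from `s` at the root. -/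
def pathState {r : ℕ} (step : ℕ → S → E → S) (s : S) (x : List ℕ → E) (α : Leaf r) : ℕ → S
  | 0 => s
  -- Step p reads the label at depth p + 1; the label of the root enters only through the initial
  -- state.
  | p + 1 => step p (pathState step s x α p) (x (ancestor α (p + 1)))

theorem ancestor_zero {r : ℕ} (α : Leaf r) : ancestor α 0 = [] := rfl

theorem ancestor_cons {r : ℕ} (a : ℕ) (α : Leaf r) (p : ℕ) :
    ancestor (Fin.cons a α : Leaf (r + 1)) (p + 1) = a :: ancestor α p := by
  simp [ancestor, List.ofFn_succ]

theorem pathState_cons {r : ℕ} (step : ℕ → S → E → S) (s : S) (x : List ℕ → E) (a : ℕ)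
    (α : Leaf r) (p : ℕ) : pathState step s x (Fin.cons a α : Leaf (r + 1)) (p + 1) =
      pathState (fun p => step (p + 1)) (step 0 s (x [a])) (fun b => x (a :: b)) α p := by
  induction p with
  | zero => simp [pathState, ancestor_cons, ancestor_zero]
  | succ p ih => rw [pathState, ih, pathState, ancestor_cons]

/-- The recursively defined sum is the sum over the leaves. -/
theorem treeSum_eq_tsum (ψ : S → ℝ≥0∞) (r : ℕ) :
    ∀ (m : ℕ → ℝ) (step : ℕ → S → E → S) (s : S) (ω : List ℕ → (ℕ → ℝ) × E),
    treeSum ψ r m step s ω = ∑' α : Leaf r,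
      (∏ p : Fin r, ENNReal.ofReal (stablePoint (m p) (ω (ancestor α p)).1 (α p))) *
        ψ (pathState step s (fun b => (ω b).2) α r) := by
  induction r with
  | zero =>
    intro m step s ω
    simp [treeSum, pathState]
  | succ r ih =>
    intro m step s ω
    rw [treeSum, ← (Fin.consEquiv fun _ : Fin (r + 1) => ℕ).tsum_eq, ENNReal.tsum_prod']
    refine tsum_congr fun a => ?_
    rw [ih, ← ENNReal.tsum_mul_left]
    refine tsum_congr fun α => ?_
    have e : (Fin.consEquiv fun _ : Fin (r + 1) => ℕ) (a, α) = (Fin.cons a α : Leaf (r + 1)) := rfl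
    rw [e, pathState_cons, Fin.prod_univ_succ, ← mul_assoc]
    simp [ancestor_cons, ancestor_zero]

end Paths


/-! ### Regrouping the noise by nodes -/

section Instances

instance : IsProbabilityMeasure cascadeLaw := by unfold cascadeLaw; infer_instance

instance (n : ℕ) : IsProbabilityMeasure (fieldLaw n) := by unfold fieldLaw; infer_instance

end Instances

section NodeData

variable {n : ℕ} {X : Type*} [MeasurableSpace X] (μ : Measure X) [IsProbabilityMeasure μ]

theorem infinitePi_map_equiv {ι κ : Type*} (e : κ ≃ ι) :
    (Measure.infinitePi fun _ : κ => μ).map (fun ω i => ω (e.symm i)) =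
      Measure.infinitePi fun _ : ι => μ := by
  rw [← Measure.infinitePi_map_piCongrLeft (μ := fun _ : ι => μ) e]
  congr 1
  funext ω i
  obtain ⟨j, rfl⟩ := e.surjective i
  rw [e.symm_apply_apply]
  exact (Equiv.piCongrLeft_apply_apply (P := fun _ : ι => X) e ω j).symm

/-- The noise at the nodes of the tree. -/
def nodeData (ω : CascadeNoise × (Fin n × List ℕ → X)) : List ℕ → (ℕ → ℝ) × (Fin n → X) :=
  fun b => (fun j => ω.1 (b, j), fun i => ω.2 (i, b))

theorem measurable_nodeData : Measurable (nodeData (n := n) (X := X)) := by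
  unfold nodeData
  fun_prop

theorem map_nodeData :
    (cascadeLaw.prod (Measure.infinitePi fun _ : Fin n × List ℕ => μ)).map nodeData =
      treeLaw (Measure.infinitePi fun _ : Fin n => μ) := by
  have h1 : cascadeLaw.map (fun ε (b : List ℕ) (j : ℕ) => ε (b, j)) =
      Measure.infinitePi fun _ : List ℕ => expSeqLaw :=
    Measure.infinitePi_map_curry (fun (_ : List ℕ) (_ : ℕ) => expMeasure 1)
  have h2 : (Measure.infinitePi fun _ : Fin n × List ℕ => μ).map
      (fun g (b : List ℕ) (i : Fin n) => g (i, b)) =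
      Measure.infinitePi fun _ : List ℕ => Measure.infinitePi fun _ : Fin n => μ := by
    rw [← Measure.infinitePi_map_curry (fun (_ : List ℕ) (_ : Fin n) => μ),
      ← infinitePi_map_equiv μ (Equiv.prodComm (Fin n) (List ℕ)),
      Measure.map_map (MeasurableEquiv.measurable _) (by fun_prop)]
    rfl
  rw [treeLaw, ← infinitePi_prod_map_pair, ← h1, ← h2, Measure.map_prod_map _ _ (by fun_prop)
    (by fun_prop), Measure.map_map (by fun_prop) (by fun_prop)]
  rfl

end NodeData

/-! ### Weights of the cascade and the dominating variable -/

section Cascade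

variable (ζ : FiniteRSB)

/-- The parameters of the cascade. -/
def param (p : ℕ) : ℝ := ζ.cdf (ζ.q p)

theorem param_mem (p : ℕ) (hp : p < ζ.r) : 0 < param ζ p ∧ param ζ p < 1 :=
  ⟨ζ.cdf_q_pos hp.le, ζ.cdf_q_lt_one hp⟩

theorem param_lt (p : ℕ) (hp : p + 1 < ζ.r) : param ζ p < param ζ (p + 1) := ζ.cdf_q_lt hp.le

theorem stablePoint_pos {m : ℝ} {ε : ℕ → ℝ} (hε : ∀ j, 0 < ε j) (j : ℕ) :
    0 < stablePoint m ε j :=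
  Real.rpow_pos_of_pos (Finset.sum_pos (fun i _ => hε i) (by simp)) _

theorem rawWeight_pos {ε : CascadeNoise} (hε : ∀ b, 0 < ε b) (α : Leaf ζ.r) :
    0 < ζ.rawWeight ε α :=
  Finset.prod_pos fun _ _ => stablePoint_pos (fun _ => hε _) _

theorem treeSum_nodeData {S X : Type*} {n : ℕ} (ψ : S → ℝ≥0∞)
    (step : ℕ → S → (Fin n → X) → S) (s : S) (ω : CascadeNoise × (Fin n × List ℕ → X))
    (hε : ∀ b, 0 < ω.1 b) :
    treeSum ψ ζ.r (param ζ) step s (nodeData ω) = ∑' α : Leaf ζ.r,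
      ENNReal.ofReal (ζ.rawWeight ω.1 α) *
        ψ (pathState step s (fun b i => ω.2 (i, b)) α ζ.r) := by
  rw [treeSum_eq_tsum]
  refine tsum_congr fun α => ?_
  congr 1
  exact (ENNReal.ofReal_prod_of_nonneg fun p _ => (stablePoint_pos (fun _ => hε _) _).le).symm

theorem ae_cascadeLaw_pos : ∀ᵐ ε ∂cascadeLaw, ∀ b, 0 < ε b := by
  rw [ae_all_iff]
  intro b
  have h := (measurePreserving_eval_infinitePi (fun _ : List ℕ × ℕ => expMeasure 1)
    b).quasiMeasurePreserving.ae ae_expMeasure_pos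
  exact h

theorem ae_cascadeLaw_of_prod {n : ℕ} {X : Type*} [MeasurableSpace X] {μ : Measure X}
    [IsProbabilityMeasure μ] {P : CascadeNoise → Prop} (h : ∀ᵐ ω ∂(cascadeLaw.prod
      (Measure.infinitePi fun _ : Fin n × List ℕ => μ)), P ω.1) : ∀ᵐ ε ∂cascadeLaw, P ε :=
  (Measure.ae_ae_of_ae_prod h).mono fun _ h => h.exists.choose_spec

theorem ae_prod_of_cascadeLaw {X : Type*} [MeasurableSpace X] {μ : Measure X} [SFinite μ]
    {P : CascadeNoise → Prop} (h : ∀ᵐ ε ∂cascadeLaw, P ε) :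
    ∀ᵐ ω ∂(cascadeLaw.prod μ), P ω.1 :=
  Measure.quasiMeasurePreserving_fst.ae h

/-- The unnormalised weights of the cascade are almost surely summable. -/
theorem ae_tsum_rawWeight_lt_top :
    ∀ᵐ ε ∂cascadeLaw, ∑' α, ENNReal.ofReal (ζ.rawWeight ε α) < ⊤ := by
  -- No field is involved: with no labels and a trivial state, the leaf sum is the total mass of the
  -- cascade.
  refine ae_cascadeLaw_of_prod (n := 0) (μ := gaussianReal 0 1) ?_
  have h := ae_treeSum_one_lt_top (ν := Measure.infinitePi fun _ : Fin 0 => gaussianReal 0 1)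
    (param_mem ζ) (param_lt ζ) (step := fun _ (_ : Unit) _ => ()) (fun _ => measurable_const) ()
  rw [← map_nodeData] at h
  filter_upwards [ae_of_ae_map measurable_nodeData.aemeasurable h,
    ae_prod_of_cascadeLaw ae_cascadeLaw_pos] with ω h1 h2
  rw [treeSum_nodeData ζ _ _ _ ω h2] at h1
  simpa using h1

theorem ae_rawWeight : ∀ᵐ ε ∂cascadeLaw, (∀ α, 0 < ζ.rawWeight ε α) ∧
    (Summable fun α : Leaf ζ.r => ζ.rawWeight ε α) ∧ 0 < ∑' γ : Leaf ζ.r, ζ.rawWeight ε γ := by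
  filter_upwards [ae_cascadeLaw_pos, ae_tsum_rawWeight_lt_top ζ] with ε h1 h2
  have hpos := rawWeight_pos ζ h1
  have hs : Summable fun α : Leaf ζ.r => ζ.rawWeight ε α := by
    have := ENNReal.summable_toReal h2.ne
    simpa [ENNReal.toReal_ofReal (hpos _).le] using this
  exact ⟨hpos, hs, hs.tsum_pos (fun α => (hpos α).le) 0 (hpos 0)⟩

theorem ae_weight : ∀ᵐ ε ∂cascadeLaw, (∀ α, 0 ≤ ζ.weight ε α) ∧ HasSum (ζ.weight ε) 1 := by
  filter_upwards [ae_rawWeight ζ] with ε ⟨h1, h2, h3⟩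
  refine ⟨fun α => div_nonneg (h1 α).le h3.le, ?_⟩
  have := h2.hasSum.div_const (∑' γ : Leaf ζ.r, ζ.rawWeight ε γ)
  rwa [div_self h3.ne'] at this

theorem measurable_rawWeight (α : Leaf ζ.r) : Measurable fun ε => ζ.rawWeight ε α := by
  unfold FiniteRSB.rawWeight poissonPoint
  fun_prop

theorem measurable_weight (α : Leaf ζ.r) : Measurable fun ε => ζ.weight ε α :=
  (measurable_rawWeight ζ α).div (Measurable.tsum fun γ => measurable_rawWeight ζ γ)

variable {ζ} {β : ℕ → ℝ} {n : ℕ}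

theorem measurable_cavityField (i : Fin n) (α : Leaf ζ.r) :
    Measurable fun g : FieldNoise n => cavityField ζ β g i α := by
  unfold cavityField
  fun_prop

theorem measurable_cascadeSum {A : Fin n → ℝ → ℝ} (hA : ∀ i, Measurable (A i)) :
    Measurable (cascadeSum ζ β A) :=
  Measurable.tsum fun α => ((measurable_weight ζ α).comp measurable_fst).mul
    (Finset.measurable_prod _ fun i _ =>
      (hA i).comp ((measurable_cavityField i α).comp measurable_snd))

theorem measurable_replicaRatio {k : ℕ} {A : Fin k → Fin n → ℝ → ℝ} {B : ℝ → ℝ}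
    (hA : ∀ l i, Measurable (A l i)) (hB : Measurable B) : Measurable (replicaRatio ζ β A B) :=
  Finset.measurable_prod _ fun l _ =>
    (measurable_cascadeSum (hA l)).div (measurable_cascadeSum fun _ => hB)

/-- `E ∑_α w_α ∏_i exp(Z^i(h_α)²)` is bounded uniformly in `ζ`. -/
theorem lintegral_squareSum_le (hβ : ∀ p : ℕ, 2 ≤ p → |β p| ≤ 1 / (p : ℝ) ^ 2) :
    ∫⁻ ω, ∑' α : Leaf ζ.r, ENNReal.ofReal (ζ.weight ω.1 α) *
        ∏ i, ENNReal.ofReal (Real.exp (cavityField ζ β ω.2 i α ^ 2)) ∂(cavityLaw n) ≤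
      ENNReal.ofReal ((√(1 / 2))⁻¹) ^ n := by
  have hw : ∀ α, Measurable fun ε => ENNReal.ofReal (ζ.weight ε α) := fun α =>
    (measurable_weight ζ α).ennreal_ofReal
  have hx : ∀ α : Leaf ζ.r, Measurable fun g : FieldNoise n =>
      ∏ i, ENNReal.ofReal (Real.exp (cavityField ζ β g i α ^ 2)) := fun α => by
    have := measurable_cavityField (ζ := ζ) (β := β) (n := n)
    fun_prop
  have hwx : ∀ α : Leaf ζ.r, Measurable fun ω : CascadeNoise × FieldNoise n =>
      ENNReal.ofReal (ζ.weight ω.1 α) *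
        ∏ i, ENNReal.ofReal (Real.exp (cavityField ζ β ω.2 i α ^ 2)) := fun α =>
    ((hw α).comp measurable_fst).mul ((hx α).comp measurable_snd)
  rw [lintegral_tsum fun α => (hwx α).aemeasurable]
  have h1 : ∀ α : Leaf ζ.r, ∫⁻ ω, ENNReal.ofReal (ζ.weight ω.1 α) *
      ∏ i, ENNReal.ofReal (Real.exp (cavityField ζ β ω.2 i α ^ 2)) ∂(cavityLaw n) ≤
      (∫⁻ ε, ENNReal.ofReal (ζ.weight ε α) ∂cascadeLaw) *
        ENNReal.ofReal ((√(1 / 2))⁻¹) ^ n := fun α => by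
    rw [cavityLaw, lintegral_prod_mul (hw α).aemeasurable (hx α).aemeasurable]
    gcongr
    exact lintegral_prod_exp_sq_cavityField_le ζ hβ α
  refine (ENNReal.tsum_le_tsum h1).trans ?_
  rw [ENNReal.tsum_mul_right, ← lintegral_tsum fun α => (hw α).aemeasurable]
  -- By independence each leaf contributes its mean weight times a bound common to all leaves, and
  -- the weights sum to one.
  have h2 : ∫⁻ ε, ∑' α, ENNReal.ofReal (ζ.weight ε α) ∂cascadeLaw = 1 := by
    rw [lintegral_congr_ae (g := fun _ => 1) ?_]
    · simp
    · filter_upwards [ae_weight ζ] with ε ⟨h3, h4⟩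
      rw [← ENNReal.ofReal_tsum_of_nonneg h3 h4.summable, h4.tsum_eq, ENNReal.ofReal_one]
  rw [h2, one_mul]

end Cascade


/-! ### Integrability and removal of the cutoff -/

section Cutoff

variable {ζ : FiniteRSB} {β : ℕ → ℝ} {k n : ℕ}

theorem measurable_momentOn (a : ℝ) (I : Set ℝ) (d : ℕ) : Measurable (momentOn a I d) := by
  have h : StronglyMeasurable (Function.uncurry fun x s : ℝ =>
      s ^ d * Real.exp (-(1 / 2) * a * s ^ 2 + x * s)) :=
    Continuous.stronglyMeasurable (by fun_prop)
  exact h.integral_prod_right.measurable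

variable (ζ β) in
/-- `∑_α w_α ∏_i exp(Z^i(h_α)²)`. -/
def cavitySquare (ω : CascadeNoise × FieldNoise n) : ℝ :=
  squareSum (ζ.weight ω.1) fun i α => cavityField ζ β ω.2 i α

theorem ae_cavity (hβ : ∀ p : ℕ, 2 ≤ p → |β p| ≤ 1 / (p : ℝ) ^ 2) :
    ∀ᵐ ω ∂(cavityLaw n), (∀ α, 0 ≤ ζ.weight ω.1 α) ∧ HasSum (ζ.weight ω.1) 1 ∧
      Summable fun α => ζ.weight ω.1 α * ∏ i, Real.exp (cavityField ζ β ω.2 i α ^ 2) := by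
  have hm : Measurable fun ω : CascadeNoise × FieldNoise n => ∑' α : Leaf ζ.r,
      ENNReal.ofReal (ζ.weight ω.1 α) *
        ∏ i, ENNReal.ofReal (Real.exp (cavityField ζ β ω.2 i α ^ 2)) :=
    Measurable.tsum fun α => ((measurable_weight ζ α).comp measurable_fst).ennreal_ofReal.mul
      (Finset.measurable_prod _ fun i _ =>
        (((measurable_cavityField i α).comp measurable_snd).pow_const 2).exp.ennreal_ofReal)
  have hfin := ae_lt_top hm ((lintegral_squareSum_le (ζ := ζ) (n := n) hβ).trans_lt
    (ENNReal.pow_lt_top ENNReal.ofReal_lt_top)).ne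
  filter_upwards [hfin, ae_prod_of_cascadeLaw (ae_weight ζ)] with ω h1 ⟨h2, h3⟩
  refine ⟨h2, h3, ?_⟩
  have := ENNReal.summable_toReal h1.ne
  simpa [ENNReal.toReal_mul, ENNReal.toReal_ofReal (h2 _), ENNReal.toReal_prod,
    ENNReal.toReal_ofReal (Real.exp_pos _).le] using this

theorem measurable_cavitySquare : Measurable (cavitySquare (n := n) ζ β) :=
  measurable_cascadeSum (A := fun _ x => Real.exp (x ^ 2)) fun _ => by fun_prop

theorem lintegral_cavitySquare_le (hβ : ∀ p : ℕ, 2 ≤ p → |β p| ≤ 1 / (p : ℝ) ^ 2) :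
    ∫⁻ ω, ENNReal.ofReal (cavitySquare ζ β ω) ∂(cavityLaw n) ≤
      ENNReal.ofReal ((√(1 / 2))⁻¹) ^ n := by
  refine le_trans (le_of_eq (lintegral_congr_ae ?_)) (lintegral_squareSum_le (ζ := ζ) hβ)
  filter_upwards [ae_cavity (ζ := ζ) hβ] with ω ⟨h1, _, h3⟩
  rw [cavitySquare, squareSum, ENNReal.ofReal_tsum_of_nonneg
    (fun α => mul_nonneg (h1 α) (Finset.prod_nonneg fun i _ => (Real.exp_pos _).le)) h3]
  refine tsum_congr fun α => ?_
  rw [ENNReal.ofReal_mul (h1 α), ENNReal.ofReal_prod_of_nonneg fun i _ => (Real.exp_pos _).le]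

theorem one_le_cavitySquare (hβ : ∀ p : ℕ, 2 ≤ p → |β p| ≤ 1 / (p : ℝ) ^ 2) :
    ∀ᵐ ω ∂(cavityLaw n), 1 ≤ cavitySquare ζ β ω := by
  filter_upwards [ae_cavity (ζ := ζ) hβ] with ω ⟨h1, h2, h3⟩
  exact one_le_squareSum h1 h2 h3

theorem integrable_cavitySquare (hβ : ∀ p : ℕ, 2 ≤ p → |β p| ≤ 1 / (p : ℝ) ^ 2) :
    Integrable (cavitySquare (n := n) ζ β) (cavityLaw n) := by
  refine ⟨measurable_cavitySquare.aestronglyMeasurable, ?_⟩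
  rw [hasFiniteIntegral_iff_ofReal
    ((one_le_cavitySquare hβ).mono fun ω h => zero_le_one.trans h)]
  exact (lintegral_cavitySquare_le hβ).trans_lt (ENNReal.pow_lt_top ENNReal.ofReal_lt_top)

theorem integral_cavitySquare_le (hβ : ∀ p : ℕ, 2 ≤ p → |β p| ≤ 1 / (p : ℝ) ^ 2) :
    ∫ ω, cavitySquare ζ β ω ∂(cavityLaw n) ≤ ((√(1 / 2))⁻¹) ^ n := by
  rw [integral_eq_lintegral_of_nonneg_ae
    ((one_le_cavitySquare hβ).mono fun ω h => zero_le_one.trans h)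
    measurable_cavitySquare.aestronglyMeasurable]
  refine ENNReal.toReal_le_of_le_ofReal (by positivity) ?_
  rw [ENNReal.ofReal_pow (by positivity)]
  exact lintegral_cavitySquare_le hβ

variable (ζ β) in
/-- The coefficient `1 + Ŝ_ζ` of the Gaussian weights. -/
def gaussCoeff : ℝ := 1 + ζ.Shat β

theorem one_le_gaussCoeff (hβ : ∀ p : ℕ, 2 ≤ p → |β p| ≤ 1 / (p : ℝ) ^ 2) :
    1 ≤ gaussCoeff ζ β := by
  have := ζ.Shat_nonneg hβ
  rw [gaussCoeff]
  linarith

theorem gaussCoeff_le (hβ : ∀ p : ℕ, 2 ≤ p → |β p| ≤ 1 / (p : ℝ) ^ 2) :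
    gaussCoeff ζ β ≤ 2 := by
  have := ζ.Shat_le hβ
  rw [gaussCoeff]
  linarith

theorem cutMoment_eq {C : ℝ} (hC : 0 ≤ C) (d : ℕ) :
    cutMoment ζ β C d = momentOn (gaussCoeff ζ β) (Set.Ioc (-C) C) d := by
  funext x
  rw [cutMoment, momentOn, intervalIntegral.integral_of_le (by linarith)]
  rfl

theorem fullMoment_eq (d : ℕ) :
    fullMoment ζ β d = momentOn (gaussCoeff ζ β) Set.univ d := by
  funext x
  rw [fullMoment, momentOn, Measure.restrict_univ]
  rfl

theorem replicaRatio_momentOn (a : ℝ) (I : Set ℝ) (e : Fin k → Fin n → ℕ)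
    (ω : CascadeNoise × FieldNoise n) :
    replicaRatio ζ β (fun l i => momentOn a I (e l i)) (momentOn a I 0) ω =
      ∏ l, gibbsSum (ζ.weight ω.1) (fun i α => cavityField ζ β ω.2 i α) a I (e l) /
        gibbsSum (ζ.weight ω.1) (fun i α => cavityField ζ β ω.2 i α) a I 0 := rfl

theorem ratioWellDefined_momentOn (hβ : ∀ p : ℕ, 2 ≤ p → |β p| ≤ 1 / (p : ℝ) ^ 2)
    (e : Fin k → Fin n → ℕ) {I : Set ℝ} {c : ℝ} (hc : 0 < c) (hc1 : c ≤ 1)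
    (hcI : ∀ y, c ≤ momentOn (gaussCoeff ζ β) I 0 y) :
    RatioWellDefined ζ β (fun l i => momentOn (gaussCoeff ζ β) I (e l i))
      (momentOn (gaussCoeff ζ β) I 0) := by
  have ha := one_le_gaussCoeff (ζ := ζ) hβ
  constructor
  · filter_upwards [ae_cavity (ζ := ζ) hβ] with ω ⟨h1, h2, h3⟩
    exact ⟨fun l => summable_gibbs h1 h3 ha I (e l), summable_gibbs h1 h3 ha I 0,
      (pow_pos hc n).trans_le (le_gibbsSum_zero h1 h2 h3 ha hc hcI)⟩
  · refine ((integrable_cavitySquare (ζ := ζ) hβ).const_mul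
      ((momentBound e / c) ^ n)).mono' (measurable_replicaRatio
        (fun l i => measurable_momentOn _ _ _) (measurable_momentOn _ _ _)).aestronglyMeasurable ?_
    filter_upwards [ae_cavity (ζ := ζ) hβ] with ω ⟨h1, h2, h3⟩
    rw [replicaRatio_momentOn]
    exact abs_prod_gibbs_le h1 h2 h3 ha hc hc1 hcI e

/-- A lower bound for all the Gaussian integrals over intervals containing `(-1, 1]`. -/
def unitMass : ℝ := 2 * Real.exp (-1)

theorem unitMass_pos : 0 < unitMass := by
  unfold unitMass
  positivity

theorem unitMass_le_one : unitMass ≤ 1 := by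
  have h : 2 ≤ Real.exp 1 := by linarith [Real.add_one_le_exp (1 : ℝ)]
  rw [unitMass, Real.exp_neg, ← div_eq_mul_inv]
  exact (div_le_one (Real.exp_pos 1)).2 h

theorem unitMass_le_momentOn {a : ℝ} (ha : 1 ≤ a) (ha2 : a ≤ 2) {I : Set ℝ}
    (hI : Set.Ioc (-1) 1 ⊆ I) (y : ℝ) : unitMass ≤ momentOn a I 0 y := by
  have := momentOn_zero_ge ha ha2 one_pos hI y
  simpa [unitMass] using this

theorem ratioWellDefined_cutMoment (hβ : ∀ p : ℕ, 2 ≤ p → |β p| ≤ 1 / (p : ℝ) ^ 2)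
    (e : Fin k → Fin n → ℕ) {C : ℝ} (hC : 0 < C) :
    RatioWellDefined ζ β (fun l i => cutMoment ζ β C (e l i)) (cutMoment ζ β C 0) := by
  simp_rw [cutMoment_eq hC.le]
  -- For one fixed C the lower bound may depend on C; only the uniform estimate, for C ≥ 1, needs
  -- `unitMass`.
  exact ratioWellDefined_momentOn hβ e (c := min (2 * C * Real.exp (-C ^ 2)) 1)
    (lt_min (by positivity) one_pos) (min_le_right _ _) fun y => (min_le_left _ _).trans
      (momentOn_zero_ge (one_le_gaussCoeff hβ) (gaussCoeff_le hβ) hC subset_rfl y)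

theorem ratioWellDefined_fullMoment (hβ : ∀ p : ℕ, 2 ≤ p → |β p| ≤ 1 / (p : ℝ) ^ 2)
    (e : Fin k → Fin n → ℕ) :
    RatioWellDefined ζ β (fun l i => fullMoment ζ β (e l i)) (fullMoment ζ β 0) := by
  simp_rw [fullMoment_eq]
  exact ratioWellDefined_momentOn hβ e unitMass_pos unitMass_le_one
    (unitMass_le_momentOn (one_le_gaussCoeff hβ) (gaussCoeff_le hβ) (Set.subset_univ _))

/-- Uniform bound for the effect of the cutoff. -/
def cutoffError (e : Fin k → Fin n → ℕ) (C : ℝ) : ℝ :=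
  2 * k * √(n * tailBound e C * (momentBound e / unitMass) ^ n) *
    ((momentBound e / unitMass) ^ n * (√(1 / 2))⁻¹ ^ n)

theorem tendsto_cutoffError (e : Fin k → Fin n → ℕ) : Tendsto (cutoffError e) atTop (𝓝 0) := by
  have h := ((((tendsto_tailBound e).const_mul (n : ℝ)).mul_const
    ((momentBound e / unitMass) ^ n)).sqrt.const_mul (2 * (k : ℝ))).mul_const
    ((momentBound e / unitMass) ^ n * (√(1 / 2))⁻¹ ^ n)
  simp only [mul_zero, zero_mul, Real.sqrt_zero] at h
  exact h

/-- The pointwise estimate has a deterministic factor times `cavitySquare`, whose mean is at most √2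
to the power n. As C ≥ 1, both denominators are controlled by the integral over (-1, 1], so no
constant depends on ζ. -/
theorem abs_cutoffExpectation_sub_le (hβ : ∀ p : ℕ, 2 ≤ p → |β p| ≤ 1 / (p : ℝ) ^ 2)
    (e : Fin k → Fin n → ℕ) {C : ℝ} (hC : 1 ≤ C) :
    |cutoffExpectation ζ β e C - fullExpectation ζ β e| ≤ cutoffError e C := by
  have ha := one_le_gaussCoeff (ζ := ζ) hβ
  have ha2 := gaussCoeff_le (ζ := ζ) hβ
  have hI1 := (ratioWellDefined_cutMoment (ζ := ζ) hβ e (by linarith : 0 < C)).2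
  have hI2 := (ratioWellDefined_fullMoment (ζ := ζ) hβ e).2
  have h1 := one_le_momentBound e
  have hu := unitMass_pos
  have hsub : Set.Ioc (-1 : ℝ) 1 ⊆ Set.Ioc (-C) C := Set.Ioc_subset_Ioc (by linarith) hC
  rw [cutoffExpectation, fullExpectation, ← integral_sub hI1 hI2, ← Real.norm_eq_abs]
  have hbound := norm_integral_le_of_norm_le
    (((integrable_cavitySquare (n := n) (ζ := ζ) hβ).const_mul
      ((momentBound e / unitMass) ^ n)).const_mul
        (2 * k * √(n * tailBound e C * (momentBound e / unitMass) ^ n)))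
    (f := fun ω => replicaRatio ζ β (fun l i => cutMoment ζ β C (e l i)) (cutMoment ζ β C 0) ω -
      replicaRatio ζ β (fun l i => fullMoment ζ β (e l i)) (fullMoment ζ β 0) ω) (by
      simp_rw [cutMoment_eq (zero_le_one.trans hC), fullMoment_eq]
      filter_upwards [ae_cavity (ζ := ζ) hβ] with ω ⟨h1, h2, h3⟩
      rw [replicaRatio_momentOn, replicaRatio_momentOn]
      exact abs_prod_gibbs_sub_le h1 h2 h3 ha hu unitMass_le_one
        (unitMass_le_momentOn ha ha2 hsub) (unitMass_le_momentOn ha ha2 (Set.subset_univ _)) e)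
  refine hbound.trans ?_
  rw [integral_const_mul, integral_const_mul, cutoffError]
  gcongr
  exact integral_cavitySquare_le hβ

end Cutoff

/-! ### Integrating out the spins -/

section Spin

variable {ζ : FiniteRSB} {β : ℕ → ℝ} {k n : ℕ}

/-- The spin measure has a Gaussian density. -/
theorem rho_eq (hβ : ∀ p : ℕ, 2 ≤ p → |β p| ≤ 1 / (p : ℝ) ^ 2) (x : ℝ) (d : ℕ) :
    ζ.rho β x (fun s => s ^ d) = fullMoment ζ β d x / fullMoment ζ β 0 x := by
  have hv : (((xiD β 1 - xiD β ζ.qStar).toNNReal : NNReal) : ℝ) = xiD β 1 - xiD β ζ.qStar :=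
    Real.coe_toNNReal _ (sub_nonneg.2 (ζ.xiD_qStar_le hβ))
  -- The Gaussian moment generating function adds half the variance times s² to the exponent,
  -- turning S into Ŝ; variance zero needs no separate treatment.
  have key : ∀ c s : ℝ, ∫ y, c * Real.exp (-((1 + ζ.S β) / 2) * s ^ 2) * Real.exp (s * y)
      ∂(gaussianReal x (xiD β 1 - xiD β ζ.qStar).toNNReal) =
      c * Real.exp (-(1 / 2) * (1 + ζ.Shat β) * s ^ 2 + x * s) := fun c s => by
    have h := mgf_gaussianReal (p := gaussianReal x (xiD β 1 - xiD β ζ.qStar).toNNReal)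
      (X := id) Measure.map_id s
    rw [mgf] at h
    simp only [id] at h
    rw [integral_const_mul, h, hv, mul_assoc, ← Real.exp_add, ζ.S_eq_Shat hβ]
    ring_nf
  have key1 := fun s => key 1 s
  simp only [one_mul] at key1
  rw [FiniteRSB.rho, fullMoment, fullMoment]
  simp_rw [key, key1, pow_zero, one_mul]

theorem fullMoment_zero_eq (hβ : ∀ p : ℕ, 2 ≤ p → |β p| ≤ 1 / (p : ℝ) ^ 2) (x : ℝ) :
    fullMoment ζ β 0 x = √(2 * Real.pi / gaussCoeff ζ β) * gaussTilt ζ β x := by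
  have ha := one_le_gaussCoeff (ζ := ζ) hβ
  have ha0 : 0 < gaussCoeff ζ β := by linarith
  have hpt : ∀ s : ℝ, s ^ 0 * Real.exp (-(1 / 2) * (1 + ζ.Shat β) * s ^ 2 + x * s) =
      gaussTilt ζ β x * Real.exp (-(gaussCoeff ζ β / 2) * (s - x / gaussCoeff ζ β) ^ 2) :=
    fun s => by
      change s ^ 0 * Real.exp (-(1 / 2) * gaussCoeff ζ β * s ^ 2 + x * s) =
        Real.exp (x ^ 2 / (2 * gaussCoeff ζ β)) * _
      rw [pow_zero, one_mul, ← Real.exp_add]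
      congr 1
      field_simp
      ring
  rw [fullMoment]
  simp_rw [hpt]
  rw [integral_const_mul, integral_sub_right_eq_self
    (fun s => Real.exp (-(gaussCoeff ζ β / 2) * s ^ 2)), integral_gaussian, mul_comm]
  congr 2
  field_simp

variable (ζ β) in
/-- The inverse of the mass of the Gaussian weight. -/
def invMass : ℝ := (√(2 * Real.pi / gaussCoeff ζ β))⁻¹

theorem invMass_pos (hβ : ∀ p : ℕ, 2 ≤ p → |β p| ≤ 1 / (p : ℝ) ^ 2) : 0 < invMass ζ β := by
  have ha := one_le_gaussCoeff (ζ := ζ) hβ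
  unfold invMass
  positivity

theorem gaussTilt_eq (hβ : ∀ p : ℕ, 2 ≤ p → |β p| ≤ 1 / (p : ℝ) ^ 2) (x : ℝ) :
    gaussTilt ζ β x = invMass ζ β * fullMoment ζ β 0 x := by
  have h := (invMass_pos (ζ := ζ) hβ).ne'
  rw [invMass] at h ⊢
  rw [fullMoment_zero_eq hβ, inv_mul_cancel_left₀ fun h0 => h (by rw [h0, inv_zero])]

theorem rhoMoment_eq (hβ : ∀ p : ℕ, 2 ≤ p → |β p| ≤ 1 / (p : ℝ) ^ 2) (d : ℕ) (x : ℝ) :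
    rhoMoment ζ β d x = invMass ζ β * fullMoment ζ β d x := by
  have h : fullMoment ζ β 0 x ≠ 0 := by
    have := (Real.exp_pos (x ^ 2 / (2 * (1 + ζ.Shat β)))).ne'
    rw [← gaussTilt, gaussTilt_eq hβ] at this
    exact right_ne_zero_of_mul this
  rw [rhoMoment, rho_eq hβ, gaussTilt_eq hβ]
  field_simp

theorem cascadeSum_const_mul (c : ℝ) (A : Fin n → ℝ → ℝ) (ω : CascadeNoise × FieldNoise n) :
    cascadeSum ζ β (fun i x => c * A i x) ω = c ^ n * cascadeSum ζ β A ω := by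
  rw [cascadeSum, cascadeSum, ← tsum_mul_left]
  refine tsum_congr fun α => ?_
  rw [Finset.prod_mul_distrib, Finset.prod_const, Finset.card_univ, Fintype.card_fin]
  ring

/-- Numerator and denominator each contain one factor per field, so both acquire c^n. This removes
the mass √(2π/(1+Ŝ)) of the Gaussian weight. -/
theorem replicaRatio_const_mul {c : ℝ} (hc : c ≠ 0) (A : Fin k → Fin n → ℝ → ℝ) (B : ℝ → ℝ) :
    replicaRatio ζ β (fun l i x => c * A l i x) (fun x => c * B x) = replicaRatio ζ β A B := by
  funext ω
  rw [replicaRatio, replicaRatio]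
  refine Finset.prod_congr rfl fun l _ => ?_
  rw [cascadeSum_const_mul, cascadeSum_const_mul c fun _ => B,
    mul_div_mul_left _ _ (pow_ne_zero n hc)]

theorem RatioWellDefined.const_mul {c : ℝ} (hc : 0 < c) {A : Fin k → Fin n → ℝ → ℝ} {B : ℝ → ℝ}
    (h : RatioWellDefined ζ β A B) :
    RatioWellDefined ζ β (fun l i x => c * A l i x) (fun x => c * B x) := by
  have hs : ∀ (A : Fin n → ℝ → ℝ) (ω : CascadeNoise × FieldNoise n),
      (Summable fun α : Leaf ζ.r => ζ.weight ω.1 α * ∏ i, A i (cavityField ζ β ω.2 i α)) →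
      Summable fun α : Leaf ζ.r => ζ.weight ω.1 α * ∏ i, c * A i (cavityField ζ β ω.2 i α) :=
    fun A ω h => (h.mul_left (c ^ n)).congr fun α => by
      rw [Finset.prod_mul_distrib, Finset.prod_const, Finset.card_univ, Fintype.card_fin]
      ring
  refine ⟨?_, by rw [replicaRatio_const_mul hc.ne']; exact h.2⟩
  filter_upwards [h.1] with ω ⟨h1, h2, h3⟩
  refine ⟨fun l => hs _ ω (h1 l), hs (fun _ => B) ω h2, ?_⟩
  rw [cascadeSum_const_mul c fun _ => B]
  positivity

theorem ratioWellDefined_rhoMoment (hβ : ∀ p : ℕ, 2 ≤ p → |β p| ≤ 1 / (p : ℝ) ^ 2)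
    (e : Fin k → Fin n → ℕ) :
    RatioWellDefined ζ β (fun l i => rhoMoment ζ β (e l i)) (gaussTilt ζ β) := by
  have h1 : gaussTilt ζ β = fun x => invMass ζ β * fullMoment ζ β 0 x :=
    funext (gaussTilt_eq hβ)
  have h2 : ∀ d, rhoMoment ζ β d = fun x => invMass ζ β * fullMoment ζ β d x := fun d =>
    funext (rhoMoment_eq hβ d)
  simp_rw [h2]
  rw [h1]
  exact (ratioWellDefined_fullMoment hβ e).const_mul (invMass_pos hβ)

theorem fullExpectation_eq_rhoExpectation (hβ : ∀ p : ℕ, 2 ≤ p → |β p| ≤ 1 / (p : ℝ) ^ 2)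
    (e : Fin k → Fin n → ℕ) : fullExpectation ζ β e = rhoExpectation ζ β e := by
  have h1 : gaussTilt ζ β = fun x => invMass ζ β * fullMoment ζ β 0 x :=
    funext (gaussTilt_eq hβ)
  have h2 : ∀ d, rhoMoment ζ β d = fun x => invMass ζ β * fullMoment ζ β d x := fun d =>
    funext (rhoMoment_eq hβ d)
  rw [fullExpectation, rhoExpectation]
  simp_rw [h2]
  rw [h1, replicaRatio_const_mul (invMass_pos hβ).ne']

end Spin


/-! ### Signed series through their positive and negative parts -/

section SignedSums

theorem hasSum_of_tsum_ofReal_lt_top {α : Type*} {g : α → ℝ} (h1 : ∑' j, ENNReal.ofReal (g j) < ⊤)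
    (h2 : ∑' j, ENNReal.ofReal (-g j) < ⊤) :
    HasSum g ((∑' j, ENNReal.ofReal (g j)).toReal - (∑' j, ENNReal.ofReal (-g j)).toReal) := by
  have e : g = fun j => (ENNReal.ofReal (g j)).toReal - (ENNReal.ofReal (-g j)).toReal :=
    funext fun j => by
      rcases le_total 0 (g j) with h | h
      · rw [ENNReal.toReal_ofReal h, ENNReal.ofReal_of_nonpos (by linarith), ENNReal.toReal_zero,
          sub_zero]
      · rw [ENNReal.toReal_ofReal (by linarith : 0 ≤ -g j), ENNReal.ofReal_of_nonpos h,
          ENNReal.toReal_zero]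
        ring
  have h := (ENNReal.hasSum_toReal h1.ne).sub (ENNReal.hasSum_toReal h2.ne)
  rwa [← e, ← ENNReal.tsum_toReal_eq fun _ => ENNReal.ofReal_ne_top,
    ← ENNReal.tsum_toReal_eq fun _ => ENNReal.ofReal_ne_top] at h

end SignedSums

/-! ### Cavity and tilted fields as tree sums -/

section TreeFields

variable (ζ : FiniteRSB) (β : ℕ → ℝ) {n : ℕ}

/-- The increments of the cavity fields at the root. -/
def gaussRoot (g : Fin n → ℝ) : Fin n → ℝ := fun i => √(ζ.incVar β 0) * g i

/-- The increments of the tilted fields at the root. -/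
def tiltRoot (u : Fin n → unitInterval) : Fin n → ℝ :=
  fun i => openQuantile (gaussianReal 0 (ζ.incVar β 0).toNNReal) (u i)

/-- Sum over the leaves of the unnormalised weights, tilted by the exponentials of the potentials
of the cavity fields. -/
def gaussTree (ψ : (Fin n → ℝ) → ℝ≥0∞) (ω : List ℕ → (ℕ → ℝ) × (Fin n → ℝ)) : ℝ≥0∞ :=
  treeSum (fun s => levelWeight ζ β ζ.r s * ψ s) ζ.r (param ζ) (gaussStep ζ β)
    (gaussRoot ζ β (ω []).2) ω

/-- Sum over the leaves of the unnormalised weights, for the tilted fields. -/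
def tiltTree (ψ : (Fin n → ℝ) → ℝ≥0∞) (ω : List ℕ → (ℕ → ℝ) × (Fin n → unitInterval)) : ℝ≥0∞ :=
  treeSum ψ ζ.r (param ζ) (tiltStep ζ β) (tiltRoot ζ β (ω []).2) ω

variable {ζ β}

theorem measurable_gaussRoot : Measurable (gaussRoot (n := n) ζ β) := by
  unfold gaussRoot
  fun_prop

theorem measurable_tiltRoot : Measurable (tiltRoot (n := n) ζ β) := by
  have h : Measurable (openQuantile (gaussianReal 0 (ζ.incVar β 0).toNNReal)) :=
    (measurable_openQuantile (T := Unit) (κ := fun _ => gaussianReal 0 (ζ.incVar β 0).toNNReal)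
      fun t => measurable_const).comp (measurable_const (a := ()) |>.prodMk measurable_id)
  exact measurable_pi_iff.2 fun i => h.comp (measurable_pi_apply i)

/-- The root increment is common to all leaves and keeps its Gaussian law under the tilt; only the
two ways of sampling it differ. -/
theorem map_gaussRoot (hβ : ∀ p : ℕ, 2 ≤ p → |β p| ≤ 1 / (p : ℝ) ^ 2) :
    (Measure.infinitePi fun _ : Fin n => gaussianReal 0 1).map (gaussRoot ζ β) =
      (Measure.infinitePi fun _ : Fin n => (volume : Measure unitInterval)).map
        (tiltRoot ζ β) := by
  have h : Measurable (openQuantile (gaussianReal 0 (ζ.incVar β 0).toNNReal)) :=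
    (measurable_openQuantile (T := Unit) (κ := fun _ => gaussianReal 0 (ζ.incVar β 0).toNNReal)
      fun t => measurable_const).comp (measurable_const (a := ()) |>.prodMk measurable_id)
  have h1 := map_gauss_increments (n := n) (ζ := ζ) hβ ζ.r.zero_le
  have h2 := Measure.infinitePi_map_pi (fun _ : Fin n => (volume : Measure unitInterval))
    (f := fun _ => openQuantile (gaussianReal 0 (ζ.incVar β 0).toNNReal)) fun _ => h
  simp_rw [map_openQuantile] at h2
  exact h1.trans h2.symm

theorem measurable_gaussTree (hβ : ∀ p : ℕ, 2 ≤ p → |β p| ≤ 1 / (p : ℝ) ^ 2)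
    {ψ : (Fin n → ℝ) → ℝ≥0∞} (hψ : Measurable ψ) : Measurable (gaussTree ζ β ψ) :=
  (measurable_treeSum ((measurable_levelWeight hβ ζ.r).mul hψ) ζ.r (param ζ)
    measurable_gaussStep).comp ((measurable_gaussRoot.comp
      (measurable_snd.comp (measurable_pi_apply []))).prodMk measurable_id)

theorem measurable_tiltTree (hβ : ∀ p : ℕ, 2 ≤ p → |β p| ≤ 1 / (p : ℝ) ^ 2)
    {ψ : (Fin n → ℝ) → ℝ≥0∞} (hψ : Measurable ψ) : Measurable (tiltTree ζ β ψ) :=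
  (measurable_treeSum hψ ζ.r (param ζ) (measurable_tiltStep hβ)).comp ((measurable_tiltRoot.comp
    (measurable_snd.comp (measurable_pi_apply []))).prodMk measurable_id)

/-- Tilting the weights of the cascade amounts to tilting the fields, as far as quantities that are
homogeneous of degree zero in the weights are concerned. -/
theorem map_gaussTree_eq_map_tiltTree (hβ : ∀ p : ℕ, 2 ≤ p → |β p| ≤ 1 / (p : ℝ) ^ 2)
    {ι X : Type*} [Fintype ι] [MeasurableSpace X] {Φ : (ι → ℝ≥0∞) → X} (hΦ : Measurable Φ)
    (hhom : ∀ c v, c ≠ 0 → c ≠ ⊤ → Φ (fun i => c * v i) = Φ v)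
    {ψ : ι → (Fin n → ℝ) → ℝ≥0∞} (hψ : ∀ i, Measurable (ψ i)) :
    (treeLaw (Measure.infinitePi fun _ : Fin n => gaussianReal 0 1)).map
        (fun ω => Φ fun i => gaussTree ζ β (ψ i) ω) =
      (treeLaw (Measure.infinitePi fun _ : Fin n => (volume : Measure unitInterval))).map
        (fun ω => Φ fun i => tiltTree ζ β (ψ i) ω) := by
  have hW := fun p => measurable_levelWeight (n := n) (ζ := ζ) hβ p
  have hs' := fun p => measurable_tiltStep (n := n) (ζ := ζ) hβ p
  have hg : Measurable fun ω i => gaussTree ζ β (ψ i) ω :=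
    measurable_pi_iff.2 fun i => measurable_gaussTree hβ (hψ i)
  have ht : Measurable fun ω i => tiltTree ζ β (ψ i) ω :=
    measurable_pi_iff.2 fun i => measurable_tiltTree hβ (hψ i)
  refine Measure.ext_of_lintegral _ fun f hf => ?_
  have hg' : Measurable fun ω => Φ fun i => gaussTree ζ β (ψ i) ω := hΦ.comp hg
  have ht' : Measurable fun ω => Φ fun i => tiltTree ζ β (ψ i) ω := hΦ.comp ht
  rw [lintegral_map hf hg', lintegral_map hf ht']
  have hG : Measurable (Function.uncurry fun (s : Fin n → ℝ) ω => f (Φ fun i =>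
      treeSum (fun s => levelWeight ζ β ζ.r s * ψ i s) ζ.r (param ζ) (gaussStep ζ β) s ω)) :=
    hf.comp (hΦ.comp (measurable_pi_iff.2 fun i =>
      measurable_treeSum ((hW ζ.r).mul (hψ i)) ζ.r (param ζ) measurable_gaussStep))
  have hT : Measurable (Function.uncurry fun (s : Fin n → ℝ) ω => f (Φ fun i =>
      treeSum (ψ i) ζ.r (param ζ) (tiltStep ζ β) s ω)) :=
    hf.comp (hΦ.comp (measurable_pi_iff.2 fun i =>
      measurable_treeSum (hψ i) ζ.r (param ζ) hs'))
  -- The root increments are frozen first. Given them, the factor exp(X_0) relating the two trees is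
  -- a constant; without this conditioning it would be random.
  have hroot1 := lintegral_treeLaw_root
    (ν := Measure.infinitePi fun _ : Fin n => gaussianReal 0 1)
    (Φ := fun z ω => f (Φ fun i => treeSum (fun s => levelWeight ζ β ζ.r s * ψ i s) ζ.r (param ζ)
      (gaussStep ζ β) (gaussRoot ζ β z) ω))
    (hG.comp ((measurable_gaussRoot.comp measurable_fst).prodMk measurable_snd))
    (fun z ω ω' h0 h1 => by simp_rw [treeSum_congr_root _ _ _ _ _ h0 h1])
  have hroot2 := lintegral_treeLaw_root
    (ν := Measure.infinitePi fun _ : Fin n => (volume : Measure unitInterval))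
    (Φ := fun z ω => f (Φ fun i => treeSum (ψ i) ζ.r (param ζ) (tiltStep ζ β)
      (tiltRoot ζ β z) ω))
    (hT.comp ((measurable_tiltRoot.comp measurable_fst).prodMk measurable_snd))
    (fun z ω ω' h0 h1 => by simp_rw [treeSum_congr_root _ _ _ _ _ h0 h1])
  refine hroot1.trans (Eq.trans ?_ hroot2.symm)
  have hfix : ∀ s, ∫⁻ ω, f (Φ fun i => treeSum (fun s => levelWeight ζ β ζ.r s * ψ i s) ζ.r
      (param ζ) (gaussStep ζ β) s ω)
        ∂treeLaw (Measure.infinitePi fun _ : Fin n => gaussianReal 0 1) =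
      ∫⁻ ω, f (Φ fun i => treeSum (ψ i) ζ.r (param ζ) (tiltStep ζ β) s ω)
        ∂treeLaw (Measure.infinitePi fun _ : Fin n => (volume : Measure unitInterval)) := fun s => by
    have hmap := map_treeSum_tilt (param_mem ζ) (fun p => measurable_gaussStep (n := n) (ζ := ζ)
      (β := β) p) hs' hW (ν := Measure.infinitePi fun _ : Fin n => gaussianReal 0 1)
      (ν' := Measure.infinitePi fun _ : Fin n => (volume : Measure unitInterval))
      (fun p hp s f hf => lintegral_levelWeight_gaussStep hβ hp s hf) hψ s
    have h1 : Measurable fun ω i => treeSum (fun s => levelWeight ζ β ζ.r s * ψ i s) ζ.r (param ζ)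
        (gaussStep ζ β) s ω := measurable_pi_iff.2 fun i =>
      measurable_treeSum_right ((hW ζ.r).mul (hψ i)) ζ.r (param ζ) measurable_gaussStep s
    have h2 : Measurable fun ω i => levelWeight ζ β 0 s * treeSum (ψ i) ζ.r (param ζ)
        (tiltStep ζ β) s ω := measurable_pi_iff.2 fun i =>
      (measurable_treeSum_right (hψ i) ζ.r (param ζ) hs' s).const_mul _
    have e1 := lintegral_map (μ := treeLaw (Measure.infinitePi fun _ : Fin n => gaussianReal 0 1))
      (hf.comp hΦ) h1
    have e2 := lintegral_map (μ := treeLaw (Measure.infinitePi fun _ : Fin n =>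
      (volume : Measure unitInterval))) (hf.comp hΦ) h2
    rw [hmap] at e1
    refine e1.symm.trans (e2.trans (lintegral_congr fun ω => ?_))
    -- The constant is positive and finite, so homogeneity of degree zero removes it.
    exact congrArg f (hhom _ _ (by simp [levelWeight, Real.exp_pos]) ENNReal.ofReal_ne_top)
  simp_rw [hfix]
  have hm := hT.lintegral_prod_right'
    (ν := treeLaw (Measure.infinitePi fun _ : Fin n => (volume : Measure unitInterval)))
  have e1 := lintegral_map (μ := Measure.infinitePi fun _ : Fin n => gaussianReal 0 1) hm
    (measurable_gaussRoot (ζ := ζ) (β := β))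
  have e2 := lintegral_map (μ := Measure.infinitePi fun _ : Fin n =>
    (volume : Measure unitInterval)) hm (measurable_tiltRoot (ζ := ζ) (β := β))
  rw [map_gaussRoot hβ] at e1
  exact e1.symm.trans e2

theorem pathState_gauss (g : FieldNoise n) (α : Leaf ζ.r) (p : ℕ) :
    pathState (gaussStep ζ β) (gaussRoot ζ β fun i => g (i, [])) (fun b i => g (i, b)) α p =
      fun i => ∑ j ∈ Finset.range (p + 1), √(ζ.incVar β j) * g (i, ancestor α j) := by
  induction p with
  | zero =>
    simp only [pathState, zero_add, Finset.sum_range_one, ancestor_zero]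
    rfl
  | succ p ih =>
    funext i
    rw [pathState, ih, gaussStep, Finset.sum_range_succ _ (p + 1)]

/-- A path to depth p carries p + 1 increments, the root included. Away from the endpoints of [0,1]
the modified quantile is the quantile, so the state is the sum of the sampled increments. -/
theorem pathState_tilt (hβ : ∀ p : ℕ, 2 ≤ p → |β p| ≤ 1 / (p : ℝ) ^ 2) {U : UniformNoise n}
    (hU : ∀ b, 0 < (U b : ℝ) ∧ (U b : ℝ) < 1) (α : Leaf ζ.r) (p : ℕ) (hp : p ≤ ζ.r) :
    pathState (tiltStep ζ β) (tiltRoot ζ β fun i => U (i, [])) (fun b i => U (i, b)) α p =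
      fun i => (tiltedIncrements ζ β U i α (p + 1)).sum := by
  induction p with
  | zero =>
    funext i
    simp only [pathState, tiltRoot, openQuantile, tiltedIncrements, tiltedKernel, ancestor_zero,
      List.nil_append, List.sum_singleton]
    exact if_pos (hU _)
  | succ p ih =>
    funext i
    have hp' : p < ζ.r := hp
    have e : tiltedIncrements ζ β U i α (p + 1 + 1) = tiltedIncrements ζ β U i α (p + 1) ++
      [quantile (tiltedKernel ζ β (p + 1) (tiltedIncrements ζ β U i α (p + 1)))
        (U (i, ancestor α (p + 1)))] := rfl
    rw [pathState, ih hp'.le, tiltStep, e, List.sum_append, List.sum_singleton,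
      tiltedKernel_succ hβ]
    congr 1
    rw [sampleInc, if_pos hp', openQuantile, if_pos (hU _)]

theorem levelWeight_last (s : Fin n → ℝ) :
    levelWeight ζ β ζ.r s = ENNReal.ofReal (∏ i, gaussTilt ζ β (s i)) := by
  simp only [levelWeight, level_last, Real.exp_sum, gaussTilt]

theorem gaussTree_nodeData (ψ : (Fin n → ℝ) → ℝ≥0∞) (ω : CascadeNoise × FieldNoise n)
    (hε : ∀ b, 0 < ω.1 b) :
    gaussTree ζ β ψ (nodeData ω) = ∑' α : Leaf ζ.r, ENNReal.ofReal (ζ.rawWeight ω.1 α) *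
      (ENNReal.ofReal (∏ i, gaussTilt ζ β (cavityField ζ β ω.2 i α)) *
        ψ fun i => cavityField ζ β ω.2 i α) := by
  refine (treeSum_nodeData ζ _ _ _ ω hε).trans (tsum_congr fun α => ?_)
  rw [← levelWeight_last]
  have h := pathState_gauss (ζ := ζ) (β := β) ω.2 α ζ.r
  exact congrArg (fun s => ENNReal.ofReal (ζ.rawWeight ω.1 α) *
    (levelWeight ζ β ζ.r s * ψ s)) h

theorem tiltTree_nodeData (hβ : ∀ p : ℕ, 2 ≤ p → |β p| ≤ 1 / (p : ℝ) ^ 2)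
    (ψ : (Fin n → ℝ) → ℝ≥0∞) (ω : CascadeNoise × UniformNoise n) (hε : ∀ b, 0 < ω.1 b)
    (hU : ∀ b, 0 < (ω.2 b : ℝ) ∧ (ω.2 b : ℝ) < 1) :
    tiltTree ζ β ψ (nodeData ω) = ∑' α : Leaf ζ.r, ENNReal.ofReal (ζ.rawWeight ω.1 α) *
      ψ fun i => tiltedField ζ β ω.2 i α := by
  refine (treeSum_nodeData ζ _ _ _ ω hε).trans (tsum_congr fun α => ?_)
  have h := pathState_tilt (ζ := ζ) (β := β) hβ hU α ζ.r le_rfl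
  exact congrArg (fun s => ENNReal.ofReal (ζ.rawWeight ω.1 α) * ψ s) h

end TreeFields


/-! ### Equality of the Gibbs and tilted expectations -/

section TiltedExpectation

variable {ζ : FiniteRSB} {β : ℕ → ℝ} {k n : ℕ}

/-- `∏_i ρ_ζ^{s_i}(s^{d_i})`. -/
def spinMean (ζ : FiniteRSB) (β : ℕ → ℝ) (d : Fin n → ℕ) (s : Fin n → ℝ) : ℝ :=
  ∏ i, ζ.rho β (s i) fun t => t ^ d i

theorem measurable_spinMean (hβ : ∀ p : ℕ, 2 ≤ p → |β p| ≤ 1 / (p : ℝ) ^ 2) (d : Fin n → ℕ) :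
    Measurable (spinMean ζ β d) := by
  refine Finset.measurable_prod _ fun i _ => ?_
  have e : (fun s : Fin n → ℝ => ζ.rho β (s i) fun t => t ^ d i) = fun s =>
      momentOn (gaussCoeff ζ β) Set.univ (d i) (s i) / momentOn (gaussCoeff ζ β) Set.univ 0 (s i) :=
    funext fun s => by rw [rho_eq hβ, fullMoment_eq, fullMoment_eq]
  rw [e]
  exact ((measurable_momentOn _ _ _).comp (measurable_pi_apply i)).div
    ((measurable_momentOn _ _ _).comp (measurable_pi_apply i))

/-- The functions of the fields whose weighted sums enter the ratios: the constant function, and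
the positive and negative parts of the means of the spins. -/
def ratioPart (ζ : FiniteRSB) (β : ℕ → ℝ) (e : Fin k → Fin n → ℕ) :
    Option (Fin k × Bool) → (Fin n → ℝ) → ℝ≥0∞
  | none, _ => 1
  | some (l, true), s => ENNReal.ofReal (spinMean ζ β (e l) s)
  | some (l, false), s => ENNReal.ofReal (-spinMean ζ β (e l) s)

theorem measurable_ratioPart (hβ : ∀ p : ℕ, 2 ≤ p → |β p| ≤ 1 / (p : ℝ) ^ 2)
    (e : Fin k → Fin n → ℕ) (j : Option (Fin k × Bool)) : Measurable (ratioPart ζ β e j) := by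
  rcases j with - | ⟨l, - | -⟩
  · exact measurable_const
  · exact (measurable_spinMean hβ (e l)).neg.ennreal_ofReal
  · exact (measurable_spinMean hβ (e l)).ennreal_ofReal

/-- The product of ratios as a function of the weighted sums. -/
def ratioOf (v : Option (Fin k × Bool) → ℝ≥0∞) : ℝ :=
  ∏ l, ((v (some (l, true))).toReal - (v (some (l, false))).toReal) / (v none).toReal

theorem measurable_ratioOf : Measurable (ratioOf (k := k)) := by
  unfold ratioOf
  fun_prop

theorem ratioOf_const_mul (c : ℝ≥0∞) (v : Option (Fin k × Bool) → ℝ≥0∞) (h0 : c ≠ 0)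
    (h1 : c ≠ ⊤) : ratioOf (fun j => c * v j) = ratioOf v := by
  rw [ratioOf, ratioOf]
  refine Finset.prod_congr rfl fun l _ => ?_
  rw [ENNReal.toReal_mul, ENNReal.toReal_mul, ENNReal.toReal_mul, ← mul_sub,
    mul_div_mul_left _ _ (ENNReal.toReal_ne_zero.2 ⟨h0, h1⟩)]

/-- Leaf sums take values in [0,∞], whereas the spin means are signed; summability makes their
positive and negative parts separately finite. The normalisation of the weights cancels between
numerator and denominator. -/
theorem ae_finite_gaussTree (hβ : ∀ p : ℕ, 2 ≤ p → |β p| ≤ 1 / (p : ℝ) ^ 2)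
    (e : Fin k → Fin n → ℕ) : ∀ᵐ ω ∂(cavityLaw n),
      (∀ j, gaussTree ζ β (ratioPart ζ β e j) (nodeData ω) < ⊤) ∧
      replicaRatio ζ β (fun l i => rhoMoment ζ β (e l i)) (gaussTilt ζ β) ω =
        ratioOf fun j => gaussTree ζ β (ratioPart ζ β e j) (nodeData ω) := by
  filter_upwards [(ratioWellDefined_rhoMoment (ζ := ζ) hβ e).1,
    ae_prod_of_cascadeLaw ae_cascadeLaw_pos, ae_prod_of_cascadeLaw (ae_rawWeight ζ)]
    with ω ⟨h1, h2, h3⟩ hε ⟨hr1, hr2, hr3⟩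
  set Z := ∑' γ : Leaf ζ.r, ζ.rawWeight ω.1 γ with hZ
  have hraw : ∀ α, ζ.rawWeight ω.1 α = Z * ζ.weight ω.1 α := fun α => by
    rw [FiniteRSB.weight, mul_div_cancel₀ _ hr3.ne']
  have hT : ∀ α : Leaf ζ.r, 0 < ∏ i, gaussTilt ζ β (cavityField ζ β ω.2 i α) := fun α =>
    Finset.prod_pos fun i _ => Real.exp_pos _
  have hA : ∀ (l : Fin k) (α : Leaf ζ.r),
      ∏ i, rhoMoment ζ β (e l i) (cavityField ζ β ω.2 i α) =
      (∏ i, gaussTilt ζ β (cavityField ζ β ω.2 i α)) *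
        spinMean ζ β (e l) fun i => cavityField ζ β ω.2 i α := fun l α => by
    rw [spinMean, ← Finset.prod_mul_distrib]
    exact Finset.prod_congr rfl fun i _ => mul_comm _ _
  have hnone : gaussTree ζ β (ratioPart ζ β e none) (nodeData ω) =
      ∑' α : Leaf ζ.r, ENNReal.ofReal (Z * (ζ.weight ω.1 α *
        ∏ i, gaussTilt ζ β (cavityField ζ β ω.2 i α))) := by
    rw [gaussTree_nodeData _ ω hε]
    refine tsum_congr fun α => ?_
    rw [ratioPart, mul_one, ← ENNReal.ofReal_mul (hr1 α).le, hraw, mul_assoc]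
  have htrue : ∀ l, gaussTree ζ β (ratioPart ζ β e (some (l, true))) (nodeData ω) =
      ∑' α : Leaf ζ.r, ENNReal.ofReal (Z * (ζ.weight ω.1 α *
        ∏ i, rhoMoment ζ β (e l i) (cavityField ζ β ω.2 i α))) := fun l => by
    rw [gaussTree_nodeData _ ω hε]
    refine tsum_congr fun α => ?_
    rw [ratioPart, ← ENNReal.ofReal_mul (hT α).le, ← ENNReal.ofReal_mul (hr1 α).le, hA, hraw,
      mul_assoc]
  have hfalse : ∀ l, gaussTree ζ β (ratioPart ζ β e (some (l, false))) (nodeData ω) =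
      ∑' α : Leaf ζ.r, ENNReal.ofReal (-(Z * (ζ.weight ω.1 α *
        ∏ i, rhoMoment ζ β (e l i) (cavityField ζ β ω.2 i α)))) := fun l => by
    rw [gaussTree_nodeData _ ω hε]
    refine tsum_congr fun α => ?_
    rw [ratioPart, ← ENNReal.ofReal_mul (hT α).le, ← ENNReal.ofReal_mul (hr1 α).le, hA, hraw,
      mul_neg, mul_neg, mul_assoc]
  have hs1 := fun l => (h1 l).mul_left Z
  have hs2 := h2.mul_left Z
  constructor
  · rintro (- | ⟨l, - | -⟩)
    · rw [hnone]
      exact hs2.tsum_ofReal_lt_top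
    · rw [hfalse]
      exact (hs1 l).neg.tsum_ofReal_lt_top
    · rw [htrue]
      exact (hs1 l).tsum_ofReal_lt_top
  · rw [replicaRatio, ratioOf]
    refine Finset.prod_congr rfl fun l _ => ?_
    rw [htrue, hfalse, hnone, ← (hasSum_of_tsum_ofReal_lt_top (hs1 l).tsum_ofReal_lt_top
      (hs1 l).neg.tsum_ofReal_lt_top).tsum_eq, ← ENNReal.ofReal_tsum_of_nonneg ?_ hs2,
      ENNReal.toReal_ofReal ?_, tsum_mul_left, tsum_mul_left, mul_div_mul_left _ _ hr3.ne']
    · rfl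
    · rw [tsum_mul_left]
      exact mul_nonneg hr3.le h3.le
    · intro α
      rw [← mul_assoc, ← hraw]
      exact mul_nonneg (hr1 α).le (hT α).le

theorem map_nodeData_cavityLaw : (cavityLaw n).map nodeData =
    treeLaw (Measure.infinitePi fun _ : Fin n => gaussianReal 0 1) :=
  map_nodeData (gaussianReal 0 1)

theorem map_nodeData_tiltedLaw : (tiltedLaw n).map nodeData =
    treeLaw (Measure.infinitePi fun _ : Fin n => (volume : Measure unitInterval)) :=
  map_nodeData (volume : Measure unitInterval)

theorem ae_uniformLaw : ∀ᵐ U ∂(uniformLaw n), ∀ b, 0 < (U b : ℝ) ∧ (U b : ℝ) < 1 := by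
  rw [ae_all_iff]
  intro b
  have h := (measurePreserving_eval_infinitePi
    (fun _ : Fin n × List ℕ => (volume : Measure unitInterval)) b).quasiMeasurePreserving.ae
      ae_unitInterval
  exact h

/-- The sums over the leaves for the tilted fields are almost surely finite. -/
theorem ae_finite_tiltTree (hβ : ∀ p : ℕ, 2 ≤ p → |β p| ≤ 1 / (p : ℝ) ^ 2)
    (e : Fin k → Fin n → ℕ) : ∀ᵐ ω ∂(tiltedLaw n),
      ∀ j, tiltTree ζ β (ratioPart ζ β e j) (nodeData ω) < ⊤ := by
  -- Finiteness is itself a homogeneous functional of degree zero, here with values in `Prop`, so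
  -- the identity in law transports it from the Gaussian to the tilted tree.
  have hΦ : Measurable fun v : Option (Fin k × Bool) → ℝ≥0∞ => ∀ j, v j < ⊤ := by
    refine measurableSet_setOfPred.1 ?_
    simp only [Set.ofPred_forall]
    exact MeasurableSet.iInter fun j => measurableSet_lt (measurable_pi_apply j) measurable_const
  have hmap := map_gaussTree_eq_map_tiltTree (ζ := ζ) hβ hΦ
    (fun c v h0 h1 => by
      refine propext (forall_congr' fun j => ?_)
      rw [lt_top_iff_ne_top, lt_top_iff_ne_top, Ne, Ne, ENNReal.mul_eq_top]
      simp [h0, h1])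
    (measurable_ratioPart (ζ := ζ) hβ e)
  have hg : Measurable fun ω => ∀ j, gaussTree ζ β (ratioPart ζ β e j) ω < ⊤ :=
    hΦ.comp (measurable_pi_iff.2 fun j => measurable_gaussTree hβ (measurable_ratioPart hβ e j))
  have ht : Measurable fun ω => ∀ j, tiltTree ζ β (ratioPart ζ β e j) ω < ⊤ :=
    hΦ.comp (measurable_pi_iff.2 fun j => measurable_tiltTree hβ (measurable_ratioPart hβ e j))
  have hset : MeasurableSet {P : Prop | P} := trivial
  have h1 : ∀ᵐ ω ∂treeLaw (Measure.infinitePi fun _ : Fin n => gaussianReal 0 1),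
      ∀ j, gaussTree ζ β (ratioPart ζ β e j) ω < ⊤ := by
    rw [← map_nodeData_cavityLaw, ae_map_iff measurable_nodeData.aemeasurable
      (measurableSet_setOfPred.2 hg)]
    exact (ae_finite_gaussTree hβ e).mono fun ω h => h.1
  have h2 := (ae_map_iff (p := fun P : Prop => P) hg.aemeasurable hset).2 h1
  rw [hmap, ae_map_iff ht.aemeasurable hset, ← map_nodeData_tiltedLaw] at h2
  exact ae_of_ae_map measurable_nodeData.aemeasurable h2

/-- Convergence of the signed series follows from the transported finiteness of both parts; dividing
by the total raw weight passes from raw to normalised weights. -/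
theorem ae_tilted (hβ : ∀ p : ℕ, 2 ≤ p → |β p| ≤ 1 / (p : ℝ) ^ 2)
    (e : Fin k → Fin n → ℕ) : ∀ᵐ ω ∂(tiltedLaw n),
      (∀ l, Summable fun α : Leaf ζ.r => ζ.weight ω.1 α * tiltedMoment ζ β (e l) ω.2 α) ∧
      tiltedProduct ζ β e ω =
        ratioOf fun j => tiltTree ζ β (ratioPart ζ β e j) (nodeData ω) := by
  have : IsProbabilityMeasure (uniformLaw n) := by unfold uniformLaw; infer_instance
  filter_upwards [ae_finite_tiltTree (ζ := ζ) hβ e, ae_prod_of_cascadeLaw ae_cascadeLaw_pos,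
    ae_prod_of_cascadeLaw (ae_rawWeight ζ),
    (Measure.quasiMeasurePreserving_snd (μ := cascadeLaw)).ae (ae_uniformLaw (n := n))]
    with ω hfin hε ⟨hr1, hr2, hr3⟩ hU
  have hnone : tiltTree ζ β (ratioPart ζ β e none) (nodeData ω) =
      ∑' α : Leaf ζ.r, ENNReal.ofReal (ζ.rawWeight ω.1 α) := by
    rw [tiltTree_nodeData hβ _ ω hε hU]
    simp [ratioPart]
  have htrue : ∀ l, tiltTree ζ β (ratioPart ζ β e (some (l, true))) (nodeData ω) =
      ∑' α : Leaf ζ.r, ENNReal.ofReal (ζ.rawWeight ω.1 α * tiltedMoment ζ β (e l) ω.2 α) :=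
    fun l => by
      rw [tiltTree_nodeData hβ _ ω hε hU]
      refine tsum_congr fun α => ?_
      rw [ratioPart, ← ENNReal.ofReal_mul (hr1 α).le]
      rfl
  have hfalse : ∀ l, tiltTree ζ β (ratioPart ζ β e (some (l, false))) (nodeData ω) =
      ∑' α : Leaf ζ.r, ENNReal.ofReal (-(ζ.rawWeight ω.1 α * tiltedMoment ζ β (e l) ω.2 α)) :=
    fun l => by
      rw [tiltTree_nodeData hβ _ ω hε hU]
      refine tsum_congr fun α => ?_
      rw [ratioPart, ← ENNReal.ofReal_mul (hr1 α).le, mul_neg]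
      rfl
  have hsum := fun l => hasSum_of_tsum_ofReal_lt_top
    ((htrue l).symm.trans_lt (hfin (some (l, true))))
    ((hfalse l).symm.trans_lt (hfin (some (l, false))))
  have hw : ∀ l, HasSum (fun α : Leaf ζ.r => ζ.weight ω.1 α * tiltedMoment ζ β (e l) ω.2 α) _ :=
    fun l => by
      have h := (hsum l).div_const (∑' γ : Leaf ζ.r, ζ.rawWeight ω.1 γ)
      refine (congrArg (fun f => HasSum f _) (funext fun α => ?_)).mp h
      rw [FiniteRSB.weight, div_mul_eq_mul_div]
  refine ⟨fun l => (hw l).summable, ?_⟩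
  rw [tiltedProduct, ratioOf]
  refine Finset.prod_congr rfl fun l _ => ?_
  rw [(hw l).tsum_eq, htrue, hfalse, hnone, ← ENNReal.ofReal_tsum_of_nonneg
    (fun α => (hr1 α).le) hr2, ENNReal.toReal_ofReal hr3.le]

/-- Both variables are almost surely the same degree-zero function `ratioOf` of corresponding tree
sums. Equality in law yields integrability of the tilted product and equality of the expectations
together. -/
theorem map_ratioOf (hβ : ∀ p : ℕ, 2 ≤ p → |β p| ≤ 1 / (p : ℝ) ^ 2) (e : Fin k → Fin n → ℕ) :
    (cavityLaw n).map
        (replicaRatio ζ β (fun l i => rhoMoment ζ β (e l i)) (gaussTilt ζ β)) =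
      (tiltedLaw n).map (tiltedProduct ζ β e) := by
  have hg : Measurable fun ω => ratioOf fun j => gaussTree ζ β (ratioPart ζ β e j) ω :=
    measurable_ratioOf.comp (measurable_pi_iff.2 fun j =>
      measurable_gaussTree hβ (measurable_ratioPart hβ e j))
  have ht : Measurable fun ω => ratioOf fun j => tiltTree ζ β (ratioPart ζ β e j) ω :=
    measurable_ratioOf.comp (measurable_pi_iff.2 fun j =>
      measurable_tiltTree hβ (measurable_ratioPart hβ e j))
  have hmap := map_gaussTree_eq_map_tiltTree (ζ := ζ) hβ measurable_ratioOf ratioOf_const_mul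
    (measurable_ratioPart (ζ := ζ) hβ e)
  rw [← map_nodeData_cavityLaw, ← map_nodeData_tiltedLaw, Measure.map_map hg measurable_nodeData,
    Measure.map_map ht measurable_nodeData] at hmap
  rw [Measure.map_congr ((ae_finite_gaussTree (ζ := ζ) hβ e).mono fun ω h => h.2),
    Measure.map_congr ((ae_tilted (ζ := ζ) hβ e).mono fun ω h => h.2)]
  exact hmap

theorem aemeasurable_tiltedProduct (hβ : ∀ p : ℕ, 2 ≤ p → |β p| ≤ 1 / (p : ℝ) ^ 2)
    (e : Fin k → Fin n → ℕ) : AEMeasurable (tiltedProduct ζ β e) (tiltedLaw n) := by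
  have ht : Measurable fun ω => ratioOf fun j => tiltTree ζ β (ratioPart ζ β e j) ω :=
    measurable_ratioOf.comp (measurable_pi_iff.2 fun j =>
      measurable_tiltTree hβ (measurable_ratioPart hβ e j))
  exact ⟨_, ht.comp measurable_nodeData, (ae_tilted (ζ := ζ) hβ e).mono fun ω h => h.2⟩

theorem tiltedWellDefined (hβ : ∀ p : ℕ, 2 ≤ p → |β p| ≤ 1 / (p : ℝ) ^ 2)
    (e : Fin k → Fin n → ℕ) : TiltedWellDefined ζ β e := by
  refine ⟨(ae_tilted hβ e).mono fun ω h => h.1, ?_⟩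
  have h := (ratioWellDefined_rhoMoment (ζ := ζ) hβ e).2
  have h1 := (integrable_map_measure (g := id) aestronglyMeasurable_id
    h.aestronglyMeasurable.aemeasurable).2 h
  rw [map_ratioOf hβ] at h1
  exact (integrable_map_measure aestronglyMeasurable_id (aemeasurable_tiltedProduct hβ e)).1 h1

theorem rhoExpectation_eq_tiltedExpectation (hβ : ∀ p : ℕ, 2 ≤ p → |β p| ≤ 1 / (p : ℝ) ^ 2)
    (e : Fin k → Fin n → ℕ) : rhoExpectation ζ β e = tiltedExpectation ζ β e := by
  have h := (ratioWellDefined_rhoMoment (ζ := ζ) hβ e).2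
  have h1 := integral_map (f := id) h.aestronglyMeasurable.aemeasurable aestronglyMeasurable_id
  have h2 := integral_map (f := id) (aemeasurable_tiltedProduct (ζ := ζ) hβ e)
    aestronglyMeasurable_id
  rw [map_ratioOf hβ] at h1
  exact h1.symm.trans h2

end TiltedExpectation

end

theorem lemma3 (β : ℕ → ℝ) (hβ : ∀ p : ℕ, 2 ≤ p → |β p| ≤ 1 / (p : ℝ) ^ 2)
    {k n : ℕ} (e : Fin k → Fin n → ℕ) :
    (∀ ζ : FiniteRSB,
      (∀ᵐ ε ∂cascadeLaw, (Summable fun α : Leaf ζ.r => ζ.rawWeight ε α) ∧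
        0 < ∑' α : Leaf ζ.r, ζ.rawWeight ε α) ∧
      (∀ C : ℝ, 0 < C →
        RatioWellDefined ζ β (fun l i => cutMoment ζ β C (e l i)) (cutMoment ζ β C 0)) ∧
      RatioWellDefined ζ β (fun l i => fullMoment ζ β (e l i)) (fullMoment ζ β 0) ∧
      RatioWellDefined ζ β (fun l i => rhoMoment ζ β (e l i)) (gaussTilt ζ β) ∧
      TiltedWellDefined ζ β e ∧
      Tendsto (fun C : ℝ => cutoffExpectation ζ β e C) atTop (𝓝 (fullExpectation ζ β e)) ∧
      fullExpectation ζ β e = rhoExpectation ζ β e ∧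
      rhoExpectation ζ β e = tiltedExpectation ζ β e) ∧
    (∀ (ζstar : ProbabilityMeasure ℝ) (ζ : ℕ → FiniteRSB),
      Tendsto (fun j => (ζ j).law) atTop (𝓝 ζstar) →
      TendstoUniformly (fun (C : ℝ) (j : ℕ) => cutoffExpectation (ζ j) β e C)
        (fun j => fullExpectation (ζ j) β e) atTop) := by
  constructor
  · intro ζ
    refine ⟨(ae_rawWeight ζ).mono fun ε h => h.2, fun C hC => ratioWellDefined_cutMoment hβ e hC,
      ratioWellDefined_fullMoment hβ e, ratioWellDefined_rhoMoment hβ e, tiltedWellDefined hβ e,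
      ?_, fullExpectation_eq_rhoExpectation hβ e, rhoExpectation_eq_tiltedExpectation hβ e⟩
    -- The rate `cutoffError` depends on e and C only; it also gives the uniform statement below.
    rw [tendsto_iff_dist_tendsto_zero]
    refine squeeze_zero' (Eventually.of_forall fun C => dist_nonneg) ?_ (tendsto_cutoffError e)
    filter_upwards [eventually_ge_atTop 1] with C hC
    rw [Real.dist_eq]
    exact abs_cutoffExpectation_sub_le hβ e hC
  · intro _ ζ _
    rw [Metric.tendstoUniformly_iff]
    intro ε hε
    filter_upwards [eventually_ge_atTop 1, (tendsto_cutoffError e).eventually_lt_const hε]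
      with C hC hlt j
    rw [dist_comm, Real.dist_eq]
    exact (abs_cutoffExpectation_sub_le hβ e hC).trans_lt hlt
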